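/- **Capacitated Sum of Radii.** An instance consists of a set $P$ of $n\ge 1$ points in a metric space with distance $\mathsf{dist}$, a non-negative integer capacity $\eta_q$ for each $q\in P$, and a non-negative integer $k$. A feasible solution consists of a set $C\subseteq P$ of exactly $k$ (distinct) centers, a non-negative integer radius $r_q$ for each $q\in C$, and an assignment $\mu:P\to C$ such that $\mathsf{dist}(p,\mu(p))\le r_{\mu(p)}$ for every $p\in P$ and $|\mu^{-1}(q)|\le \eta_q$ for every $q\in C$. Its cost is $\sum_{q\in C} r_q$. **Theorem.** For every constant $\epsilon>0$ there are a deterministic algorithm and a constant $c$, both depending only on $\epsilon$, such that on every instance, given by $n$, $k$, the capacities and the pairwise distances of the points, the algorithm halts after at most $c\cdot 2^{c\,k^2\log_2 k}\cdot n^3$ steps (with $k^2\log_2 k$ read as $0$ for $k=0$); it outputs a feasible solution $(C,(r_q)_{q\in C},\mu)$ whose cost is at most $(15+\epsilon)$ times the cost of every feasible solution if a feasible solution exists, and otherwise it reports that there is none. In short, Capacitated Sum of Radii with non-uniform hard capacities in a general metric admits a $(15+\epsilon)$-approximation in time $2^{O(k^2\log k)}\cdot n^3$. Here an algorithm is a program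 of a unit-cost random access machine with cells for natural numbers and cells for real numbers, whose operations are indirect reading and writing, comparison, addition, subtraction and halving (and, for reals, rounding up to an integer and conversion from a natural number); each operation counts as one step. -/

import Mathlib

/-!
Capacitated Sum of Radii in a general metric, and the random access machine on which running
times are counted.
-/

namespace CSR

/-! ### The problem -/

/-- A candidate solution for `n` points: a set of centers, an integer radius for each center
(the values of `radius` outside `centers` play no role), and an assignment of points. -/
structure Solution (n : ℕ) where
  centers : Finset (Fin n)
  radius : Fin n → ℕ
  assign : Fin n → Fin n

/-- Feasibility for the points `P`, the number `k` of clusters and the hard capacities `η`. -/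
structure Solution.Feasible {n : ℕ} {X : Type*} [MetricSpace X] (P : Fin n ↪ X) (k : ℕ)
    (η : Fin n → ℕ) (S : Solution n) : Prop where
  card_centers : S.centers.card = k
  assign_mem : ∀ i, S.assign i ∈ S.centers
  dist_le : ∀ i, dist (P i) (P (S.assign i)) ≤ S.radius (S.assign i)
  capacity : ∀ q ∈ S.centers, (Finset.univ.filter fun i => S.assign i = q).card ≤ η q

/-- The objective: the sum of the radii. -/
def Solution.cost {n : ℕ} (S : Solution n) : ℕ := ∑ q ∈ S.centers, S.radius q

/-! ### The machine

A unit-cost random access machine, given by structured programs. A program has a fixed finite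
number of arrays (their names are constants in its text) of natural numbers and of reals, with
computed indices. There is no multiplication, so that the unit cost of the operations (in
particular of the rounding of reals) is realistic, and there is no conversion of reals to natural
numbers. -/

/-- Expressions for natural numbers. -/
inductive NatExpr : Type
  | const (c : ℕ)
  | read (a : ℕ) (i : NatExpr)
  | add (e f : NatExpr)
  | sub (e f : NatExpr)
  | half (e : NatExpr)

/-- Expressions for reals. -/
inductive RealExpr : Type
  | cast (e : NatExpr)
  | read (a : ℕ) (i : NatExpr)
  | add (e f : RealExpr)
  | sub (e f : RealExpr)
  | half (e : RealExpr)
  | ceil (e : RealExpr)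

/-- Tests. -/
inductive Test : Type
  | natLe (e f : NatExpr)
  | realLe (e f : RealExpr)
  | neg (b : Test)
  | conj (b c : Test)

/-- Programs. `setNat a i e` stores the value of `e` at index `i` of the array `a`. -/
inductive Program : Type
  | skip
  | setNat (a : ℕ) (i : NatExpr) (e : NatExpr)
  | setReal (a : ℕ) (i : NatExpr) (e : RealExpr)
  | seq (p q : Program)
  | cond (b : Test) (p q : Program)
  | loop (b : Test) (p : Program)

/-- The memory: `nat a i` and `real a i` are the contents of the cell `i` of the array `a` of
natural numbers, respectively of reals. -/
structure State : Type where
  nat : ℕ → ℕ → ℕ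
  real : ℕ → ℕ → ℝ

/-- The value of an expression (`sub` is truncated, `half` rounds down). -/
def NatExpr.eval (s : State) : NatExpr → ℕ
  | const c => c
  | read a i => s.nat a (i.eval s)
  | add e f => e.eval s + f.eval s
  | sub e f => e.eval s - f.eval s
  | half e => e.eval s / 2

/-- The number of operations in an expression, each of them counted as one step. -/
def NatExpr.time : NatExpr → ℕ
  | const _ => 1
  | read _ i => i.time + 1
  | add e f => e.time + f.time + 1
  | sub e f => e.time + f.time + 1
  | half e => e.time + 1

/-- The value of an expression (`ceil` rounds up to an integer). -/
noncomputable def RealExpr.eval (s : State) : RealExpr → ℝ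
  | cast e => (e.eval s : ℝ)
  | read a i => s.real a (i.eval s)
  | add e f => e.eval s + f.eval s
  | sub e f => e.eval s - f.eval s
  | half e => e.eval s / 2
  | ceil e => (⌈e.eval s⌉ : ℝ)

/-- The number of operations in an expression, each of them counted as one step. -/
def RealExpr.time : RealExpr → ℕ
  | cast e => e.time + 1
  | read _ i => i.time + 1
  | add e f => e.time + f.time + 1
  | sub e f => e.time + f.time + 1
  | half e => e.time + 1
  | ceil e => e.time + 1

/-- When a test succeeds. -/
def Test.Holds (s : State) : Test → Prop
  | natLe e f => e.eval s ≤ f.eval s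
  | realLe e f => e.eval s ≤ f.eval s
  | neg b => ¬ b.Holds s
  | conj b c => b.Holds s ∧ c.Holds s

/-- The number of operations in a test. -/
def Test.time : Test → ℕ
  | natLe e f => e.time + f.time + 1
  | realLe e f => e.time + f.time + 1
  | neg b => b.time + 1
  | conj b c => b.time + c.time + 1

/-- The memory after storing `v` in the cell `i` of the array `a` of natural numbers. -/
def State.putNat (s : State) (a i v : ℕ) : State where
  nat := Function.update s.nat a (Function.update (s.nat a) i v)
  real := s.real

/-- The memory after storing `v` in the cell `i` of the array `a` of reals. -/
noncomputable def State.putReal (s : State) (a i : ℕ) (v : ℝ) : State where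
  nat := s.nat
  real := Function.update s.real a (Function.update (s.real a) i v)

/-- `Runs p s t s'`: started on the memory `s`, the program `p` halts after exactly `t` steps
with the memory `s'`. -/
inductive Runs : Program → State → ℕ → State → Prop
  | skip (s : State) : Runs .skip s 1 s
  | setNat (s : State) (a : ℕ) (i e : NatExpr) :
      Runs (.setNat a i e) s (i.time + e.time + 1) (s.putNat a (i.eval s) (e.eval s))
  | setReal (s : State) (a : ℕ) (i : NatExpr) (e : RealExpr) :
      Runs (.setReal a i e) s (i.time + e.time + 1) (s.putReal a (i.eval s) (e.eval s))
  | seq {p q : Program} {s s' s'' : State} {t t' : ℕ} :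
      Runs p s t s' → Runs q s' t' s'' → Runs (.seq p q) s (t + t') s''
  | cond_true {b : Test} {p q : Program} {s s' : State} {t : ℕ} :
      b.Holds s → Runs p s t s' → Runs (.cond b p q) s (b.time + t + 1) s'
  | cond_false {b : Test} {p q : Program} {s s' : State} {t : ℕ} :
      ¬ b.Holds s → Runs q s t s' → Runs (.cond b p q) s (b.time + t + 1) s'
  | loop_true {b : Test} {p : Program} {s s' s'' : State} {t t' : ℕ} :
      b.Holds s → Runs p s t s' → Runs (.loop b p) s' t' s'' →
        Runs (.loop b p) s (b.time + t + t' + 1) s''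
  | loop_false {b : Test} {p : Program} {s : State} :
      ¬ b.Holds s → Runs (.loop b p) s (b.time + 1) s

/-! ### Input and output -/

/-- The initial memory. Natural numbers: array `0` holds `n` and `k`, array `1` the capacities.
Reals: array `0` holds the pairwise distances, row by row, the distance of the points `i` and `j`
at index `i * n + j`. All other cells are zero. -/
noncomputable def input {n : ℕ} {X : Type*} [MetricSpace X] (P : Fin n ↪ X) (k : ℕ)
    (η : Fin n → ℕ) : State where
  nat := fun a m =>
    if a = 0 then (if m = 0 then n else if m = 1 then k else 0)
    else if a = 1 then (if h : m < n then η ⟨m, h⟩ else 0)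
    else 0
  real := fun a m =>
    if a = 0 then
      (if h : m < n * n then
        dist (P (Fin.divNat (⟨m, h⟩ : Fin (n * n)))) (P (Fin.modNat (⟨m, h⟩ : Fin (n * n))))
      else 0)
    else 0

/-- The final memory `s` announces that there is no feasible solution. -/
def ReportsInfeasible (s : State) : Prop := s.nat 2 0 = 0

/-- The final memory `s` announces a solution, and `S` is that solution: its centers are marked
in the array `3` of natural numbers, the assignment is the array `4` of natural numbers, and the
radii of the centers are in the array `1` of reals. -/
structure Returns {n : ℕ} (s : State) (S : Solution n) : Prop where
  found : s.nat 2 0 = 1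
  centers : ∀ i : Fin n, i ∈ S.centers ↔ s.nat 3 i = 1
  radius : ∀ i ∈ S.centers, s.real 1 i = S.radius i
  assign : ∀ i : Fin n, s.nat 4 i = S.assign i

end CSR

namespace CSR

/-! ### Reasoning about programs -/

/-! Fix a feasible solution with clusters C_l, centers c_l and radii r_l, ordered by radius. The
program runs through all values of a bounded amount of advice about this solution. Each advice
determines centers, to which the points are assigned by means of Hall's condition, and the cheapest
assignment is kept. Whatever is recorded is feasible, so the theorem rests on one fact: for some
advice the chosen centers can serve all points within radii of total at most 15 times the cost.

Radii. Let R be the largest distance of a point to its center, rounded up. Among k + 1 points of the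
farthest-first traversal two share a cluster, and from this some rounded distance from a traversal
point lies between R/2 and 2R (`Data.Spread.exists_scale`). Divided by a power of two that is at
least 16k, it gives a unit. Rounding each radius up to a multiple of the unit and then down to an
integer gives ρ_l. The total loss is at most an eighth of the cost, and 13(1 + 1/8) ≤ 15
(`exists_grid`).

Centers. A cluster is anchored when a point within 5ρ_l of c_l is known. Its new center is looked
for in the ball of radius 5ρ_l around the anchor, among the k points of largest capacity; by Hall's
theorem these choices can be made distinct and at least as capacious as c_l
(`exists_distinct_ranked`), so a rank below k is enough advice. A free, that is not anchored,
cluster i gets greedily the point that can serve most points within ρ_i, subject to staying more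
than 5ρ_i away from the anchors and the free centers chosen before. If the advice says that c_i is
far from an anchor, the new center must be far from it too.

Progress. If an anchor or a new free center lies within 5ρ_l of the center of a free cluster l, that
cluster can be anchored. If one lies within 3ρ_l of c_l while the anchor of l does not, the anchor
can be improved. Either happens at most once for each cluster, so one of 2k + 1 rounds makes no
progress (`Data.Planted.exists_blocks`).

Service. In such a round Hall's condition holds with the radii 13ρ_l (`Data.Planted.servable`). Each
free cluster i reserves |C_i| points in the ball of radius ρ_i around its new center, and these sets
are disjoint. A reserved point may belong to another cluster; this leads from i to that cluster, and
so on. Along free clusters the radii drop by a factor of more than 4, so a chain that ends in an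
anchored cluster l starts at a cluster i with c_i within 4ρ_l + 2ρ_i of the anchor of l. Without
progress this distance exceeds 5ρ_i, so 3ρ_i < 4ρ_l, and the points of C_i are within ρ_i + (4ρ_l +
2ρ_i) + 5ρ_l < 13ρ_l of the new center of l. The points displaced by reservations can therefore be
absorbed at the ends of chains, and counting gives Hall's condition.

Time. The advice consists of k multiples of the unit and 2k + 1 blocks of 2k + 2 numbers, which are
O(k²) digits in a base at most 64k + 3. There are (k + 1)n units, and a round costs O(n² (k + 1)²
2^k). The programs are verified by triples `Ens` that carry a step bound, together with a frame rule
for arrays that are not written. -/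

/-- Started on `s`, the program `p` halts within `T` steps on a memory satisfying `Q`. -/
def Ens (p : Program) (s : State) (T : ℕ) (Q : State → Prop) : Prop :=
  ∃ t s', Runs p s t s' ∧ t ≤ T ∧ Q s'

/-- The arrays of natural numbers that a program may write to. -/
def Program.natWrites : Program → List ℕ
  | skip => []
  | setNat a _ _ => [a]
  | setReal _ _ _ => []
  | seq p q => p.natWrites ++ q.natWrites
  | cond _ p q => p.natWrites ++ q.natWrites
  | loop _ p => p.natWrites

/-- The arrays of reals that a program may write to. -/
def Program.realWrites : Program → List ℕ
  | skip => []
  | setNat _ _ _ => []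
  | setReal a _ _ => [a]
  | seq p q => p.realWrites ++ q.realWrites
  | cond _ p q => p.realWrites ++ q.realWrites
  | loop _ p => p.realWrites

/-- The memories `s` and `s'` differ at most on the arrays that `p` may write to. -/
structure Frame (p : Program) (s s' : State) : Prop where
  nat : ∀ a, a ∉ p.natWrites → s'.nat a = s.nat a
  real : ∀ a, a ∉ p.realWrites → s'.real a = s.real a

@[simp] theorem State.putNat_nat (s : State) (a i v b : ℕ) :
    (s.putNat a i v).nat b = if b = a then Function.update (s.nat a) i v else s.nat b := by
  by_cases h : b = a
  · subst h; simp [State.putNat]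
  · simp [State.putNat, h]

@[simp] theorem State.putNat_real (s : State) (a i v : ℕ) : (s.putNat a i v).real = s.real := rfl

@[simp] theorem State.putReal_nat (s : State) (a i : ℕ) (v : ℝ) :
    (s.putReal a i v).nat = s.nat := rfl

@[simp] theorem State.putReal_real (s : State) (a i : ℕ) (v : ℝ) (b : ℕ) :
    (s.putReal a i v).real b = if b = a then Function.update (s.real a) i v else s.real b := by
  by_cases h : b = a
  · subst h; simp [State.putReal]
  · simp [State.putReal, h]

theorem Frame.refl (p : Program) (s : State) : Frame p s s := ⟨fun _ _ => rfl, fun _ _ => rfl⟩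

theorem Frame.trans {p : Program} {s s' s'' : State} (h : Frame p s s') (h' : Frame p s' s'') :
    Frame p s s'' :=
  ⟨fun a ha => (h'.nat a ha).trans (h.nat a ha), fun a ha => (h'.real a ha).trans (h.real a ha)⟩

theorem Frame.mono {p q : Program} {s s' : State} (h : Frame p s s')
    (hn : p.natWrites ⊆ q.natWrites) (hr : p.realWrites ⊆ q.realWrites) : Frame q s s' :=
  ⟨fun a ha => h.nat a fun h' => ha (hn h'), fun a ha => h.real a fun h' => ha (hr h')⟩

/-- The arrays that may change are read off the program text. For concrete programs the side
conditions are settled by `decide`, so invariants need not mention arrays that are left alone. -/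
theorem Runs.frame {p : Program} {s s' : State} {t : ℕ} (h : Runs p s t s') : Frame p s s' := by
  induction h with
  | skip s => exact Frame.refl _ _
  | setNat s a i e =>
    refine ⟨fun b hb => ?_, fun b _ => rfl⟩
    simp [Program.natWrites] at hb
    simp [hb]
  | setReal s a i e =>
    refine ⟨fun b hb => rfl, fun b hb => ?_⟩
    simp [Program.realWrites] at hb
    simp [hb]
  | seq _ _ h1 h2 =>
    exact (h1.mono (by simp [Program.natWrites]) (by simp [Program.realWrites])).trans
      (h2.mono (by simp [Program.natWrites]) (by simp [Program.realWrites]))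
  | cond_true _ _ h =>
    exact h.mono (by simp [Program.natWrites]) (by simp [Program.realWrites])
  | cond_false _ _ h =>
    exact h.mono (by simp [Program.natWrites]) (by simp [Program.realWrites])
  | loop_true _ _ _ h1 h2 =>
    exact (h1.mono (by simp [Program.natWrites]) (by simp [Program.realWrites])).trans h2
  | loop_false _ => exact Frame.refl _ _

theorem Ens.frame {p : Program} {s : State} {T : ℕ} {Q : State → Prop} (h : Ens p s T Q) :
    Ens p s T fun s' => Q s' ∧ Frame p s s' := by
  obtain ⟨t, s', hr, ht, hq⟩ := h
  exact ⟨t, s', hr, ht, hq, hr.frame⟩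

theorem Ens.mono {p : Program} {s : State} {T T' : ℕ} {Q Q' : State → Prop} (h : Ens p s T Q)
    (hT : T ≤ T') (hQ : ∀ s', Q s' → Q' s') : Ens p s T' Q' := by
  obtain ⟨t, s', hr, ht, hq⟩ := h
  exact ⟨t, s', hr, ht.trans hT, hQ _ hq⟩

theorem Ens.imp {p : Program} {s : State} {T : ℕ} {Q Q' : State → Prop} (h : Ens p s T Q)
    (hQ : ∀ s', Frame p s s' → Q s' → Q' s') : Ens p s T Q' :=
  h.frame.mono le_rfl fun s' hs => hQ s' hs.2 hs.1

theorem Ens.seq {p q : Program} {s : State} {T T' : ℕ} {Q : State → Prop}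
    (h : Ens p s T fun s' => Ens q s' T' Q) : Ens (.seq p q) s (T + T') Q := by
  obtain ⟨t, s', hr, ht, t', s'', hr', ht', hq⟩ := h
  exact ⟨t + t', s'', .seq hr hr', by omega, hq⟩

theorem Ens.cond {b : Test} {p q : Program} {s : State} {T T' : ℕ} {Q : State → Prop}
    (h : b.Holds s → Ens p s T Q) (h' : ¬ b.Holds s → Ens q s T' Q) :
    Ens (.cond b p q) s (b.time + T + T' + 1) Q := by
  by_cases hb : b.Holds s
  · obtain ⟨t, s', hr, ht, hq⟩ := h hb
    exact ⟨_, s', .cond_true hb hr, by omega, hq⟩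
  · obtain ⟨t, s', hr, ht, hq⟩ := h' hb
    exact ⟨_, s', .cond_false hb hr, by omega, hq⟩

/-- Programs without loops. -/
def Program.IsFlat : Program → Prop
  | skip => True
  | setNat _ _ _ => True
  | setReal _ _ _ => True
  | seq p q => p.IsFlat ∧ q.IsFlat
  | cond _ p q => p.IsFlat ∧ q.IsFlat
  | loop _ _ => False

open Classical in
/-- The effect of a program without loops. -/
noncomputable def Program.exec : Program → State → State
  | skip, s => s
  | setNat a i e, s => s.putNat a (i.eval s) (e.eval s)
  | setReal a i e, s => s.putReal a (i.eval s) (e.eval s)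
  | seq p q, s => q.exec (p.exec s)
  | cond b p q, s => if b.Holds s then p.exec s else q.exec s
  | loop _ _, s => s

/-- A bound for the running time of a program without loops. -/
def Program.flatTime : Program → ℕ
  | skip => 1
  | setNat _ i e => i.time + e.time + 1
  | setReal _ i e => i.time + e.time + 1
  | seq p q => p.flatTime + q.flatTime
  | cond b p q => b.time + p.flatTime + q.flatTime + 1
  | loop _ _ => 0

theorem ens_exec (p : Program) (hp : p.IsFlat) (s : State) :
    Ens p s p.flatTime fun s' => s' = p.exec s := by
  induction p generalizing s with
  | skip => exact ⟨_, _, .skip s, le_rfl, rfl⟩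
  | setNat a i e => exact ⟨_, _, .setNat s a i e, le_rfl, rfl⟩
  | setReal a i e => exact ⟨_, _, .setReal s a i e, le_rfl, rfl⟩
  | seq p q hP hQ =>
    refine Ens.seq ((hP hp.1 s).mono le_rfl ?_)
    rintro _ rfl
    exact hQ hp.2 _
  | cond b p q hP hQ =>
    refine Ens.cond (fun hb => ?_) (fun hb => ?_)
    · simpa [Program.exec, hb] using hP hp.1 s
    · simpa [Program.exec, hb] using hQ hp.2 s
  | loop b p => exact hp.elim

theorem Ens.flat {p : Program} (hp : p.IsFlat) {s : State} {Q : State → Prop}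
    (h : Q (p.exec s)) : Ens p s p.flatTime Q :=
  (ens_exec p hp s).mono le_rfl (by rintro _ rfl; exact h)

theorem Ens.flat_le {p : Program} {s : State} {T : ℕ} {Q : State → Prop}
    (h : Q (p.exec s)) (hp : p.IsFlat) (hT : p.flatTime ≤ T) : Ens p s T Q :=
  (Ens.flat hp h).mono hT fun _ h => h

/-! ### Counting loops -/

/-- The scalar variable `a`: the cell `0` of the array `a`. -/
abbrev NatExpr.var (a : ℕ) : NatExpr := .read a (.const 0)

/-- The real scalar variable `a`. -/
abbrev RealExpr.var (a : ℕ) : RealExpr := .read a (.const 0)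

/-- Run `p` for the values `0, …, m - 1` of the variable `v`. -/
def Program.for (v : ℕ) (m : NatExpr) (p : Program) : Program :=
  .seq (.setNat v (.const 0) (.const 0))
    (.loop (.neg (.natLe m (.var v))) (.seq p (.setNat v (.const 0) (.add (.var v) (.const 1)))))

theorem Program.natWrites_for (v : ℕ) (m : NatExpr) (p : Program) :
    (Program.for v m p).natWrites = v :: (p.natWrites ++ [v]) := rfl

theorem Program.realWrites_for (v : ℕ) (m : NatExpr) (p : Program) :
    (Program.for v m p).realWrites = p.realWrites := by
  simp [Program.for, Program.realWrites]

/-- The running time of a counting loop. -/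
def forTime (m : NatExpr) (M T : ℕ) : ℕ := (T + m.time + 12) * M + (m.time + 10)

/-- The loop itself resets and increments the counter, so the invariant must be insensitive to that
cell (`hI`). The body is only examined on memories that agree with `s` outside the arrays written by
the loop; in particular the bound `m` keeps its value `M`. -/
theorem ens_for {v : ℕ} {m : NatExpr} {p : Program} {s : State} (M T : ℕ)
    (I : ℕ → State → Prop)
    (hv : v ∉ p.natWrites)
    (hm : ∀ s', Frame (Program.for v m p) s s' → m.eval s' = M)
    (hI : ∀ j s' x, I j s' → I j (s'.putNat v 0 x))
    (h0 : I 0 s)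
    (step : ∀ j < M, ∀ s', Frame (Program.for v m p) s s' → s'.nat v 0 = j → I j s' →
      Ens p s' T (I (j + 1))) :
    Ens (Program.for v m p) s (forTime m M T) (I M) := by
  have hfr : ∀ (s' : State) (x : ℕ), Frame (Program.for v m p) s s' →
      Frame (Program.for v m p) s (s'.putNat v 0 x) := by
    intro s' x h
    refine h.trans ⟨fun a ha => ?_, fun a _ => rfl⟩
    have : a ≠ v := fun h => ha (by simp [Program.natWrites_for, h])
    simp [this]
  have main : ∀ r j s', j + r = M → Frame (Program.for v m p) s s' → s'.nat v 0 = j → I j s' →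
      Ens (.loop (.neg (.natLe m (.var v)))
        (.seq p (.setNat v (.const 0) (.add (.var v) (.const 1))))) s'
        ((T + m.time + 12) * r + (m.time + 5)) (I M) := by
    intro r
    induction r with
    | zero =>
      intro j s' hj hF hs hi
      have hb : ¬ (Test.neg (.natLe m (.var v))).Holds s' := by
        simp [Test.Holds, hm s' hF, NatExpr.eval, hs]; omega
      refine ⟨_, s', .loop_false hb, ?_, ?_⟩
      · simp [Test.time, NatExpr.time]
      · have : j = M := by omega
        exact this ▸ hi
    | succ r ih =>
      intro j s' hj hF hs hi
      have hb : (Test.neg (.natLe m (.var v))).Holds s' := by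
        simp [Test.Holds, hm s' hF, NatExpr.eval, hs]; omega
      obtain ⟨t, s1, hr1, ht1, hI1, hF1⟩ := (step j (by omega) s' hF hs hi).frame
      have hs1 : s1.nat v 0 = j := by rw [hF1.nat v hv, hs]
      have hF1' : Frame (Program.for v m p) s s1 :=
        hF.trans (hF1.mono (by intro a ha; simp [Program.natWrites_for, ha])
          (by simp [Program.realWrites_for]))
      obtain ⟨t2, s2, hr2, ht2, hI2⟩ := ih (j + 1) (s1.putNat v 0 (j + 1)) (by omega)
        (hfr _ _ hF1') (by simp) (hI _ _ _ hI1)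
      have hset := Runs.setNat s1 v (.const 0) (.add (.var v) (.const 1))
      have he : (NatExpr.add (.var v) (.const 1)).eval s1 = j + 1 := by
        simp [NatExpr.eval, hs1]
      rw [he] at hset
      refine ⟨_, s2, .loop_true hb (.seq hr1 hset) hr2, ?_, hI2⟩
      simp only [Test.time, NatExpr.time]
      have : (T + m.time + 12) * (r + 1) = (T + m.time + 12) * r + (T + m.time + 12) := by ring
      omega
  obtain ⟨t, s', hr, ht, hq⟩ := main M 0 (s.putNat v 0 0) (by omega) (hfr _ _ (Frame.refl _ _))
    (by simp) (hI _ _ _ h0)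
  refine ⟨_, s', .seq (Runs.setNat s v (.const 0) (.const 0)) hr, ?_, hq⟩
  simp only [NatExpr.time, forTime]
  omega

/-- Store in the variable `c` the number of values `0, …, m - 1` of the variable `v` for which the
test `b` succeeds after running `p`. -/
def Program.count (v c : ℕ) (m : NatExpr) (p : Program) (b : Test) : Program :=
  .seq (.setNat c (.const 0) (.const 0))
    (Program.for v m (.seq p (.cond b (.setNat c (.const 0) (.add (.var c) (.const 1))) .skip)))

/-- The running time of a counting loop with a test. -/
def countTime (m : NatExpr) (b : Test) (M T : ℕ) : ℕ := 3 + forTime m M (T + (b.time + 9))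

theorem Program.natWrites_count (v c : ℕ) (m : NatExpr) (p : Program) (b : Test) :
    (Program.count v c m p b).natWrites = c :: v :: (p.natWrites ++ [c] ++ [v]) := rfl

open Classical in
/-- The number of `j < M` with `P j`. -/
noncomputable def countBelow (P : ℕ → Prop) (M : ℕ) : ℕ := ((Finset.range M).filter P).card

theorem countBelow_eq_card (P : ℕ → Prop) [DecidablePred P] (M : ℕ) :
    countBelow P M = ((Finset.range M).filter P).card := by
  rw [countBelow]
  exact congrArg Finset.card (by ext; simp)

theorem countBelow_succ (P : ℕ → Prop) [DecidablePred P] (M : ℕ) :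
    countBelow P (M + 1) = countBelow P M + if P M then 1 else 0 := by
  classical
  unfold countBelow
  rw [Finset.range_add_one, Finset.filter_insert]
  split_ifs with h
  · rw [Finset.card_insert_of_notMem (by simp)]
  · rfl

theorem countBelow_eq_zero {P : ℕ → Prop} {M : ℕ} : countBelow P M = 0 ↔ ∀ j < M, ¬ P j := by
  classical
  simp [countBelow, Finset.filter_eq_empty_iff]

theorem ens_count {v c : ℕ} {m : NatExpr} {p : Program} {b : Test} {s : State} (M T : ℕ)
    (P : ℕ → Prop)
    (hvc : v ≠ c) (hv : v ∉ p.natWrites) (hc : c ∉ p.natWrites)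
    (hm : ∀ s', Frame (Program.count v c m p b) s s' → m.eval s' = M)
    (step : ∀ j < M, ∀ s', Frame (Program.count v c m p b) s s' → s'.nat v 0 = j →
      Ens p s' T fun s'' => b.Holds s'' ↔ P j) :
    Ens (Program.count v c m p b) s (countTime m b M T) fun s' =>
      s'.nat c 0 = countBelow P M := by
  classical
  have key : ∀ s', Frame (Program.for v m (.seq p (.cond b (.setNat c (.const 0)
      (.add (.var c) (.const 1))) .skip))) (s.putNat c 0 0) s' →
      Frame (Program.count v c m p b) s s' := by
    intro s' hF
    refine Frame.trans (s' := s.putNat c 0 0) ⟨fun a ha => ?_, fun a _ => rfl⟩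
      (hF.mono ?_ ?_)
    · have : a ≠ c := fun h => ha (by simp [Program.natWrites_count, h])
      simp [this]
    · intro a ha
      exact List.mem_cons_of_mem _ ha
    · intro a ha; simpa [Program.count, Program.realWrites] using ha
  refine (Ens.seq (T := 3) (T' := forTime m M (T + (b.time + 9)))
    (Ens.flat (p := .setNat c (.const 0) (.const 0)) trivial ?_)).mono le_rfl fun _ h => h
  refine ens_for M _ (fun j s' => s'.nat c 0 = countBelow P j) ?_ ?_ ?_ ?_ ?_
  · simp [Program.natWrites, hv, hvc]
  · intro s' hF; exact hm s' (key s' hF)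
  · intro j s' x h; simp [hvc.symm, h]
  · simp [Program.exec, NatExpr.eval, countBelow]
  · intro j hj s' hF hs hI
    refine Ens.seq ((step j hj s' (key s' hF) hs).imp ?_)
    intro s2 hF2 hb
    have hc2 : s2.nat c 0 = countBelow P j := by rw [hF2.nat c hc, hI]
    refine (Ens.flat (p := .cond b (.setNat c (.const 0) (.add (.var c) (.const 1))) .skip)
      ⟨trivial, trivial⟩ ?_).mono ?_ fun _ h => h
    · simp only [Program.exec, hb]
      rw [countBelow_succ]
      by_cases hP : P j
      · simp [hP, NatExpr.eval, hc2]
      · simp [hP, hc2]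
    · simp [Program.flatTime, NatExpr.time]

/-! ### Assignments with capacities -/

/-- Hall's theorem for assignments of points to `k` slots with capacities. -/
theorem exists_assignment {k : ℕ} (A : Finset ℕ) (N : ℕ → ℕ → Prop) (cap : ℕ → ℕ)
    (h : ∀ T : Finset ℕ, T ⊆ Finset.range k → ∀ Q : Finset ℕ, Q ⊆ A →
      (∀ p ∈ Q, ∀ l < k, N p l → l ∈ T) → Q.card ≤ ∑ l ∈ T, cap l) :
    ∃ f : ℕ → ℕ, (∀ p ∈ A, f p < k ∧ N p (f p)) ∧
      ∀ l < k, (A.filter fun p => f p = l).card ≤ cap l := by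
  classical
  -- Splitting a slot into `cap l` unit places turns the capacitated problem into a matching, to
  -- which Hall's theorem applies.
  let t : A → Finset (Σ _ : ℕ, ℕ) := fun p =>
    ((Finset.range k).filter fun l => N p l).sigma fun l => Finset.range (cap l)
  have hall : ∀ s : Finset A, s.card ≤ (s.biUnion t).card := by
    intro s
    let T := (Finset.range k).filter fun l => ∃ p ∈ s, N p l
    have h1 := h T (Finset.filter_subset _ _) (s.map (Function.Embedding.subtype _))
      (by intro x hx; simp at hx; exact hx.1)
      (by
        intro p hp l hl hN
        simp only [Finset.mem_map, Function.Embedding.subtype_apply] at hp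
        obtain ⟨q, hq, rfl⟩ := hp
        exact Finset.mem_filter.2 ⟨Finset.mem_range.2 hl, q, hq, hN⟩)
    rw [Finset.card_map] at h1
    have h2 : s.biUnion t = T.sigma fun l => Finset.range (cap l) := by
      ext ⟨l, j⟩
      simp only [Finset.mem_biUnion, Finset.mem_sigma, Finset.mem_filter, t, T]
      tauto
    rw [h2, Finset.card_sigma]
    simpa using h1
  obtain ⟨f, hf, hft⟩ := (Finset.all_card_le_biUnion_card_iff_exists_injective t).1 hall
  refine ⟨fun p => if hp : p ∈ A then (f ⟨p, hp⟩).1 else 0, fun p hp => ?_, fun l hl => ?_⟩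
  · have := hft ⟨p, hp⟩
    simp only [t, Finset.mem_sigma, Finset.mem_filter, Finset.mem_range] at this
    simp only [hp, dif_pos]
    exact this.1
  · rw [← Finset.card_range (cap l)]
    refine Finset.card_le_card_of_injOn (fun p => if hp : p ∈ A then (f ⟨p, hp⟩).2 else 0) ?_ ?_
    · intro p hp
      simp only [Finset.coe_filter, Set.mem_ofPred_eq] at hp
      obtain ⟨hp, hl⟩ := hp
      have := hft ⟨p, hp⟩
      simp only [t, Finset.mem_sigma, Finset.mem_filter, Finset.mem_range] at this
      simp only [hp, dif_pos] at hl ⊢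
      rw [hl] at this
      simpa using this.2
    · intro p hp q hq hpq
      simp only [Finset.coe_filter, Set.mem_ofPred_eq] at hp hq
      obtain ⟨hp, hlp⟩ := hp
      obtain ⟨hq, hlq⟩ := hq
      simp only [hp, hq, dif_pos] at hlp hlq hpq
      have : f ⟨p, hp⟩ = f ⟨q, hq⟩ := Sigma.ext (hlp.trans hlq.symm) (heq_of_eq hpq)
      simpa using hf this

/-! ### Ranks -/

/-- The order of the points by decreasing capacity, ties being broken by the index. -/
def Precedes (η : ℕ → ℕ) (y x : ℕ) : Prop := η x < η y ∨ (η x = η y ∧ y < x)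

theorem Precedes.trans {η : ℕ → ℕ} {x y z : ℕ} (h : Precedes η x y) (h' : Precedes η y z) :
    Precedes η x z := by
  unfold Precedes at *; omega

theorem precedes_trichotomy (η : ℕ → ℕ) (x y : ℕ) :
    Precedes η x y ∨ x = y ∨ Precedes η y x := by
  unfold Precedes; omega

theorem not_precedes_self (η : ℕ → ℕ) (x : ℕ) : ¬ Precedes η x x := by
  unfold Precedes; omega

/-- The number of points `y < n` with `A y` that precede `x`. -/
noncomputable def rankIn (n : ℕ) (η : ℕ → ℕ) (A : ℕ → Prop) (x : ℕ) : ℕ :=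
  countBelow (fun y => A y ∧ Precedes η y x) n

theorem rankIn_lt_of_precedes {n : ℕ} {η : ℕ → ℕ} {A : ℕ → Prop} {x y : ℕ} (hy : y < n)
    (hA : A y) (h : Precedes η y x) : rankIn n η A y < rankIn n η A x := by
  classical
  unfold rankIn countBelow
  refine Finset.card_lt_card ?_
  rw [Finset.ssubset_iff_of_subset]
  · exact ⟨y, by simp [hy, hA, h], by simp [not_precedes_self]⟩
  · intro z hz
    simp only [Finset.mem_filter] at hz ⊢
    exact ⟨hz.1, hz.2.1, hz.2.2.trans h⟩

theorem rankIn_inj {n : ℕ} {η : ℕ → ℕ} {A : ℕ → Prop} {x y : ℕ} (hx : x < n) (hy : y < n)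
    (hAx : A x) (hAy : A y) (h : rankIn n η A x = rankIn n η A y) : x = y := by
  rcases precedes_trichotomy η x y with h' | h' | h'
  · exact absurd h (rankIn_lt_of_precedes hx hAx h').ne
  · exact h'
  · exact absurd h (rankIn_lt_of_precedes hy hAy h').ne'

/-- Take a member of `A` of least rank among those of rank at least `k`. Everything that precedes it
in `A` has rank below `k`, and there are at least `k` such members. -/
theorem le_card_rankIn_lt {n k : ℕ} {η : ℕ → ℕ} {A : ℕ → Prop} [DecidablePred A] {x : ℕ}
    (hx : x < n) (hA : A x) (h : k ≤ rankIn n η A x) :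
    k ≤ ((Finset.range n).filter fun y => A y ∧ rankIn n η A y < k).card := by
  classical
  by_contra! hlt
  set T := (Finset.range n).filter fun y => A y ∧ rankIn n η A y < k with hT
  have hne : ((Finset.range n).filter fun y => A y ∧ k ≤ rankIn n η A y).Nonempty :=
    ⟨x, by simp [hx, hA, h]⟩
  obtain ⟨z, hz, hmin⟩ := Finset.exists_min_image _ (rankIn n η A) hne
  simp only [Finset.mem_filter, Finset.mem_range] at hz hmin
  have : rankIn n η A z ≤ T.card := by
    rw [rankIn, countBelow]
    refine Finset.card_le_card fun y hy => ?_
    simp only [Finset.mem_filter, Finset.mem_range] at hy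
    have hlt' := rankIn_lt_of_precedes hy.1 hy.2.1 hy.2.2
    simp only [hT, Finset.mem_filter, Finset.mem_range]
    refine ⟨hy.1, hy.2.1, ?_⟩
    by_contra! hk
    have := hmin y ⟨hy.1, hy.2.1, hk⟩
    omega
  omega

theorem capacity_le_of_rankIn_lt {n : ℕ} {η : ℕ → ℕ} {A : ℕ → Prop} {x y : ℕ}
    (hx : x < n) (hA : A x) (h : rankIn n η A y < rankIn n η A x) : η x ≤ η y := by
  rcases precedes_trichotomy η x y with h' | h' | h'
  · exact absurd (rankIn_lt_of_precedes hx hA h') h.not_gt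
  · rw [h']
  · rcases h' with h' | h'
    · exact h'.le
    · exact h'.1.le

/-- Given `k` distinct points, each with a set containing it, some of them can be replaced by points
of rank less than `k` of their sets such that all the points are distinct. -/
theorem exists_distinct_ranked {n k : ℕ} (η : ℕ → ℕ) (A : ℕ → ℕ → Prop) (H : Set ℕ)
    (c : ℕ → ℕ) (hc : ∀ l < k, c l < n) (hinj : Set.InjOn c (Set.Iio k))
    (hA : ∀ l < k, l ∈ H → A l (c l)) :
    ∃ c' : ℕ → ℕ, Set.InjOn c' (Set.Iio k) ∧ (∀ l < k, l ∉ H → c' l = c l) ∧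
      ∀ l < k, l ∈ H → c' l < n ∧ A l (c' l) ∧ rankIn n η (A l) (c' l) < k ∧
        η (c l) ≤ η (c' l) := by
  classical
  -- A set of indices that contains one with a large-rank point has at least `k` candidates already;
  -- otherwise all candidate sets are singletons, distinct by `hinj`. So Hall's condition holds.
  let t : Fin k → Finset ℕ := fun l =>
    if l.1 ∈ H ∧ k ≤ rankIn n η (A l) (c l) then
      (Finset.range n).filter fun y => A l y ∧ rankIn n η (A l) y < k
    else {c l}
  have hall : ∀ s : Finset (Fin k), s.card ≤ (s.biUnion t).card := by
    intro s
    by_cases hs : ∃ l ∈ s, l.1 ∈ H ∧ k ≤ rankIn n η (A l) (c l)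
    · obtain ⟨l, hl, hH, hk⟩ := hs
      calc s.card ≤ k := by simpa using s.card_le_univ
        _ ≤ (t l).card := by
          simp only [t, hH, hk, and_self, if_true]
          exact le_card_rankIn_lt (hc l l.2) (hA l l.2 hH) hk
        _ ≤ _ := Finset.card_le_card (Finset.subset_biUnion_of_mem t hl)
    · have : s.biUnion t = s.image fun l : Fin k => c l.1 := by
        rw [← Finset.biUnion_singleton]
        refine Finset.biUnion_congr rfl fun l hl => ?_
        have : ¬ (l.1 ∈ H ∧ k ≤ rankIn n η (A l) (c l)) := fun h => hs ⟨l, hl, h⟩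
        simp only [t, this, if_false]
      rw [this, Finset.card_image_of_injective]
      intro a b hab
      exact Fin.ext (hinj a.2 b.2 hab)
  obtain ⟨f, hf, hft⟩ := (Finset.all_card_le_biUnion_card_iff_exists_injective t).1 hall
  refine ⟨fun l => if h : l < k then f ⟨l, h⟩ else 0, ?_, ?_, ?_⟩
  · intro a ha b hb hab
    simp only [Set.mem_Iio] at ha hb
    simp only [ha, hb, dif_pos] at hab
    simpa using hf hab
  · intro l hl hH
    have := hft ⟨l, hl⟩
    simpa [t, hH, hl] using this
  · intro l hl hH
    have := hft ⟨l, hl⟩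
    simp only [t, hl, dif_pos, hH, true_and] at this ⊢
    split_ifs at this with hk
    · simp only [Finset.mem_filter, Finset.mem_range] at this
      exact ⟨this.1, this.2.1, this.2.2,
        capacity_le_of_rankIn_lt (hc l hl) (hA l hl hH) (by omega)⟩
    · rw [Finset.mem_singleton] at this
      rw [this]
      exact ⟨hc l hl, hA l hl hH, by omega, le_rfl⟩

/-! ### The search for the centers -/

/-- The last `x < m` with `P x`, and `0` if there is none. -/
noncomputable def pickLast (P : ℕ → Prop) : ℕ → ℕ
  | 0 => 0
  | m + 1 => open Classical in if P m then m else pickLast P m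

theorem pickLast_spec {P : ℕ → Prop} {x : ℕ} (hP : P x) :
    ∀ {m : ℕ}, x < m → pickLast P m < m ∧ P (pickLast P m)
  | 0, h => absurd h (by simp)
  | m + 1, h => by
    by_cases hm : P m
    · simp [pickLast, hm]
    · have : x < m := by
        rcases Nat.lt_succ_iff_lt_or_eq.1 h with h | rfl
        · exact h
        · exact absurd hP hm
      have := pickLast_spec hP this
      simp only [pickLast, hm, if_false]
      exact ⟨by omega, this.2⟩

/-- The best score of the `x < m` with `P x`, and the last `x` that attains it. -/
noncomputable def pickBest (P : ℕ → Prop) (score : ℕ → ℕ) : ℕ → ℕ × ℕ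
  | 0 => (0, 0)
  | m + 1 => open Classical in
      if P m ∧ (pickBest P score m).1 ≤ score m then (score m, m) else pickBest P score m

theorem pickBest_spec {P : ℕ → Prop} {score : ℕ → ℕ} {x : ℕ} (hP : P x) {m : ℕ} (hx : x < m) :
    (pickBest P score m).2 < m ∧ P (pickBest P score m).2 ∧
      score x ≤ score (pickBest P score m).2 := by
  have h1 : ∀ m, (∃ y < m, P y) → (pickBest P score m).2 < m ∧ P (pickBest P score m).2 ∧
      (pickBest P score m).1 = score (pickBest P score m).2 := by
    intro m
    induction m with
    | zero => simp
    | succ m ih =>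
      rintro ⟨y, hy, hPy⟩
      by_cases hm : P m ∧ (pickBest P score m).1 ≤ score m
      · simp [pickBest, hm]
      · have hlt : ∃ y < m, P y := by
          by_contra! hno
          have hym : y = m := by
            by_contra hne
            exact hno y (by omega) hPy
          -- As long as nothing is admissible the default score is `0`. The comparison is not
          -- strict, so the first admissible point replaces the default even if its own score is
          -- `0`.
          have h0 : ∀ r ≤ m, pickBest P score r = (0, 0) := by
            intro r
            induction r with
            | zero => simp [pickBest]
            | succ r ihr => intro hr; simp [pickBest, hno r (by omega), ihr (by omega)]
          exact hm ⟨hym ▸ hPy, by simp [h0 m le_rfl]⟩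
        have := ih hlt
        simp only [pickBest, hm, if_false]
        exact ⟨by omega, this.2⟩
  have h2 : ∀ m, x < m → score x ≤ (pickBest P score m).1 := by
    intro m
    induction m with
    | zero => simp
    | succ m ih =>
      intro hx
      rcases Nat.lt_succ_iff_lt_or_eq.1 hx with hx | rfl
      · have := ih hx
        simp only [pickBest]
        split_ifs with h
        · exact this.trans h.2
        · exact this
      · simp only [pickBest]
        split_ifs with h
        · exact le_rfl
        · have : ¬ (pickBest P score x).1 ≤ score x := fun h' => h ⟨hP, h'⟩
          omega
  obtain ⟨a, b, c⟩ := h1 m ⟨x, hx, hP⟩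
  exact ⟨a, b, c ▸ h2 m hx⟩

/-! ### Instances, anchors, and the choice of centers in one round -/

/-- An instance with the points `0, …, n - 1`. -/
structure Data where
  n : ℕ
  k : ℕ
  d : ℕ → ℕ → ℝ
  η : ℕ → ℕ

/-- The distances of an instance form a pseudometric. -/
structure Data.IsMetric (D : Data) : Prop where
  self : ∀ x < D.n, D.d x x = 0
  symm : ∀ x < D.n, ∀ y < D.n, D.d x y = D.d y x
  triangle : ∀ x < D.n, ∀ y < D.n, ∀ z < D.n, D.d x z ≤ D.d x y + D.d y z

/-- A clustering with centers `c`, assignment `μ` and radii at most `ρ`. -/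
structure Data.Planted (D : Data) (ρ : ℕ → ℝ) (c μ : ℕ → ℕ) : Prop where
  center_lt : ∀ l < D.k, c l < D.n
  inj : Set.InjOn c (Set.Iio D.k)
  map_lt : ∀ p < D.n, μ p < D.k
  dist_le : ∀ p < D.n, D.d p (c (μ p)) ≤ ρ (μ p)
  capacity : ∀ l < D.k, countBelow (fun p => μ p = l) D.n ≤ D.η (c l)
  nonneg : ∀ l, 0 ≤ ρ l
  mono : ∀ l l', l ≤ l' → l' < D.k → ρ l ≤ ρ l'

/-- The centers `ce` are distinct and the points can be assigned to them within the distances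
`13 * ρ`. -/
def Data.Servable (D : Data) (ρ : ℕ → ℝ) (ce : ℕ → ℕ) : Prop :=
  Set.InjOn ce (Set.Iio D.k) ∧ (∀ l < D.k, ce l < D.n) ∧
    ∃ f : ℕ → ℕ, (∀ p < D.n, f p < D.k ∧ D.d p (ce (f p)) ≤ 13 * ρ (f p)) ∧
      ∀ l < D.k, countBelow (fun p => f p = l) D.n ≤ D.η (ce l)

/-- The clusters for which a point near the center is known, these points, and a guess of the
other clusters whose centers are near these points. -/
structure Anchors where
  hit : Set ℕ
  pt : ℕ → ℕ
  bit : ℕ → ℕ → ℕ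

open Classical in
/-- The points known in a round with centers `ce`. -/
noncomputable def Anchors.known (a : Anchors) (ce : ℕ → ℕ) (j : ℕ) : ℕ :=
  if j ∈ a.hit then a.pt j else ce j

/-- The cluster `j` excludes the point `x` as a center of the cluster `i`. -/
def Data.Bad (D : Data) (ρ : ℕ → ℝ) (a : Anchors) (ce : ℕ → ℕ) (i j x : ℕ) : Prop :=
  ((j ∈ a.hit ∨ j < i) ∧ D.d (a.known ce j) x ≤ 5 * ρ i) ∨
    (j ∈ a.hit ∧ ((a.bit j i = 0 ∧ D.d (a.pt j) x ≤ 4 * ρ j + 2 * ρ i) ∨ ce j = x))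

/-- The number of points that `x` can serve within the distance `r`. -/
noncomputable def Data.score (D : Data) (r : ℝ) (x : ℕ) : ℕ :=
  D.η x - (D.η x - countBelow (fun y => D.d x y ≤ r) D.n)

open Classical in
/-- The centers chosen for the anchored clusters, the other ones being set to `0`. -/
noncomputable def Data.hitCenters (D : Data) (ρ : ℕ → ℝ) (a : Anchors) (m : ℕ → ℕ) (l : ℕ) : ℕ :=
  if l ∈ a.hit ∧ l < D.k then
    pickLast (fun x => D.d (a.pt l) x ≤ 5 * ρ l ∧
      rankIn D.n D.η (fun y => D.d (a.pt l) y ≤ 5 * ρ l) x = m l) D.n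
  else 0

open Classical in
/-- The centers after the choice for the first `i` clusters that are not anchored. -/
noncomputable def Data.centersUpTo (D : Data) (ρ : ℕ → ℝ) (a : Anchors) (m : ℕ → ℕ) :
    ℕ → ℕ → ℕ
  | 0 => D.hitCenters ρ a m
  | i + 1 =>
    if i ∈ a.hit then D.centersUpTo ρ a m i
    else Function.update (D.centersUpTo ρ a m i) i
      (pickBest (fun x => ∀ j < D.k, ¬ D.Bad ρ a (D.centersUpTo ρ a m i) i j x)
        (D.score (ρ i)) D.n).2

/-- The centers chosen in a round. -/
noncomputable def Data.centers (D : Data) (ρ : ℕ → ℝ) (a : Anchors) (m : ℕ → ℕ) : ℕ → ℕ :=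
  D.centersUpTo ρ a m D.k

/-- Only the first `k` entries of a block are ranks; this allows the rest of the block to carry
other advice. -/
theorem Data.centers_congr (D : Data) (ρ : ℕ → ℝ) (a : Anchors) {m m' : ℕ → ℕ}
    (h : ∀ l < D.k, m l = m' l) : D.centers ρ a m = D.centers ρ a m' := by
  have h0 : D.hitCenters ρ a m = D.hitCenters ρ a m' := by
    funext l
    unfold Data.hitCenters
    by_cases hl : l < D.k
    · simp only [h l hl]
    · simp [hl]
  have : ∀ i, D.centersUpTo ρ a m i = D.centersUpTo ρ a m' i := by
    intro i
    induction i with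
    | zero => exact h0
    | succ i ih => simp only [Data.centersUpTo, ih]
  exact this _

theorem Data.centersUpTo_hit (D : Data) (ρ : ℕ → ℝ) (a : Anchors) (m : ℕ → ℕ) (i l : ℕ)
    (hl : l ∈ a.hit) : D.centersUpTo ρ a m i l = D.hitCenters ρ a m l := by
  induction i with
  | zero => rfl
  | succ i ih =>
    rw [Data.centersUpTo]
    split_ifs with h
    · exact ih
    · rw [Function.update_of_ne (by rintro rfl; exact h hl), ih]

theorem Data.centersUpTo_of_lt (D : Data) (ρ : ℕ → ℝ) (a : Anchors) (m : ℕ → ℕ) (i i' l : ℕ)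
    (hl : l < i) (h : i ≤ i') : D.centersUpTo ρ a m i' l = D.centersUpTo ρ a m i l := by
  induction i', h using Nat.le_induction with
  | base => rfl
  | succ i' h ih =>
    rw [Data.centersUpTo]
    split_ifs with hi
    · exact ih
    · rw [Function.update_of_ne (by omega), ih]

/-- The test for the cluster `i` consults only centers that are final when `i` is treated, so the
partial choice may be replaced by the final one. -/
theorem Data.bad_congr {D : Data} {ρ : ℕ → ℝ} {a : Anchors} {ce ce' : ℕ → ℕ} {i : ℕ}
    (h : ∀ j, j ∈ a.hit ∨ j < i → ce j = ce' j) (j x : ℕ) :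
    D.Bad ρ a ce i j x ↔ D.Bad ρ a ce' i j x := by
  classical
  have h2 : j ∈ a.hit → ce j = ce' j := fun hj => h j (.inl hj)
  unfold Data.Bad Anchors.known
  by_cases hj : j ∈ a.hit
  · simp [hj, h2 hj]
  · by_cases hji : j < i
    · simp [hj, hji, h j (.inr hji)]
    · simp [hj, hji]

/-- The round leads to a new or better anchor for some cluster. -/
def Data.Progress (D : Data) (ρ : ℕ → ℝ) (c : ℕ → ℕ) (a : Anchors) (ce : ℕ → ℕ) (l j : ℕ) :
    Prop :=
  l < D.k ∧ j < D.k ∧ a.known ce j < D.n ∧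
    ((l ∉ a.hit ∧ D.d (a.known ce j) (c l) ≤ 5 * ρ l) ∨
      (l ∈ a.hit ∧ 3 * ρ l < D.d (a.pt l) (c l) ∧ D.d (a.known ce j) (c l) ≤ 3 * ρ l))

/-- The anchors are near the centers, and the guesses are right. -/
structure Data.Valid (D : Data) (ρ : ℕ → ℝ) (c : ℕ → ℕ) (a : Anchors) : Prop where
  pt_lt : ∀ l < D.k, l ∈ a.hit → a.pt l < D.n
  dist_pt : ∀ l < D.k, l ∈ a.hit → D.d (a.pt l) (c l) ≤ 5 * ρ l
  bit : ∀ j < D.k, j ∈ a.hit → ∀ i < D.k,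
    (a.bit j i = 0 ↔ ¬ D.d (a.pt j) (c i) ≤ 4 * ρ j + 2 * ρ i)

variable {D : Data} {ρ : ℕ → ℝ} {c μ : ℕ → ℕ} {a : Anchors}

/-- The properties of the centers chosen in a round without progress. -/
structure Data.Stuck (D : Data) (ρ : ℕ → ℝ) (c μ : ℕ → ℕ) (a : Anchors) (ce : ℕ → ℕ) :
    Prop where
  lt : ∀ l < D.k, ce l < D.n
  inj : Set.InjOn ce (Set.Iio D.k)
  hit_near : ∀ l < D.k, l ∈ a.hit → D.d (a.pt l) (ce l) ≤ 5 * ρ l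
  hit_capacity : ∀ l < D.k, l ∈ a.hit → D.η (c l) ≤ D.η (ce l)
  not_bad : ∀ i < D.k, i ∉ a.hit → ∀ j < D.k, ¬ D.Bad ρ a ce i j (ce i)
  score : ∀ i < D.k, i ∉ a.hit → countBelow (fun p => μ p = i) D.n ≤ D.score (ρ i) (ce i)

/-- Two truncated subtractions express a minimum, which is how the machine computes it. -/
theorem Data.score_eq (D : Data) (r : ℝ) (x : ℕ) :
    D.score r x = min (D.η x) (countBelow (fun y => D.d x y ≤ r) D.n) := by
  unfold Data.score; omega

/-- The advice `m` consists of the ranks of the points given by `exists_distinct_ranked`. Without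
progress the true center of a free cluster is admissible, so the greedy choice scores at least as
well, and the score of the true center is at least the size of its cluster. Strong induction is
needed because admissibility involves the earlier choices, which must already be known to be points.
-/
theorem Data.Planted.exists_stuck (hm : D.IsMetric) (hp : D.Planted ρ c μ)
    (ha : D.Valid ρ c a) :
    ∃ m : ℕ → ℕ, (∀ l < D.k, m l < D.k) ∧
      ((∀ l j, ¬ D.Progress ρ c a (D.centers ρ a m) l j) →
        D.Stuck ρ c μ a (D.centers ρ a m)) := by
  classical
  obtain ⟨c', hinj, hfree, hhit⟩ := exists_distinct_ranked D.η
    (fun l x => D.d (a.pt l) x ≤ 5 * ρ l) a.hit c hp.center_lt hp.inj ha.dist_pt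
  refine ⟨fun l => if l ∈ a.hit then rankIn D.n D.η (fun y => D.d (a.pt l) y ≤ 5 * ρ l) (c' l)
    else 0, fun l hl => ?_, fun hno => ?_⟩
  · dsimp only
    split_ifs with h
    · exact (hhit l hl h).2.2.1
    · omega
  set m : ℕ → ℕ := fun l => if l ∈ a.hit then
    rankIn D.n D.η (fun y => D.d (a.pt l) y ≤ 5 * ρ l) (c' l) else 0 with hmdef
  set ce := D.centers ρ a m with hce
  have hcehit : ∀ l < D.k, l ∈ a.hit → ce l = c' l := by
    intro l hl hlH
    rw [hce, Data.centers, D.centersUpTo_hit _ _ _ _ _ hlH, Data.hitCenters, if_pos ⟨hlH, hl⟩]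
    have h1 := hhit l hl hlH
    have h2 := pickLast_spec (P := fun x => D.d (a.pt l) x ≤ 5 * ρ l ∧
      rankIn D.n D.η (fun y => D.d (a.pt l) y ≤ 5 * ρ l) x = m l) (x := c' l)
      ⟨h1.2.1, by simp [hmdef, hlH]⟩ h1.1
    refine rankIn_inj h2.1 h1.1 h2.2.1 h1.2.1 (h2.2.2.trans ?_)
    simp [hmdef, hlH]
  have hknown : ∀ j, j ∉ a.hit → a.known ce j = ce j := by
    intro j hj; simp [Anchors.known, hj]
  have hknown' : ∀ j, j ∈ a.hit → a.known ce j = a.pt j := by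
    intro j hj; simp [Anchors.known, hj]
  have hE1 : ∀ l < D.k, l ∉ a.hit → ∀ j < D.k, a.known ce j < D.n →
      5 * ρ l < D.d (a.known ce j) (c l) := by
    intro l hl hlH j hj hjn
    by_contra! h
    exact hno l j ⟨hl, hj, hjn, .inl ⟨hlH, h⟩⟩
  have main : ∀ i < D.k, i ∉ a.hit → ce i < D.n ∧ (∀ j < D.k, ¬ D.Bad ρ a ce i j (ce i)) ∧
      countBelow (fun p => μ p = i) D.n ≤ D.score (ρ i) (ce i) := by
    intro i
    induction i using Nat.strong_induction_on with
    | _ i ih =>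
      intro hi hiH
      have hbad : ∀ j x, D.Bad ρ a (D.centersUpTo ρ a m i) i j x ↔ D.Bad ρ a ce i j x := by
        refine Data.bad_congr fun j hj => ?_
        rcases hj with hj | hj
        · rw [hce, Data.centers, D.centersUpTo_hit _ _ _ _ _ hj, D.centersUpTo_hit _ _ _ _ _ hj]
        · rw [hce, Data.centers, D.centersUpTo_of_lt _ _ _ _ _ _ hj hi.le]
      have hcei : ce i = (pickBest (fun x => ∀ j < D.k, ¬ D.Bad ρ a ce i j x)
          (D.score (ρ i)) D.n).2 := by
        rw [hce, Data.centers, D.centersUpTo_of_lt _ _ _ (i + 1) _ _ (Nat.lt_succ_self i) hi,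
          Data.centersUpTo, if_neg hiH, Function.update_self]
        simp only [hbad]
        rfl
      -- The true center passes each test: the ball tests by lack of progress, the test with the bit
      -- because the bits are right, and the last one because `c'` is injective and agrees with `c`
      -- on free clusters.
      have hok : ∀ j < D.k, ¬ D.Bad ρ a ce i j (c i) := by
        rintro j hj (⟨hji, hd⟩ | ⟨hjH, ⟨hb, hd⟩ | hd⟩)
        · refine absurd (hE1 i hi hiH j hj ?_) hd.not_gt
          by_cases hjH : j ∈ a.hit
          · rw [hknown' j hjH]; exact ha.pt_lt j hj hjH
          · rw [hknown j hjH]; exact (ih j (hji.resolve_left hjH) hj hjH).1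
        · exact (ha.bit j hj hjH i hi).1 hb hd
        · rw [hcehit j hj hjH, ← hfree i hi hiH] at hd
          have := hinj hj hi hd
          exact hiH (this ▸ hjH)
      have := pickBest_spec (P := fun x => ∀ j < D.k, ¬ D.Bad ρ a ce i j x)
        (score := D.score (ρ i)) hok (hp.center_lt i hi)
      rw [← hcei] at this
      refine ⟨this.1, this.2.1, le_trans ?_ this.2.2⟩
      rw [Data.score_eq]
      refine le_min (hp.capacity i hi) ?_
      unfold countBelow
      refine Finset.card_le_card fun p hpm => ?_
      simp only [Finset.mem_filter, Finset.mem_range] at hpm ⊢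
      refine ⟨hpm.1, ?_⟩
      rw [hm.symm _ (hp.center_lt i hi) _ hpm.1]
      simpa [hpm.2] using hp.dist_le p hpm.1
  refine ⟨fun l hl => ?_, ?_, fun l hl hlH => ?_, fun l hl hlH => ?_,
    fun i hi hiH => (main i hi hiH).2.1, fun i hi hiH => (main i hi hiH).2.2⟩
  · by_cases hlH : l ∈ a.hit
    · rw [hcehit l hl hlH]; exact (hhit l hl hlH).1
    · exact (main l hl hlH).1
  -- A free center that repeats an earlier free one would be at distance `0 ≤ 5 * ρ i` from it;
  -- coincidence with an anchored center is excluded explicitly in `Data.Bad`.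
  · have aux : ∀ i < D.k, i ∉ a.hit → ∀ j < D.k, (j ∈ a.hit ∨ j < i) → ce j ≠ ce i := by
      intro i hi hiH j hj hji heq
      refine (main i hi hiH).2.1 j hj ?_
      by_cases hjH : j ∈ a.hit
      · exact .inr ⟨hjH, .inr heq⟩
      · refine .inl ⟨hji, ?_⟩
        rw [hknown j hjH, heq, hm.self _ (main i hi hiH).1]
        exact mul_nonneg (by norm_num) (hp.nonneg i)
    intro i hi j hj hij
    simp only [Set.mem_Iio] at hi hj
    by_cases hiH : i ∈ a.hit
    · by_cases hjH : j ∈ a.hit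
      · rw [hcehit i hi hiH, hcehit j hj hjH] at hij
        exact hinj hi hj hij
      · exact absurd hij (aux j hj hjH i hi (.inl hiH))
    · by_cases hjH : j ∈ a.hit
      · exact absurd hij.symm (aux i hi hiH j hj (.inl hjH))
      · rcases lt_trichotomy i j with h | h | h
        · exact absurd hij (aux j hj hjH i hi (.inr h))
        · exact h
        · exact absurd hij.symm (aux i hi hiH j hj (.inr h))
  · rw [hcehit l hl hlH]; exact (hhit l hl hlH).2.1
  · rw [hcehit l hl hlH]; exact (hhit l hl hlH).2.2.2

end CSR

namespace CSR

/-! ### A round without progress serves all points -/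

variable {D : Data} {ρ : ℕ → ℝ} {c μ : ℕ → ℕ} {a : Anchors} {ce : ℕ → ℕ}

/-- A ball around the center chosen for a cluster that is not anchored meets the cluster `l`. -/
theorem Data.Planted.dist_center_le (hm : D.IsMetric) (hp : D.Planted ρ c μ) {x : ℕ} (hx : x < D.n)
    {r : ℝ} {y : ℕ} (hy : y < D.n) (hd : D.d x y ≤ r) :
    D.d x (c (μ y)) ≤ r + ρ (μ y) :=
  (hm.triangle x hx y hy _ (hp.center_lt _ (hp.map_lt y hy))).trans
    (add_le_add hd (hp.dist_le y hy))

/-- Hall's condition is verified by an exchange argument. Each free cluster has a reserved set `Y i`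
near its new center, as large as the cluster. The relation `E` records that the reserved set of one
free cluster contains a point of another one. The distance estimates show that all anchored clusters
reached from a point of `Q` belong to `T`, so the points displaced by the reserved sets are
accounted for within `T`. -/
theorem Data.Planted.servable (hm : D.IsMetric) (hp : D.Planted ρ c μ) (ha : D.Valid ρ c a)
    (hs : D.Stuck ρ c μ a ce) (hno : ∀ l j, ¬ D.Progress ρ c a ce l j) :
    D.Servable ρ ce := by
  classical
  refine ⟨hs.inj, hs.lt, ?_⟩
  have hknown : ∀ j, j ∉ a.hit → a.known ce j = ce j := by
    intro j hj; simp [Anchors.known, hj]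
  have hknown' : ∀ j, j ∈ a.hit → a.known ce j = a.pt j := by
    intro j hj; simp [Anchors.known, hj]
  have hkn : ∀ j < D.k, a.known ce j < D.n := by
    intro j hj
    by_cases hjH : j ∈ a.hit
    · rw [hknown' j hjH]; exact ha.pt_lt j hj hjH
    · rw [hknown j hjH]; exact hs.lt j hj
  have hE1 : ∀ l < D.k, l ∉ a.hit → ∀ j < D.k, 5 * ρ l < D.d (a.known ce j) (c l) := by
    intro l hl hlH j hj
    by_contra! h
    exact hno l j ⟨hl, hj, hkn j hj, .inl ⟨hlH, h⟩⟩
  have hE2 : ∀ l < D.k, l ∈ a.hit → ∀ j < D.k, D.d (a.known ce j) (c l) ≤ 3 * ρ l →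
      D.d (a.pt l) (c l) ≤ 3 * ρ l := by
    intro l hl hlH j hj h
    by_contra! h'
    exact hno l j ⟨hl, hj, hkn j hj, .inr ⟨hlH, h', h⟩⟩
  -- the points reserved for the clusters that are not anchored
  have hY : ∀ i, ∃ Y : Finset ℕ, i < D.k → i ∉ a.hit →
      (∀ y ∈ Y, y < D.n ∧ D.d (ce i) y ≤ ρ i) ∧ Y.card = countBelow (fun p => μ p = i) D.n := by
    intro i
    by_cases hi : i < D.k ∧ i ∉ a.hit
    · have h1 := hs.score i hi.1 hi.2
      rw [Data.score_eq] at h1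
      have h2 := h1.trans (min_le_right _ _)
      rw [countBelow.eq_def (fun y => D.d (ce i) y ≤ ρ i)] at h2
      obtain ⟨Y, hYs, hYc⟩ := Finset.exists_subset_card_eq h2
      refine ⟨Y, fun _ _ => ⟨fun y hy => by simpa using hYs hy, hYc⟩⟩
    · exact ⟨∅, fun h h' => absurd ⟨h, h'⟩ hi⟩
  choose Y hYspec using hY
  have hYmem : ∀ i < D.k, i ∉ a.hit → ∀ y ∈ Y i, y < D.n ∧ D.d (ce i) y ≤ ρ i :=
    fun i hi hiH => (hYspec i hi hiH).1
  have hYcard : ∀ i < D.k, i ∉ a.hit → (Y i).card = countBelow (fun p => μ p = i) D.n :=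
    fun i hi hiH => (hYspec i hi hiH).2
  have hfar : ∀ i < D.k, i ∉ a.hit → ∀ j < D.k, j ∉ a.hit → i < j →
      5 * ρ j < D.d (ce i) (ce j) := by
    intro i hi hiH j hj hjH hij
    by_contra! h
    exact hs.not_bad j hj hjH i hi (.inl ⟨.inr hij, by rwa [hknown i hiH]⟩)
  -- The later cluster has the larger radius, so a common point would put the two centers within `2
  -- * ρ j`, while they are more than `5 * ρ j` apart. This is where the order by radius matters.
  have hdisj' : ∀ i < D.k, i ∉ a.hit → ∀ j < D.k, j ∉ a.hit → i < j → Disjoint (Y i) (Y j) := by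
    intro i hi hiH j hj hjH hij
    rw [Finset.disjoint_left]
    intro y hyi hyj
    have h1 := hYmem i hi hiH y hyi
    have h2 := hYmem j hj hjH y hyj
    have h3 := hfar i hi hiH j hj hjH hij
    have h4 := hm.triangle _ (hs.lt i hi) _ h1.1 _ (hs.lt j hj)
    rw [hm.symm y h1.1 _ (hs.lt j hj)] at h4
    have h5 := hp.mono i j hij.le hj
    have h6 := hp.nonneg j
    linarith [h1.2, h2.2]
  have hdisj : ∀ i < D.k, i ∉ a.hit → ∀ j < D.k, j ∉ a.hit → i ≠ j → Disjoint (Y i) (Y j) := by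
    intro i hi hiH j hj hjH hij
    rcases lt_or_gt_of_ne hij with h | h
    · exact hdisj' i hi hiH j hj hjH h
    · exact (hdisj' j hj hjH i hi hiH h).symm
  let E : ℕ → ℕ → Prop := fun i l =>
    i < D.k ∧ i ∉ a.hit ∧ l < D.k ∧ l ∉ a.hit ∧ ∃ y ∈ Y i, μ y = l
  -- a chain of clusters leading to an anchored cluster stays near its anchor
  have hbit : ∀ i < D.k, i ∉ a.hit → ∀ l < D.k, l ∈ a.hit →
      D.d (a.pt l) (ce i) ≤ 4 * ρ l + 2 * ρ i → D.d (a.pt l) (c i) ≤ 4 * ρ l + 2 * ρ i := by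
    intro i hi hiH l hl hlH h
    by_contra h'
    exact hs.not_bad i hi hiH l hl (.inr ⟨hlH, .inl ⟨(ha.bit l hl hlH i hi).2 h', h⟩⟩)
  -- With `l = μ y`, the ball test gives `5 * ρ i < 6 * ρ l + ρ i`, so `ce i` is within `5/2 * ρ l`
  -- of `c l`. Without progress the anchor of `l` is then within `3 * ρ l` of `c l`, which puts `ce
  -- i` within `4 * ρ l + ρ i` of the anchor. The bit transfers the bound from `ce i` to `c i`.
  have hbase : ∀ i < D.k, i ∉ a.hit → ∀ y ∈ Y i, μ y ∈ a.hit →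
      D.d (a.pt (μ y)) (c i) ≤ 4 * ρ (μ y) + 2 * ρ i := by
    intro i hi hiH y hy hlH
    obtain ⟨hyn, hyd⟩ := hYmem i hi hiH y hy
    have hl := hp.map_lt y hyn
    have h1 := hp.dist_center_le hm (hs.lt i hi) hyn hyd
    have h2 : 5 * ρ i < D.d (a.pt (μ y)) (ce i) := by
      by_contra! h
      exact hs.not_bad i hi hiH _ hl (.inl ⟨.inl hlH, by rwa [hknown' _ hlH]⟩)
    have h3 := hm.triangle _ (ha.pt_lt _ hl hlH) _ (hp.center_lt _ hl) _ (hs.lt i hi)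
    rw [hm.symm _ (hp.center_lt _ hl) _ (hs.lt i hi)] at h3
    have h4 := ha.dist_pt _ hl hlH
    have h5 := hE2 _ hl hlH i hi (by rw [hknown i hiH]; linarith [hp.nonneg (μ y)])
    exact hbit i hi hiH _ hl hlH (by linarith [hp.nonneg i])
  -- Lack of progress gives `5 * ρ i' < ρ i + ρ i'`. The two steps from `c i'` to `ce i` therefore
  -- keep the new center within `4 * ρ l + ρ i + 3 * ρ i' ≤ 4 * ρ l + 2 * ρ i` of the anchor, and
  -- the bit returns the bound to `c i`. It does not deteriorate with the length of the chain.
  have hstep : ∀ i i', E i i' → ∀ l < D.k, l ∈ a.hit →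
      D.d (a.pt l) (c i') ≤ 4 * ρ l + 2 * ρ i' → D.d (a.pt l) (c i) ≤ 4 * ρ l + 2 * ρ i := by
    rintro i i' ⟨hi, hiH, hi', hi'H, y, hy, rfl⟩ l hl hlH hd
    obtain ⟨hyn, hyd⟩ := hYmem i hi hiH y hy
    have h1 := hp.dist_center_le hm (hs.lt i hi) hyn hyd
    have h2 := hE1 _ hi' hi'H i hi
    rw [hknown i hiH] at h2
    have h3 := hm.triangle _ (ha.pt_lt _ hl hlH) _ (hp.center_lt _ hi') _ (hs.lt i hi)
    rw [hm.symm _ (hp.center_lt _ hi') _ (hs.lt i hi)] at h3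
    exact hbit i hi hiH l hl hlH (by linarith [hp.nonneg i, hp.nonneg (μ y)])
  have hchain : ∀ i0 i, Relation.ReflTransGen E i0 i → ∀ l < D.k, l ∈ a.hit →
      D.d (a.pt l) (c i) ≤ 4 * ρ l + 2 * ρ i → D.d (a.pt l) (c i0) ≤ 4 * ρ l + 2 * ρ i0 := by
    intro i0 i hE l hl hlH hd
    induction hE using Relation.ReflTransGen.head_induction_on with
    | refl => exact hd
    | head h _ ih => exact hstep _ _ h l hl hlH ih
  -- This is the source of the constant 13: `5 * ρ (μ z) < 4 * ρ l + 2 * ρ (μ z)` bounds `3 * ρ (μ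
  -- z)` by `4 * ρ l`, and the path through the center and the anchor has length at most `3 * ρ (μ
  -- z) + 9 * ρ l`.
  have hserve : ∀ z < D.n, μ z ∉ a.hit → ∀ l < D.k, l ∈ a.hit →
      D.d (a.pt l) (c (μ z)) ≤ 4 * ρ l + 2 * ρ (μ z) → D.d z (ce l) ≤ 13 * ρ l := by
    intro z hz hzH l hl hlH hd
    have h1 := hE1 _ (hp.map_lt z hz) hzH l hl
    rw [hknown' l hlH] at h1
    have h2 := hm.triangle z hz _ (hp.center_lt _ (hp.map_lt z hz)) _ (hs.lt l hl)
    have h3 := hm.triangle _ (hp.center_lt _ (hp.map_lt z hz)) _ (ha.pt_lt l hl hlH) _ (hs.lt l hl)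
    rw [hm.symm _ (hp.center_lt _ (hp.map_lt z hz)) _ (ha.pt_lt l hl hlH)] at h3
    have h4 := hs.hit_near l hl hlH
    linarith [hp.dist_le z hz]
  have hserve' : ∀ z < D.n, μ z ∈ a.hit → D.d z (ce (μ z)) ≤ 13 * ρ (μ z) := by
    intro z hz hzH
    have hl := hp.map_lt z hz
    have h2 := hm.triangle z hz _ (hp.center_lt _ hl) _ (hs.lt _ hl)
    have h3 := hm.triangle _ (hp.center_lt _ hl) _ (ha.pt_lt _ hl hzH) _ (hs.lt _ hl)
    rw [hm.symm _ (hp.center_lt _ hl) _ (ha.pt_lt _ hl hzH)] at h3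
    linarith [hp.dist_le z hz, hs.hit_near _ hl hzH, ha.dist_pt _ hl hzH, hp.nonneg (μ z)]
  suffices h : ∃ f : ℕ → ℕ, (∀ p ∈ Finset.range D.n, f p < D.k ∧ D.d p (ce (f p)) ≤ 13 * ρ (f p)) ∧
      ∀ l < D.k, ((Finset.range D.n).filter fun p => f p = l).card ≤ D.η (ce l) by
    obtain ⟨f, hf, hfc⟩ := h
    refine ⟨f, fun p hpn => hf p (Finset.mem_range.2 hpn), fun l hl => ?_⟩
    rw [countBelow_eq_card]
    exact hfc l hl
  refine exists_assignment (Finset.range D.n)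
    (fun p l => D.d p (ce l) ≤ 13 * ρ l) (fun l => D.η (ce l)) ?_
  intro T hT Q hQn hQ
  have hQlt : ∀ p ∈ Q, p < D.n := fun p hpQ => Finset.mem_range.1 (hQn hpQ)
  let C : ℕ → Finset ℕ := fun l => (Finset.range D.n).filter fun p => μ p = l
  have hC : ∀ l, (C l).card = countBelow (fun p => μ p = l) D.n := by
    intro l; rw [countBelow_eq_card]
  -- The free clusters to which points of `Q` can be passed along chains of reserved sets.
  let J : Finset ℕ := (Finset.range D.k).filter fun i =>
    i ∉ a.hit ∧ ∃ p ∈ Q, μ p ∉ a.hit ∧ Relation.ReflTransGen E (μ p) i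
  have hJ : ∀ i ∈ J, i < D.k ∧ i ∉ a.hit := by
    intro i hi
    simp only [J, Finset.mem_filter, Finset.mem_range] at hi
    exact ⟨hi.1, hi.2.1⟩
  have hJT : ∀ i ∈ J, ∀ y ∈ Y i, μ y ∈ J ∨ (μ y ∈ T ∧ μ y ∈ a.hit) := by
    intro i hi y hy
    simp only [J, Finset.mem_filter, Finset.mem_range] at hi
    obtain ⟨hik, hiH, p, hpQ, hpH, hpi⟩ := hi
    have hyn := (hYmem i hik hiH y hy).1
    have hl := hp.map_lt y hyn
    by_cases hlH : μ y ∈ a.hit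
    · refine .inr ⟨hQ p hpQ _ hl ?_, hlH⟩
      exact hserve p (hQlt p hpQ) hpH _ hl hlH
        (hchain _ _ hpi _ hl hlH (hbase i hik hiH y hy hlH))
    · refine .inl ?_
      simp only [J, Finset.mem_filter, Finset.mem_range]
      exact ⟨hl, hlH, p, hpQ, hpH, hpi.tail ⟨hik, hiH, hl, hlH, y, hy, rfl⟩⟩
  let TH := T.filter fun l => l ∈ a.hit
  have hdJ : Disjoint J TH := by
    rw [Finset.disjoint_left]
    intro l hl hl'
    exact (hJ l hl).2 (Finset.mem_filter.1 hl').2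
  -- Both `Q` and `Z` lie in `A`, and `Z` has as many points as the clusters in `J` together. Hence
  -- `A \ Z` is no larger than the anchored clusters in `T`, while a point of `Q` in some `Y i` is
  -- near `ce i` and forces `i ∈ T`.
  let A : Finset ℕ := (J ∪ TH).biUnion C
  let Z : Finset ℕ := J.biUnion Y
  have hAcard : A.card ≤ ∑ i ∈ J, (C i).card + ∑ l ∈ TH, (C l).card := by
    rw [← Finset.sum_union hdJ]
    exact Finset.card_biUnion_le
  have hZcard : Z.card = ∑ i ∈ J, (C i).card := by
    rw [Finset.card_biUnion]
    · exact Finset.sum_congr rfl fun i hi => by rw [hYcard i (hJ i hi).1 (hJ i hi).2, hC]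
    · intro i hi j hj hij
      exact hdisj i (hJ i hi).1 (hJ i hi).2 j (hJ j hj).1 (hJ j hj).2 hij
  have hmemA : ∀ y < D.n, (μ y ∈ J ∨ (μ y ∈ T ∧ μ y ∈ a.hit)) → y ∈ A := by
    intro y hy h
    simp only [A, C, TH, Finset.mem_biUnion, Finset.mem_union, Finset.mem_filter,
      Finset.mem_range]
    exact ⟨μ y, h, hy, rfl⟩
  have hZA : Z ⊆ A := by
    intro y hy
    obtain ⟨i, hi, hy⟩ := Finset.mem_biUnion.1 hy
    exact hmemA y (hYmem i (hJ i hi).1 (hJ i hi).2 y hy).1 (hJT i hi y hy)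
  have hQA : Q ⊆ A := by
    intro p hpQ
    have hpn := hQlt p hpQ
    refine hmemA p hpn ?_
    by_cases hH : μ p ∈ a.hit
    · exact .inr ⟨hQ p hpQ _ (hp.map_lt p hpn) (hserve' p hpn hH), hH⟩
    · refine .inl ?_
      simp only [J, Finset.mem_filter, Finset.mem_range]
      exact ⟨hp.map_lt p hpn, hH, p, hpQ, hH, .refl⟩
  have hQZ : (Q ∩ Z).card ≤ ∑ i ∈ J ∩ T, (C i).card := by
    have h1 : Q ∩ Z ⊆ (J ∩ T).biUnion Y := by
      intro p hpm
      obtain ⟨hpQ, hpZ⟩ := Finset.mem_inter.1 hpm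
      obtain ⟨i, hi, hpY⟩ := Finset.mem_biUnion.1 hpZ
      refine Finset.mem_biUnion.2 ⟨i, Finset.mem_inter.2 ⟨hi, ?_⟩, hpY⟩
      refine hQ p hpQ i (hJ i hi).1 ?_
      have h2 := hYmem i (hJ i hi).1 (hJ i hi).2 p hpY
      rw [hm.symm p h2.1 _ (hs.lt i (hJ i hi).1)]
      linarith [h2.2, hp.nonneg i]
    refine (Finset.card_le_card h1).trans (Finset.card_biUnion_le.trans ?_)
    refine Finset.sum_le_sum fun i hi => ?_
    have := hJ i (Finset.mem_inter.1 hi).1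
    rw [hYcard i this.1 this.2, hC]
  have hsplit : Q.card ≤ (Q ∩ Z).card + (A \ Z).card := by
    rw [← Finset.card_inter_add_card_sdiff Q Z]
    exact Nat.add_le_add_left (Finset.card_le_card (Finset.sdiff_subset_sdiff hQA le_rfl)) _
  have hAZ : (A \ Z).card ≤ ∑ l ∈ TH, (C l).card := by
    rw [Finset.card_sdiff_of_subset hZA, hZcard]
    omega
  have hfin : ∑ i ∈ J ∩ T, (C i).card + ∑ l ∈ TH, (C l).card ≤ ∑ l ∈ T, (C l).card := by
    rw [← Finset.sum_union (Finset.disjoint_of_subset_left Finset.inter_subset_left hdJ)]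
    refine Finset.sum_le_sum_of_subset ?_
    exact Finset.union_subset Finset.inter_subset_right (Finset.filter_subset _ _)
  calc Q.card ≤ ∑ l ∈ T, (C l).card := by omega
    _ ≤ ∑ l ∈ T, D.η (ce l) := by
      refine Finset.sum_le_sum fun l hl => ?_
      have hlk := Finset.mem_range.1 (hT hl)
      rw [hC]
      by_cases hlH : l ∈ a.hit
      · exact (hp.capacity l hlk).trans (hs.hit_capacity l hlk hlH)
      · have := hs.score l hlk hlH
        rw [Data.score_eq] at this
        exact this.trans (min_le_left _ _)

end CSR

namespace CSR

/-! ### Rounds, blocks of advice, and the potential -/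

variable {D : Data} {ρ : ℕ → ℝ} {c μ : ℕ → ℕ} {a : Anchors}

theorem countBelow_mono {P Q : ℕ → Prop} {M : ℕ} (h : ∀ j < M, P j → Q j) :
    countBelow P M ≤ countBelow Q M := by
  classical
  rw [countBelow_eq_card, countBelow_eq_card]
  refine Finset.card_le_card fun j hj => ?_
  simp only [Finset.mem_filter, Finset.mem_range] at hj ⊢
  exact ⟨hj.1, h j hj.1 hj.2⟩

theorem countBelow_lt {P Q : ℕ → Prop} {M j : ℕ} (h : ∀ j < M, P j → Q j) (hj : j < M)
    (hP : ¬ P j) (hQ : Q j) : countBelow P M < countBelow Q M := by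
  classical
  rw [countBelow_eq_card, countBelow_eq_card]
  refine Finset.card_lt_card ((Finset.ssubset_iff_of_subset fun j hj => ?_).2
    ⟨j, by simp [hj, hQ], by simp [hP]⟩)
  simp only [Finset.mem_filter, Finset.mem_range] at hj ⊢
  exact ⟨hj.1, h j hj.1 hj.2⟩

theorem countBelow_le (P : ℕ → Prop) (M : ℕ) : countBelow P M ≤ M := by
  classical
  rw [countBelow_eq_card]
  simpa using Finset.card_filter_le (Finset.range M) P

theorem countBelow_congr {P Q : ℕ → Prop} {M : ℕ} (h : ∀ j < M, (P j ↔ Q j)) :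
    countBelow P M = countBelow Q M :=
  le_antisymm (countBelow_mono fun j hj => (h j hj).1) (countBelow_mono fun j hj => (h j hj).2)

/-- The anchors after a round, where `b` holds the guesses: the ranks of the centers of the
anchored clusters, the cluster that gets a new anchor, the cluster where it is found, and the
clusters that are near it. -/
noncomputable def Data.event (D : Data) (ρ : ℕ → ℝ) (a : Anchors) (b : ℕ → ℕ) : Anchors where
  hit := insert (b D.k) a.hit
  pt := Function.update a.pt (b D.k) (a.known (D.centers ρ a b) (b (D.k + 1)))
  bit := Function.update a.bit (b D.k) fun i => if i < D.k then b (D.k + 2 + i) else 0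

/-- A round reads only `2 * k + 2` numbers: `k` ranks, the cluster to be anchored, the source of its
anchor and `k` bits. The bits are cut off at `k` in `Data.event` for this purpose. -/
theorem Data.event_congr (D : Data) (ρ : ℕ → ℝ) (a : Anchors) {b b' : ℕ → ℕ}
    (h : ∀ r < 2 * D.k + 2, b r = b' r) : D.event ρ a b = D.event ρ a b' := by
  have h1 : D.centers ρ a b = D.centers ρ a b' := D.centers_congr ρ a fun l hl => h l (by omega)
  have h2 : (fun i => if i < D.k then b (D.k + 2 + i) else 0) =
      fun i => if i < D.k then b' (D.k + 2 + i) else 0 := by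
    funext i
    split_ifs with hi
    · exact h _ (by omega)
    · rfl
  unfold Data.event
  rw [h1, h2, h D.k (by omega), h (D.k + 1) (by omega)]

/-- The anchors after `e` rounds. -/
noncomputable def Data.anchors (D : Data) (ρ : ℕ → ℝ) (blk : ℕ → ℕ → ℕ) : ℕ → Anchors
  | 0 => ⟨∅, 0, 0⟩
  | e + 1 => D.event ρ (D.anchors ρ blk e) (blk e)

theorem Data.anchors_congr (D : Data) (ρ : ℕ → ℝ) {b b' : ℕ → ℕ → ℕ} (e : ℕ)
    (h : ∀ e' < e, ∀ r < 2 * D.k + 2, b e' r = b' e' r) : D.anchors ρ b e = D.anchors ρ b' e := by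
  induction e with
  | zero => rfl
  | succ e ih =>
    rw [Data.anchors, Data.anchors, ih fun e' he' => h e' (by omega),
      D.event_congr ρ _ (h e (Nat.lt_succ_self e))]

/-- A measure of progress. -/
noncomputable def Data.potential (D : Data) (ρ : ℕ → ℝ) (c : ℕ → ℕ) (a : Anchors) : ℕ :=
  countBelow (fun l => l ∈ a.hit) D.k +
    countBelow (fun l => l ∈ a.hit ∧ D.d (a.pt l) (c l) ≤ 3 * ρ l) D.k

/-- If the round with the right ranks makes no progress, `Data.Planted.servable` applies. Otherwise
the witnesses of progress and the true bits complete the block. A new anchor raises the first count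
of the potential and an improved one raises the second; neither count decreases, since the other
anchors are kept. -/
theorem Data.Planted.exists_block (hm : D.IsMetric) (hp : D.Planted ρ c μ) (hk : 0 < D.k)
    (ha : D.Valid ρ c a) :
    ∃ b : ℕ → ℕ, (∀ r, b r ≤ D.k + 1) ∧ b (D.k + 1) < D.k ∧
      (D.Servable ρ (D.centers ρ a b) ∨
        (D.Valid ρ c (D.event ρ a b) ∧ D.potential ρ c a < D.potential ρ c (D.event ρ a b))) := by
  classical
  obtain ⟨m, hmk, hstuck⟩ := hp.exists_stuck hm ha
  by_cases hno : ∀ l j, ¬ D.Progress ρ c a (D.centers ρ a m) l j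
  · refine ⟨fun r => if r < D.k then m r else 0, fun r => ?_, by simpa using hk, .inl ?_⟩
    · dsimp only
      split_ifs with h
      · exact (hmk r h).le.trans (by omega)
      · omega
    · rw [D.centers_congr ρ a (m' := m) (fun l hl => by simp [hl])]
      exact hp.servable hm ha (hstuck hno) hno
  · push Not at hno
    obtain ⟨l, j, hl, hj, hjn, hprog⟩ := hno
    set x := a.known (D.centers ρ a m) j with hx
    let b : ℕ → ℕ := fun r => if r < D.k then m r else if r = D.k then l else
      if r = D.k + 1 then j else
        if D.d x (c (r - (D.k + 2))) ≤ 4 * ρ l + 2 * ρ (r - (D.k + 2)) then 1 else 0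
    have hbm : D.centers ρ a b = D.centers ρ a m :=
      D.centers_congr ρ a fun l hl => by simp [b, hl]
    have hbl : b D.k = l := by simp [b]
    have hbj : b (D.k + 1) = j := by simp [b]
    have hbi : ∀ i, b (D.k + 2 + i) = if D.d x (c i) ≤ 4 * ρ l + 2 * ρ i then 1 else 0 := by
      intro i
      have h1 : ¬ D.k + 2 + i < D.k := by omega
      have h2 : ¬ D.k + 2 + i = D.k := by omega
      have h3 : ¬ D.k + 2 + i = D.k + 1 := by omega
      simp only [b, h1, h2, h3, if_false, Nat.add_sub_cancel_left]
    have hev : D.event ρ a b = ⟨insert l a.hit, Function.update a.pt l x,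
        Function.update a.bit l fun i =>
          if i < D.k then (if D.d x (c i) ≤ 4 * ρ l + 2 * ρ i then 1 else 0) else 0⟩ := by
      unfold Data.event
      simp only [hbl, hbj, hbm, hbi, ← hx]
    have hd5 : D.d x (c l) ≤ 5 * ρ l := by
      rcases hprog with h | h
      · exact h.2
      · linarith [h.2.2, hp.nonneg l]
    refine ⟨b, fun r => ?_, by rw [hbj]; exact hj, .inr ⟨?_, ?_⟩⟩
    · by_cases h1 : r < D.k
      · simp only [b, h1, if_true]; exact (hmk r h1).le.trans (by omega)
      · simp only [b, h1, if_false]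
        split_ifs <;> omega
    · rw [hev]
      refine ⟨fun l' hl' hH => ?_, fun l' hl' hH => ?_, fun j' hj' hH i hi => ?_⟩
      · by_cases h : l' = l
        · subst h; simpa using hjn
        · simp only [Function.update_of_ne h]
          exact ha.pt_lt l' hl' (hH.resolve_left h)
      · by_cases h : l' = l
        · subst h; simpa using hd5
        · simp only [Function.update_of_ne h]
          exact ha.dist_pt l' hl' (hH.resolve_left h)
      · by_cases h : j' = l
        · subst h
          simp [hi]
        · simp only [Function.update_of_ne h]
          exact ha.bit j' hj' (hH.resolve_left h) i hi
    · rw [hev]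
      unfold Data.potential
      rcases hprog with ⟨hlH, -⟩ | ⟨hlH, h3, h3'⟩
      · refine Nat.add_lt_add_of_lt_of_le (countBelow_lt (j := l) ?_ hl hlH ?_)
          (countBelow_mono ?_)
        · exact fun _ _ h => .inr h
        · exact .inl rfl
        · rintro l' hl' ⟨h1, h2⟩
          have : l' ≠ l := by rintro rfl; exact hlH h1
          refine ⟨.inr h1, ?_⟩
          simpa only [Function.update_of_ne this] using h2
      · refine Nat.add_lt_add_of_le_of_lt (countBelow_mono ?_)
          (countBelow_lt (j := l) ?_ hl ?_ ?_)
        · exact fun _ _ h => .inr h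
        · rintro l' hl' ⟨h1, h2⟩
          have : l' ≠ l := by rintro rfl; exact h2.not_gt h3
          refine ⟨.inr h1, ?_⟩
          simpa only [Function.update_of_ne this] using h2
        · exact fun h => h.2.not_gt h3
        · exact ⟨.inl rfl, by simpa using h3'⟩

/-- The potential is at most `2 * k` and grows in every unsuccessful round, so `2 * k + 1` rounds
cannot all fail. -/
theorem Data.Planted.exists_blocks (hm : D.IsMetric) (hp : D.Planted ρ c μ) (hk : 0 < D.k) :
    ∃ blk : ℕ → ℕ → ℕ, (∀ e r, blk e r ≤ D.k + 1) ∧ (∀ e, blk e (D.k + 1) < D.k) ∧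
      ∃ e ≤ 2 * D.k, D.Servable ρ (D.centers ρ (D.anchors ρ blk e) (blk e)) := by
  classical
  have hpick : ∀ a : Anchors, ∃ b : ℕ → ℕ, (∀ r, b r ≤ D.k + 1) ∧ b (D.k + 1) < D.k ∧
      (D.Valid ρ c a → D.Servable ρ (D.centers ρ a b) ∨
        (D.Valid ρ c (D.event ρ a b) ∧
          D.potential ρ c a < D.potential ρ c (D.event ρ a b))) := by
    intro a
    by_cases ha : D.Valid ρ c a
    · obtain ⟨b, h1, h2, h3⟩ := hp.exists_block hm hk ha
      exact ⟨b, h1, h2, fun _ => h3⟩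
    · exact ⟨fun _ => 0, fun _ => Nat.zero_le _, hk, fun h => absurd h ha⟩
  choose pick hpick1 hpick2 hpick3 using hpick
  -- The block of a round depends on the anchors left by the previous ones, so the anchors are built
  -- by recursion together with the picks.
  let st : ℕ → Anchors := fun e =>
    Nat.rec (motive := fun _ => Anchors) ⟨∅, 0, 0⟩ (fun _ a => D.event ρ a (pick a)) e
  have hst : ∀ e, D.anchors ρ (fun e => pick (st e)) e = st e := by
    intro e
    induction e with
    | zero => rfl
    | succ e ih => rw [Data.anchors, ih]
  refine ⟨fun e => pick (st e), fun e r => hpick1 _ _, fun e => hpick2 _, ?_⟩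
  by_contra! hno
  have main : ∀ e ≤ 2 * D.k + 1, D.Valid ρ c (st e) ∧ e ≤ D.potential ρ c (st e) := by
    intro e
    induction e with
    | zero =>
      intro _
      exact ⟨⟨fun _ _ h => absurd h (by simp [st]), fun _ _ h => absurd h (by simp [st]),
        fun _ _ h => absurd h (by simp [st])⟩, Nat.zero_le _⟩
    | succ e ih =>
      intro he
      obtain ⟨h1, h2⟩ := ih (by omega)
      have h3 := (hpick3 (st e) h1).resolve_left (by
        have := hno e (by omega)
        rwa [hst] at this)
      exact ⟨h3.1, lt_of_le_of_lt h2 h3.2⟩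
  have h1 := (main _ le_rfl).2
  unfold Data.potential at h1
  have h2 := countBelow_le (fun l => l ∈ (st (2 * D.k + 1)).hit) D.k
  have h3 := countBelow_le (fun l => l ∈ (st (2 * D.k + 1)).hit ∧
    D.d ((st (2 * D.k + 1)).pt l) (c l) ≤ 3 * ρ l) D.k
  omega

end CSR

namespace CSR

variable {D : Data}

/-! ### The scale of the radii -/

/-- The points `q 0, …, q k` are chosen by the farthest-first traversal. -/
def Data.Spread (D : Data) (q : ℕ → ℕ) (j : ℕ) (md : ℕ → ℝ) : Prop :=
  (∀ b ≤ j, q b < D.n) ∧ (∀ x < D.n, ∃ b ≤ j, md x = D.d (q b) x) ∧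
    (∀ b ≤ j, ∀ x < D.n, md x ≤ D.d (q b) x) ∧
    ∀ b c, b < c → c ≤ j → ∀ x < D.n, md x ≤ D.d (q b) (q c)

/-- By pigeonhole the covering radius `md z` of the traversal is at most `2R`. If its ceiling
exceeds `R/2`, it is the value sought. Otherwise take a point at rounded distance `R` from its
center and a traversal point within the covering radius of that center: their rounded distance is
between `R/2` and `3R/2`. -/
theorem Data.Spread.exists_scale (hm : D.IsMetric) {q : ℕ → ℕ} {md : ℕ → ℝ}
    (hq : D.Spread q D.k md) {c μ : ℕ → ℕ} (hc : ∀ l < D.k, c l < D.n)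
    (hμ : ∀ p < D.n, μ p < D.k) {R : ℕ} (hR : ∀ p < D.n, D.d p (c (μ p)) ≤ R)
    (hR' : ∃ p < D.n, ⌈D.d p (c (μ p))⌉ = (R : ℤ)) :
    ∃ j ≤ D.k, ∃ x < D.n, ⌈D.d (q j) x⌉ ≤ 2 * (R : ℤ) ∧ (R : ℤ) ≤ 2 * ⌈D.d (q j) x⌉ := by
  obtain ⟨hqn, hmd, hmd', hsep⟩ := hq
  obtain ⟨p, hp, hpR⟩ := hR'
  obtain ⟨z, hz, hzmax⟩ := Finset.exists_max_image (Finset.range D.n) md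
    ⟨p, Finset.mem_range.2 hp⟩
  simp only [Finset.mem_range] at hz hzmax
  have hδ : md z ≤ 2 * R := by
    have hcard : (Finset.range D.k).card < (Finset.range (D.k + 1)).card := by simp
    obtain ⟨b, hb, b', hb', hne, heq⟩ := Finset.exists_ne_map_eq_of_card_lt_of_maps_to
      (f := fun b => μ (q b)) hcard (by
        intro b hb
        simp only [Finset.coe_range, Set.mem_Iio] at hb ⊢
        exact hμ _ (hqn b (by omega)))
    simp only [Finset.mem_range] at hb hb'
    have aux : ∀ b b', b < b' → b' ≤ D.k → μ (q b) = μ (q b') → md z ≤ 2 * R := by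
      intro b b' hbb hb' heq
      have h1 := hsep b b' hbb hb' z hz
      have h2 := hqn b (by omega)
      have h3 := hqn b' hb'
      have h4 := hm.triangle _ h2 _ (hc _ (hμ _ h2)) _ h3
      rw [hm.symm _ (hc _ (hμ _ h2)) _ h3] at h4
      have h5 := hR _ h2
      have h6 := hR _ h3
      rw [← heq] at h6
      linarith
    rcases lt_or_gt_of_ne hne with h | h
    · exact aux b b' h (by omega) heq
    · exact aux b' b h (by omega) heq.symm
  have hδ' : ⌈md z⌉ ≤ 2 * (R : ℤ) := Int.ceil_le.2 (by push_cast; exact hδ)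
  by_cases hcase : (R : ℤ) < 2 * ⌈md z⌉
  · obtain ⟨b, hb, hbz⟩ := hmd z hz
    exact ⟨b, hb, z, hz, by rw [← hbz]; exact hδ', by rw [← hbz]; exact hcase.le⟩
  · have hcp := hc _ (hμ p hp)
    obtain ⟨b, hb, hbz⟩ := hmd _ hcp
    have h1 : D.d (q b) (c (μ p)) ≤ md z := hbz ▸ hzmax _ hcp
    have hqb := hqn b hb
    have h2 : (R : ℤ) ≤ ⌈md z⌉ + ⌈D.d (q b) p⌉ := by
      rw [← hpR]
      refine (Int.ceil_mono ?_).trans (Int.ceil_add_le _ _)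
      have := hm.triangle p hp _ hqb _ hcp
      rw [hm.symm p hp _ hqb] at this
      linarith
    have h3 : ⌈D.d (q b) p⌉ ≤ ⌈md z⌉ + (R : ℤ) := by
      refine (Int.ceil_mono (b := md z + R) ?_).trans ?_
      · have := hm.triangle _ hqb _ hcp _ hp
        rw [hm.symm _ hcp _ hp] at this
        linarith [hR p hp]
      · have := Int.ceil_add_natCast (md z) R
        rw [this]
    exact ⟨b, hb, p, hp, by omega, by omega⟩

/-- The radii of the clusters `l < k` given by the multiples `g l` of the unit `u`. -/
noncomputable def gridRadius (k : ℕ) (u : ℝ) (g : ℕ → ℕ) (l : ℕ) : ℝ :=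
  if l < k then (⌊(g l : ℝ) * u⌋ : ℝ) else 0

/-- The outer floor makes the radii integral and loses nothing, since a multiple of the unit that is
at least the integer `r l` has floor at least `r l`. Rounding up costs at most one unit for each
cluster. -/
theorem exists_grid {k H R V : ℕ} (hH : 16 * k ≤ 2 ^ H) {v : ℤ} (hv : v ≤ 2 * (R : ℤ))
    (hv' : (R : ℤ) ≤ 2 * v) {r : ℕ → ℕ} (hr : ∀ l < k, r l ≤ R)
    (hmono : ∀ l l', l ≤ l' → l' < k → r l ≤ r l') (hsum : ∑ l ∈ Finset.range k, r l ≤ V)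
    (hRV : R ≤ V) :
    ∃ g : ℕ → ℕ, (∀ l, g l ≤ 2 * 2 ^ H) ∧
      (∀ l, 0 ≤ gridRadius k ((v : ℝ) / 2 ^ H) g l) ∧
      (∀ l < k, (r l : ℝ) ≤ gridRadius k ((v : ℝ) / 2 ^ H) g l) ∧
      (∀ l l', l ≤ l' → l' < k →
        gridRadius k ((v : ℝ) / 2 ^ H) g l ≤ gridRadius k ((v : ℝ) / 2 ^ H) g l') ∧
      ∑ l ∈ Finset.range k, 13 * gridRadius k ((v : ℝ) / 2 ^ H) g l ≤ 15 * V := by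
  have hv0 : (0 : ℝ) ≤ v := by
    have : (0 : ℤ) ≤ v := by omega
    exact_mod_cast this
  have hM : (0 : ℝ) < 2 ^ H := by positivity
  set u : ℝ := (v : ℝ) / 2 ^ H with hu
  have hu0 : 0 ≤ u := by positivity
  have hRv : (R : ℝ) ≤ 2 * v := by exact_mod_cast hv'
  have hvR : (v : ℝ) ≤ 2 * R := by exact_mod_cast hv
  -- The bound on `g l` comes from `r l ≤ R ≤ 2 * v`. If the unit is zero, then `v`, `R` and all `r
  -- l` vanish and the junk value of the quotient does no harm.
  let g : ℕ → ℕ := fun l => if l < k then ⌈(r l : ℝ) / u⌉₊ else 0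
  have hg1 : ∀ l < k, (r l : ℝ) ≤ g l * u := by
    intro l hl
    simp only [g, hl, if_true]
    rcases hu0.eq_or_lt with h | h
    · have hv00 : (v : ℝ) = 0 := by
        rw [hu] at h
        rcases div_eq_zero_iff.1 h.symm with h | h
        · exact h
        · exact absurd h hM.ne'
      have : (r l : ℝ) ≤ R := by exact_mod_cast hr l hl
      rw [← h]
      linarith
    · rw [← div_le_iff₀ h]
      exact Nat.le_ceil _
  have hg2 : ∀ l < k, (g l : ℝ) * u ≤ r l + u := by
    intro l hl
    simp only [g, hl, if_true]
    rcases hu0.eq_or_lt with h | h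
    · rw [← h]; simp
    · have h1 := (Nat.ceil_lt_add_one (div_nonneg (Nat.cast_nonneg (r l)) hu0)).le
      calc (⌈(r l : ℝ) / u⌉₊ : ℝ) * u ≤ ((r l : ℝ) / u + 1) * u := by gcongr
        _ = r l + u := by field_simp
  refine ⟨g, fun l => ?_, fun l => ?_, fun l hl => ?_, fun l l' hll hl' => ?_, ?_⟩
  · by_cases hl : l < k
    · simp only [g, hl, if_true]
      rw [Nat.ceil_le]
      refine div_le_of_le_mul₀ hu0 (by positivity) ?_
      have : (r l : ℝ) ≤ R := by exact_mod_cast hr l hl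
      push_cast
      rw [hu, mul_assoc, mul_div_cancel₀ _ hM.ne']
      linarith
    · simp [g, hl]
  · unfold gridRadius
    split_ifs <;> [skip; exact le_rfl]
    exact_mod_cast Int.floor_nonneg.2 (mul_nonneg (Nat.cast_nonneg _) hu0)
  · rw [gridRadius, if_pos hl]
    have : (r l : ℤ) ≤ ⌊(g l : ℝ) * u⌋ := Int.le_floor.2 (by exact_mod_cast hg1 l hl)
    exact_mod_cast this
  · have hl : l < k := by omega
    rw [gridRadius, gridRadius, if_pos hl, if_pos hl']
    have : g l ≤ g l' := by
      simp only [g, hl, hl', if_true]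
      have := hmono l l' hll hl'
      gcongr
    exact_mod_cast Int.floor_mono (by gcongr)
  · have h1 : ∑ l ∈ Finset.range k, 13 * gridRadius k u g l ≤
        ∑ l ∈ Finset.range k, (13 * (r l : ℝ) + 13 * u) := by
      refine Finset.sum_le_sum fun l hl => ?_
      have := hg2 l (Finset.mem_range.1 hl)
      have h2 : gridRadius k u g l ≤ g l * u := by
        rw [gridRadius, if_pos (Finset.mem_range.1 hl)]
        exact Int.floor_le _
      linarith
    rw [Finset.sum_add_distrib, Finset.sum_const, Finset.card_range,
      nsmul_eq_mul] at h1
    have h2 : (∑ l ∈ Finset.range k, (r l : ℝ)) ≤ V := by exact_mod_cast hsum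
    have h3 : (R : ℝ) ≤ V := by exact_mod_cast hRV
    -- From `v ≤ 2 * R ≤ 2 * V` and `16 * k ≤ 2 ^ H`. The excess over `13 * V` is thus at most `13/8
    -- * V`, which is less than the slack `2 * V`.
    have h4 : (k : ℝ) * u ≤ V / 8 := by
      have h5 : (16 : ℝ) * k ≤ 2 ^ H := by exact_mod_cast hH
      rw [hu, mul_div_assoc', div_le_iff₀ hM]
      nlinarith
    rw [← Finset.mul_sum]
    rw [← Finset.mul_sum, ← Finset.mul_sum] at h1
    linarith

end CSR

namespace CSR

/-! ### From feasible solutions to guesses -/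

/-- The data of an instance in the form in which they are given to the machine. -/
noncomputable def dataOf {n : ℕ} {X : Type*} [MetricSpace X] (P : Fin n ↪ X) (k : ℕ)
    (η : Fin n → ℕ) : Data where
  n := n
  k := k
  d := fun i j => (input P k η).real 0 (i * n + j)
  η := (input P k η).nat 1

section

variable {n : ℕ} {X : Type*} [MetricSpace X] {P : Fin n ↪ X} {k : ℕ} {η : Fin n → ℕ}

theorem dataOf_d {i j : ℕ} (hi : i < n) (hj : j < n) :
    (dataOf P k η).d i j = dist (P ⟨i, hi⟩) (P ⟨j, hj⟩) := by
  have h : i * n + j < n * n := by nlinarith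
  have hdiv : (i * n + j) / n = i := by
    rw [mul_comm, Nat.mul_add_div (by omega), Nat.div_eq_of_lt hj, add_zero]
  have hmod : (i * n + j) % n = j := by
    rw [mul_comm, Nat.mul_add_mod, Nat.mod_eq_of_lt hj]
  have h1 : Fin.divNat (⟨i * n + j, h⟩ : Fin (n * n)) = ⟨i, hi⟩ := Fin.ext hdiv
  have h2 : Fin.modNat (⟨i * n + j, h⟩ : Fin (n * n)) = ⟨j, hj⟩ := Fin.ext hmod
  simp only [dataOf, input, if_true, h, dif_pos, h1, h2]

theorem dataOf_η {i : ℕ} (hi : i < n) : (dataOf P k η).η i = η ⟨i, hi⟩ := by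
  simp [dataOf, input, hi]

theorem dataOf_isMetric : (dataOf P k η).IsMetric where
  self x (hx : x < n) := by rw [dataOf_d hx hx, dist_self]
  symm x (hx : x < n) y (hy : y < n) := by rw [dataOf_d hx hy, dataOf_d hy hx, dist_comm]
  triangle x (hx : x < n) y (hy : y < n) z (hz : z < n) := by
    rw [dataOf_d hx hy, dataOf_d hy hz, dataOf_d hx hz]
    exact dist_triangle _ _ _

theorem countBelow_eq_card_fin (Q : ℕ → Prop) [DecidablePred fun i : Fin n => Q i] :
    countBelow Q n = (Finset.univ.filter fun i : Fin n => Q i).card := by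
  classical
  rw [countBelow_eq_card, Finset.card_filter, Finset.card_filter, ← Fin.sum_univ_eq_sum_range
    (fun i => if Q i then 1 else 0)]
  exact Finset.sum_congr rfl fun i _ => by congr

/-- A feasible solution, with its clusters ordered by their radii. -/
theorem Solution.Feasible.exists_planted (hn : 0 < n) {S : Solution n} (hS : S.Feasible P k η) :
    ∃ (c μ r : ℕ → ℕ) (R : ℕ),
      (∀ ρ : ℕ → ℝ, (∀ l, 0 ≤ ρ l) → (∀ l l', l ≤ l' → l' < k → ρ l ≤ ρ l') →
        (∀ l < k, (r l : ℝ) ≤ ρ l) → (dataOf P k η).Planted ρ c μ) ∧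
      (∀ l l', l ≤ l' → l' < k → r l ≤ r l') ∧ (∀ l < k, r l ≤ R) ∧
      (∃ p < n, ⌈(dataOf P k η).d p (c (μ p))⌉ = (R : ℤ)) ∧
      ∑ l ∈ Finset.range k, r l ≤ S.cost ∧ R ≤ S.cost := by
  classical
  let e : Fin k ≃ S.centers := (S.centers.equivFinOfCardEq hS.card_centers).symm
  -- The field `mono` of `Data.Planted` requires the clusters to be numbered by increasing radius.
  let σ := Tuple.sort fun l => S.radius (e l)
  let cf : Fin k → Fin n := fun l => e (σ l)
  have hcf : ∀ l, cf l ∈ S.centers := fun l => (e (σ l)).2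
  have hcfinj : Function.Injective cf := fun a b h => σ.injective (e.injective (Subtype.ext h))
  let μf : Fin n → Fin k := fun p => σ.symm (e.symm ⟨S.assign p, hS.assign_mem p⟩)
  have hμf : ∀ p, cf (μf p) = S.assign p := by
    intro p; simp [cf, μf]
  have hμf' : ∀ p l, μf p = l ↔ S.assign p = cf l := by
    intro p l
    rw [← hμf]
    exact ⟨fun h => h ▸ rfl, fun h => hcfinj h⟩
  have hmono : Monotone fun l => S.radius (cf l) := Tuple.monotone_sort fun l => S.radius (e l)
  have : Nonempty (Fin n) := ⟨⟨0, hn⟩⟩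
  obtain ⟨p0, -, hp0⟩ := Finset.exists_max_image (Finset.univ : Finset (Fin n))
    (fun p => ⌈dist (P p) (P (S.assign p))⌉₊) Finset.univ_nonempty
  set R := ⌈dist (P p0) (P (S.assign p0))⌉₊ with hRdef
  have hdR : ∀ p, dist (P p) (P (S.assign p)) ≤ R := fun p =>
    (Nat.le_ceil _).trans (by exact_mod_cast hp0 p (Finset.mem_univ p))
  let c : ℕ → ℕ := fun l => if h : l < k then cf ⟨l, h⟩ else 0
  let μ : ℕ → ℕ := fun p => if h : p < n then μf ⟨p, h⟩ else 0
  -- A given radius may exceed all distances in its cluster. Truncation at the largest rounded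
  -- distance `R` makes all radii comparable with the scale.
  let r : ℕ → ℕ := fun l => if h : l < k then min (S.radius (cf ⟨l, h⟩)) R else 0
  have hc : ∀ l (h : l < k), c l = cf ⟨l, h⟩ := fun l h => by simp [c, h]
  have hμ : ∀ p (h : p < n), μ p = μf ⟨p, h⟩ := fun p h => by simp [μ, h]
  have hr : ∀ l (h : l < k), r l = min (S.radius (cf ⟨l, h⟩)) R := fun l h => by simp [r, h]
  have hcμ : ∀ p (h : p < n), c (μ p) = S.assign ⟨p, h⟩ := by
    intro p h
    rw [hμ p h, hc _ (μf ⟨p, h⟩).2, Fin.eta, hμf]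
  have hd : ∀ p (h : p < n), (dataOf P k η).d p (c (μ p)) =
      dist (P ⟨p, h⟩) (P (S.assign ⟨p, h⟩)) := by
    intro p h
    rw [hcμ p h, dataOf_d h (S.assign ⟨p, h⟩).2]
  refine ⟨c, μ, r, R, fun ρ h0 hρ hrρ => ⟨?_, ?_, ?_, ?_, ?_, h0, hρ⟩, ?_, ?_, ?_, ?_, ?_⟩
  · intro l hl
    rw [hc l hl]
    exact (cf _).2
  · intro a ha b hb hab
    rw [hc a ha, hc b hb] at hab
    exact congrArg Fin.val (hcfinj (Fin.ext hab))
  · intro p hp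
    rw [hμ p hp]
    exact (μf _).2
  · intro p hp
    rw [hd p hp]
    have hlt : μ p < k := by rw [hμ p hp]; exact (μf _).2
    refine le_trans ?_ (hrρ _ hlt)
    have : cf ⟨μ p, hlt⟩ = S.assign ⟨p, hp⟩ := by
      rw [← hμf]; congr 1; exact Fin.ext (hμ p hp)
    rw [hr _ hlt, this, Nat.cast_min]
    exact le_min (hS.dist_le _) (hdR _)
  · intro l hl
    change countBelow (fun p => μ p = l) n ≤ _
    rw [hc l hl, dataOf_η (cf ⟨l, hl⟩).2, countBelow_eq_card_fin]
    refine le_trans (Finset.card_le_card fun p hp => ?_) (hS.capacity _ (hcf ⟨l, hl⟩))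
    simp only [Finset.mem_filter, Finset.mem_univ, true_and] at hp ⊢
    rw [hμ p p.2] at hp
    exact (hμf' p ⟨l, hl⟩).1 (Fin.ext hp)
  · intro l l' hll hl'
    rw [hr l (by omega), hr l' hl']
    exact min_le_min_right _ (hmono hll)
  · intro l hl
    rw [hr l hl]
    exact min_le_right _ _
  · refine ⟨p0, p0.2, ?_⟩
    rw [hd p0 p0.2, hRdef]
    exact (Int.natCast_ceil_eq_ceil dist_nonneg).symm
  · have h1 : ∑ l ∈ Finset.range k, r l ≤ ∑ l : Fin k, S.radius (cf l) := by
      rw [← Fin.sum_univ_eq_sum_range]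
      refine Finset.sum_le_sum fun l _ => ?_
      rw [hr l l.2]
      exact min_le_left _ _
    refine h1.trans (le_of_eq ?_)
    have h2 : ∑ l : Fin k, S.radius (cf l) = ∑ l : Fin k, S.radius (e l) :=
      Equiv.sum_comp σ fun l => S.radius (e l)
    rw [h2, Equiv.sum_comp e fun q : S.centers => S.radius q, Solution.cost,
      Finset.sum_coe_sort S.centers S.radius]
  · have h1 : R ≤ S.radius (S.assign p0) := Nat.ceil_le.2 (hS.dist_le p0)
    exact h1.trans (Finset.single_le_sum (f := S.radius) (fun _ _ => Nat.zero_le _)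
      (hS.assign_mem p0))

/-- The guesses for the round `e`. -/
def block (k : ℕ) (g : ℕ → ℕ) (e r : ℕ) : ℕ := g (k + e * (2 * k + 2) + r)

/-- The guess `g` leads to a successful round for the unit `u`. -/
def Data.Good (D : Data) (u : ℝ) (g : ℕ → ℕ) : Prop :=
  (∀ e ≤ 2 * D.k, block D.k g e (D.k + 1) < D.k) ∧
    ∃ e ≤ 2 * D.k, D.Servable (gridRadius D.k u g)
      (D.centers (gridRadius D.k u g) (D.anchors (gridRadius D.k u g) (block D.k g) e)
        (block D.k g e))

/-- The constant radius `R` serves to find the scale; the grid radii at that scale then give the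
blocks. Multiples of the unit and blocks are concatenated into one string of digits. -/
theorem Solution.Feasible.exists_good (hn : 0 < n) {S : Solution n} (hS : S.Feasible P k η)
    {q : ℕ → ℕ} {md : ℕ → ℝ} (hq : (dataOf P k η).Spread q k md) {H : ℕ}
    (hH : 16 * k ≤ 2 ^ H) :
    ∃ j ≤ k, ∃ x < n, ∃ g : ℕ → ℕ, (∀ i, g i ≤ 2 * 2 ^ H) ∧
      (dataOf P k η).Good ((⌈(dataOf P k η).d (q j) x⌉ : ℝ) / 2 ^ H) g ∧
      ∑ l ∈ Finset.range k,
        13 * gridRadius k ((⌈(dataOf P k η).d (q j) x⌉ : ℝ) / 2 ^ H) g l ≤ 15 * (S.cost : ℝ) := by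
  obtain ⟨c, μ, r, R, hpl, hmono, hrR, ⟨p, hp, hpR⟩, hsum, hRV⟩ := hS.exists_planted hn
  have hpl0 := hpl (fun _ => R) (fun _ => Nat.cast_nonneg _) (fun _ _ _ _ => le_rfl)
    (fun l hl => by exact_mod_cast hrR l hl)
  have hk : 0 < k := lt_of_le_of_lt (Nat.zero_le _) (hpl0.map_lt 0 hn)
  obtain ⟨j, hj, x, hx, hv, hv'⟩ := Data.Spread.exists_scale dataOf_isMetric hq hpl0.center_lt
    hpl0.map_lt hpl0.dist_le ⟨p, hp, hpR⟩
  obtain ⟨g0, hg0, hρ0, hρr, hρm, hcost⟩ := exists_grid hH hv hv' hrR hmono hsum hRV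
  set u : ℝ := (⌈(dataOf P k η).d (q j) x⌉ : ℝ) / 2 ^ H with hu
  have hpl' := hpl _ hρ0 hρm hρr
  obtain ⟨blk, hblk, hsrc, e, he, hserv⟩ := hpl'.exists_blocks dataOf_isMetric hk
  let g : ℕ → ℕ := fun i => if i < k then g0 i else
    blk ((i - k) / (2 * k + 2)) ((i - k) % (2 * k + 2))
  have hgk : ∀ i < k, g i = g0 i := fun i hi => by simp [g, hi]
  have hgr : gridRadius k u g = gridRadius k u g0 := by
    funext l
    unfold gridRadius
    split_ifs with h
    · rw [hgk l h]
    · rfl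
  have hgb : ∀ e, ∀ r < 2 * k + 2, block k g e r = blk e r := by
    intro e r hr
    have h1 : ¬ k + e * (2 * k + 2) + r < k := by
      have := Nat.zero_le (e * (2 * k + 2)); omega
    have h2 : k + e * (2 * k + 2) + r - k = (2 * k + 2) * e + r := by
      rw [mul_comm e]; omega
    have h3 : ((2 * k + 2) * e + r) / (2 * k + 2) = e := by
      rw [Nat.mul_add_div (by omega), Nat.div_eq_of_lt hr, add_zero]
    have h4 : ((2 * k + 2) * e + r) % (2 * k + 2) = r := by
      rw [Nat.mul_add_mod, Nat.mod_eq_of_lt hr]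
    simp only [block, g, h1, if_false, h2, h3, h4]
  refine ⟨j, hj, x, hx, g, fun i => ?_, ⟨fun e _ => ?_, e, he, ?_⟩, ?_⟩
  · by_cases hi : i < k
    · rw [hgk i hi]; exact hg0 i
    · simp only [g, hi, if_false]
      -- Entries of blocks are at most `k + 1`, which fits into a digit because `0 < k` and `16 * k
      -- ≤ 2 ^ H`.
      have := hblk ((i - k) / (2 * k + 2)) ((i - k) % (2 * k + 2))
      change _ ≤ k + 1 at this
      omega
  · change block k g e (k + 1) < k
    rw [hgb e (k + 1) (by omega)]
    exact hsrc e
  · change (dataOf P k η).Servable (gridRadius k u g) ((dataOf P k η).centers (gridRadius k u g)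
      ((dataOf P k η).anchors (gridRadius k u g) (block k g) e) (block k g e))
    rw [hgr, Data.anchors_congr (b' := blk) _ _ e fun e' _ r hr => hgb e' r hr,
      Data.centers_congr (m' := blk e) _ _ _ fun l hl => hgb e l (by
        change l < k at hl; omega)]
    exact hserv
  · rw [hgr]; exact hcost

end

/-! ### Digits -/

/-- This ensures that a counter running through all numbers below `B ^ L` meets every guess, and in
base 2 every set of clusters. -/
theorem exists_digits {B : ℕ} (L : ℕ) (g : ℕ → ℕ) (hg : ∀ i < L, g i < B) :
    ∃ t < B ^ L, ∀ i < L, t / B ^ i % B = g i := by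
  induction L with
  | zero => exact ⟨0, by simp, by simp⟩
  | succ L ih =>
    obtain ⟨t, ht, hd⟩ := ih fun i hi => hg i (by omega)
    have hB : 0 < B := lt_of_le_of_lt (Nat.zero_le _) (hg 0 (by omega))
    refine ⟨B ^ L * g L + t, ?_, fun i hi => ?_⟩
    · have := hg L (by omega)
      calc B ^ L * g L + t < B ^ L * g L + B ^ L := by omega
        _ = B ^ L * (g L + 1) := by ring
        _ ≤ B ^ L * B := Nat.mul_le_mul_left _ this
        _ = B ^ (L + 1) := by ring
    · rcases Nat.lt_succ_iff_lt_or_eq.1 hi with hi | rfl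
      · rw [← hd i hi]
        obtain ⟨r, rfl⟩ : ∃ r, L = i + 1 + r := ⟨L - (i + 1), by omega⟩
        have : B ^ (i + 1 + r) * g (i + 1 + r) + t =
            B ^ i * (B * (B ^ r * g (i + 1 + r))) + t := by ring
        rw [this, Nat.mul_add_div (by positivity), Nat.mul_add_mod]
      · rw [Nat.mul_add_div (by positivity), Nat.div_eq_of_lt ht, add_zero,
          Nat.mod_eq_of_lt (hg _ (by omega))]

/-- Incrementing a number changes a digit if and only if all lower digits are maximal. -/
theorem digit_succ (B t i : ℕ) :
    (t + 1) / B ^ i = if (t + 1) % B ^ i = 0 then t / B ^ i + 1 else t / B ^ i := by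
  rw [Nat.succ_div]
  simp only [Nat.dvd_iff_mod_eq_zero]
  split_ifs <;> rfl

end CSR

namespace CSR

/-! ### The program -/

namespace Reg

/-! Arrays of natural numbers. -/

@[simp] abbrev size : ℕ := 0
@[simp] abbrev eta : ℕ := 1
@[simp] abbrev flag : ℕ := 2
@[simp] abbrev outCenter : ℕ := 3
@[simp] abbrev outAssign : ℕ := 4
@[simp] abbrev row : ℕ := 5
@[simp] abbrev far : ℕ := 6
@[simp] abbrev guess : ℕ := 7
@[simp] abbrev subset : ℕ := 8
@[simp] abbrev hit : ℕ := 9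
@[simp] abbrev pt : ℕ := 10
@[simp] abbrev bits : ℕ := 11
@[simp] abbrev center : ℕ := 12
@[simp] abbrev known : ℕ := 13
@[simp] abbrev cap : ℕ := 14
@[simp] abbrev label : ℕ := 15
@[simp] abbrev mark : ℕ := 16

/-! Variables for natural numbers. -/

@[simp] abbrev pow : ℕ := 20
@[simp] abbrev expo : ℕ := 21
@[simp] abbrev base : ℕ := 22
@[simp] abbrev len : ℕ := 23
@[simp] abbrev guesses : ℕ := 24
@[simp] abbrev subsets : ℕ := 25
@[simp] abbrev best : ℕ := 26
@[simp] abbrev bestScore : ℕ := 27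
@[simp] abbrev acc : ℕ := 28
@[simp] abbrev carry : ℕ := 29
@[simp] abbrev cnt : ℕ := 30
@[simp] abbrev cnt' : ℕ := 31
@[simp] abbrev off : ℕ := 32
@[simp] abbrev good : ℕ := 33
@[simp] abbrev found : ℕ := 34
@[simp] abbrev extends' : ℕ := 35
@[simp] abbrev total : ℕ := 36
@[simp] abbrev a : ℕ := 40
@[simp] abbrev z : ℕ := 41
@[simp] abbrev t : ℕ := 42
@[simp] abbrev e : ℕ := 43
@[simp] abbrev l : ℕ := 44
@[simp] abbrev x : ℕ := 45
@[simp] abbrev y : ℕ := 46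
@[simp] abbrev j : ℕ := 47
@[simp] abbrev p : ℕ := 48
@[simp] abbrev q : ℕ := 49
@[simp] abbrev r : ℕ := 50
@[simp] abbrev i : ℕ := 51

/-! Arrays of reals. -/

@[simp] abbrev dist : ℕ := 0
@[simp] abbrev outRadius : ℕ := 1
@[simp] abbrev gap : ℕ := 2
@[simp] abbrev table : ℕ := 3
@[simp] abbrev rho : ℕ := 4
@[simp] abbrev rad : ℕ := 5

/-! Variables for reals. -/

@[simp] abbrev unit : ℕ := 6
@[simp] abbrev cost : ℕ := 7
@[simp] abbrev outCost : ℕ := 8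

end Reg

/-- The number of points. -/
abbrev NatExpr.n : NatExpr := .read Reg.size (.const 0)

/-- The number of clusters. -/
abbrev NatExpr.k : NatExpr := .read Reg.size (.const 1)

/-- Assignment to a variable. -/
abbrev Program.set (v : ℕ) (e : NatExpr) : Program := .setNat v (.const 0) e

/-- The distance of two points. -/
abbrev RealExpr.d (e f : NatExpr) : RealExpr := .read Reg.dist (.add (.read Reg.row e) f)

/-- Disjunction of tests. -/
abbrev Test.disj (b c : Test) : Test := .neg (.conj (.neg b) (.neg c))

/-- The distance of two points according to the memory. -/
def State.d (s : State) (x y : ℕ) : ℝ := s.real Reg.dist (s.nat Reg.row x + y)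

/-! ### Counters in a given base -/

/-- Increment the number with `m` digits in base `b` in the array `g`. -/
def Program.increment (g : ℕ) (m b : NatExpr) : Program :=
  .seq (.set Reg.carry (.const 1)) (.for Reg.i m
    (.cond (.natLe (.const 1) (.var Reg.carry))
      (.cond (.natLe b (.add (.read g (.var Reg.i)) (.const 1)))
        (.setNat g (.var Reg.i) (.const 0))
        (.seq (.setNat g (.var Reg.i) (.add (.read g (.var Reg.i)) (.const 1)))
          (.set Reg.carry (.const 0))))
      .skip))

/-- The running time of `Program.increment`. -/
def incrementTime (m b : NatExpr) (M : ℕ) : ℕ := 3 + forTime m M (b.time + 40)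

/-- The rule by which the carry passes from one digit to the next: when applied to `t + 1`, the left
side says that the carry is still alive. -/
theorem mod_pow_succ_eq_zero (B t j : ℕ) :
    t % B ^ (j + 1) = 0 ↔ t % B ^ j = 0 ∧ t / B ^ j % B = 0 := by
  rw [pow_succ, Nat.mod_mul, Nat.add_eq_zero_iff, Nat.mul_eq_zero]
  constructor
  · rintro ⟨h1, h2 | h2⟩
    · have : t = 0 := by rw [h2, Nat.mod_zero] at h1; exact h1
      simp [this]
    · exact ⟨h1, h2⟩
  · rintro ⟨h1, h2⟩
    exact ⟨h1, .inr h2⟩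

theorem Program.natWrites_increment (g : ℕ) (m b : NatExpr) (a : ℕ) :
    a ∈ (Program.increment g m b).natWrites ↔ a = g ∨ a = Reg.carry ∨ a = Reg.i := by
  simp [Program.increment, Program.natWrites, Program.for]
  tauto

/-- During the loop the digits below `j` are those of `t + 1` and the others are still those of `t`,
while the carry is `1` exactly when `B ^ j` divides `t + 1`. An overflow is dropped, so the counter
wraps around to zero. -/
theorem ens_increment {g : ℕ} {m b : NatExpr} {s : State} {M B t : ℕ}
    (hg : g ≠ Reg.carry ∧ g ≠ Reg.i) (hB : 0 < B)
    (hm : ∀ s', Frame (.increment g m b) s s' → m.eval s' = M)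
    (hb : ∀ s', Frame (.increment g m b) s s' → b.eval s' = B)
    (hs : ∀ i < M, s.nat g i = t / B ^ i % B) :
    Ens (.increment g m b) s (incrementTime m b M) fun s' =>
      ∀ i < M, s'.nat g i = (t + 1) / B ^ i % B := by
  obtain ⟨hg1, hg2⟩ := hg
  have hg1' : ¬ 29 = g := fun h => hg1 h.symm
  have hg2' : ¬ 51 = g := fun h => hg2 h.symm
  simp only [Reg.carry, Reg.i] at hg1 hg2
  have hset : Frame (.increment g m b) s (s.putNat Reg.carry 0 1) := by
    refine ⟨fun a ha => ?_, fun a _ => rfl⟩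
    rw [Program.natWrites_increment] at ha
    have : a ≠ 29 := fun h => ha (by simp [h])
    simp [this]
  have hfr : ∀ s', Frame (.for Reg.i m
    (.cond (.natLe (.const 1) (.var Reg.carry))
      (.cond (.natLe b (.add (.read g (.var Reg.i)) (.const 1)))
        (.setNat g (.var Reg.i) (.const 0))
        (.seq (.setNat g (.var Reg.i) (.add (.read g (.var Reg.i)) (.const 1)))
          (.set Reg.carry (.const 0))))
      .skip)) (s.putNat Reg.carry 0 1) s' → Frame (.increment g m b) s s' := by
    intro s' hF
    exact hset.trans (hF.mono (fun a ha => List.mem_cons_of_mem _ ha) (fun a ha => by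
      simpa [Program.increment, Program.realWrites] using ha))
  unfold Program.increment incrementTime
  refine Ens.seq (Ens.flat (p := .set Reg.carry (.const 1)) trivial ?_)
  refine (ens_for M (b.time + 40) (fun j s' =>
    (∀ i < j, s'.nat g i = (t + 1) / B ^ i % B) ∧
    (∀ i < M, j ≤ i → s'.nat g i = t / B ^ i % B) ∧
    ((s'.nat Reg.carry 0 = 1 ∧ (t + 1) % B ^ j = 0) ∨
      (s'.nat Reg.carry 0 = 0 ∧ (t + 1) % B ^ j ≠ 0))) ?_ ?_ ?_ ?_ ?_).mono le_rfl
      fun s' h => h.1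
  · simp [Program.natWrites, hg2']
  · intro s' hF
    exact hm s' (hfr s' hF)
  · intro j s' x h
    simpa [hg2] using h
  · simp only [Program.exec, NatExpr.eval]
    refine ⟨by simp, fun i hi _ => ?_, .inl ⟨by simp, by simp [Nat.mod_one]⟩⟩
    simp [hg1, hs i hi]
  · rintro j hj s' hF hsj ⟨h1, h2, h3⟩
    have hbj := hb s' (hfr s' hF)
    refine (Ens.flat (by simp [Program.IsFlat]) ?_).mono (by
      simp only [Program.flatTime, Test.time, NatExpr.time]; omega) fun _ h => h
    have hdig := h2 j hj le_rfl
    have hlt := Nat.mod_lt (t / B ^ j) hB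
    have hdiv := digit_succ B t j
    rcases h3 with ⟨hc, hz⟩ | ⟨hc, hz⟩
    · rw [if_pos hz] at hdiv
      have hmod : (t / B ^ j + 1) % B = if B ≤ t / B ^ j % B + 1 then 0 else t / B ^ j % B + 1 := by
        rw [Nat.add_mod]
        split_ifs with h
        · have h' : t / B ^ j % B = B - 1 := by omega
          rcases Nat.lt_or_ge 1 B with h1 | h1
          · rw [h', Nat.mod_eq_of_lt h1, Nat.sub_add_cancel hB, Nat.mod_self]
          · have : B = 1 := by omega
            subst this; simp [Nat.mod_one]
        · rw [Nat.mod_eq_of_lt (show 1 < B by omega), Nat.mod_eq_of_lt (by omega)]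
      by_cases hle : B ≤ t / B ^ j % B + 1
      · rw [if_pos hle] at hmod
        have hex : Program.exec (.cond (.natLe (.const 1) (.var Reg.carry))
          (.cond (.natLe b (.add (.read g (.var Reg.i)) (.const 1)))
          (.setNat g (.var Reg.i) (.const 0))
          (.seq (.setNat g (.var Reg.i) (.add (.read g (.var Reg.i)) (.const 1)))
          (.set Reg.carry (.const 0)))) .skip) s' = s'.putNat g j 0 := by
          simp only [Reg.carry, Reg.i] at hc hsj
          simp [Program.exec, Test.Holds, NatExpr.eval, hc, hbj, hsj, hdig, hle]
        rw [hex]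
        refine ⟨fun i hi => ?_, fun i hi hji => ?_, .inl ⟨?_, ?_⟩⟩
        · rcases Nat.lt_succ_iff_lt_or_eq.1 hi with hi | rfl
          · simp [Function.update_of_ne hi.ne, h1 i hi]
          · simp [hdiv, hmod]
        · have : i ≠ j := by omega
          simp [Function.update_of_ne this, h2 i hi (by omega)]
        · simpa [hg1'] using hc
        · rw [mod_pow_succ_eq_zero, hdiv]
          exact ⟨hz, hmod⟩
      · rw [if_neg hle] at hmod
        have hex : Program.exec (.cond (.natLe (.const 1) (.var Reg.carry))
          (.cond (.natLe b (.add (.read g (.var Reg.i)) (.const 1)))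
          (.setNat g (.var Reg.i) (.const 0))
          (.seq (.setNat g (.var Reg.i) (.add (.read g (.var Reg.i)) (.const 1)))
          (.set Reg.carry (.const 0)))) .skip) s' =
            (s'.putNat g j (t / B ^ j % B + 1)).putNat Reg.carry 0 0 := by
          simp only [Reg.carry, Reg.i] at hc hsj
          simp [Program.exec, Test.Holds, NatExpr.eval, hc, hbj, hsj, hdig, hle]
        rw [hex]
        refine ⟨fun i hi => ?_, fun i hi hji => ?_, .inr ⟨?_, ?_⟩⟩
        · rcases Nat.lt_succ_iff_lt_or_eq.1 hi with hi | rfl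
          · simp [hg1, Function.update_of_ne hi.ne, h1 i hi]
          · simp [hg1, hdiv, hmod]
        · have : i ≠ j := by omega
          simp [hg1, Function.update_of_ne this, h2 i hi (by omega)]
        · simp
        · rw [Ne, mod_pow_succ_eq_zero, hdiv, hmod]
          omega
    · rw [if_neg hz] at hdiv
      have hex : Program.exec (.cond (.natLe (.const 1) (.var Reg.carry))
          (.cond (.natLe b (.add (.read g (.var Reg.i)) (.const 1)))
          (.setNat g (.var Reg.i) (.const 0))
          (.seq (.setNat g (.var Reg.i) (.add (.read g (.var Reg.i)) (.const 1)))
          (.set Reg.carry (.const 0)))) .skip) s' = s' := by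
        simp only [Reg.carry, Reg.i] at hc hsj
        simp [Program.exec, Test.Holds, NatExpr.eval, hc]
      rw [hex]
      refine ⟨fun i hi => ?_, fun i hi hji => h2 i hi (by omega), .inr ⟨hc, ?_⟩⟩
      · rcases Nat.lt_succ_iff_lt_or_eq.1 hi with hi | rfl
        · exact h1 i hi
        · rw [hdig, hdiv]
      · rw [Ne, mod_pow_succ_eq_zero]
        tauto

/-! ### Testing Hall's condition -/

/-- The points from `p` on can be assigned to the clusters, respecting the capacities `cap`. -/
def Extends (n k : ℕ) (N : ℕ → ℕ → Prop) (cap : ℕ → ℕ) (p : ℕ) : Prop :=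
  ∃ f : ℕ → ℕ, (∀ q < n, p ≤ q → f q < k ∧ N q (f q)) ∧
    ∀ l < k, countBelow (fun q => p ≤ q ∧ f q = l) n ≤ cap l

/-- Hall's condition for the set of clusters with the binary code `t`. -/
def HallAt (n k : ℕ) (N : ℕ → ℕ → Prop) (cap : ℕ → ℕ) (p t : ℕ) : Prop :=
  countBelow (fun q => p ≤ q ∧ ∀ l < k, N q l → 1 ≤ t / 2 ^ l % 2) n ≤
    ∑ l ∈ Finset.range k, if 1 ≤ t / 2 ^ l % 2 then cap l else 0

/-- For a given set of clusters it suffices to test the largest set of points confined to it. Binary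
digits encode the set. -/
theorem extends_iff {n k : ℕ} {N : ℕ → ℕ → Prop} {cap : ℕ → ℕ} {p : ℕ} :
    Extends n k N cap p ↔ ∀ t < 2 ^ k, HallAt n k N cap p t := by
  classical
  constructor
  · rintro ⟨f, hf, hc⟩ t -
    unfold HallAt
    rw [countBelow_eq_card, ← Finset.sum_filter]
    refine le_trans ?_ (Finset.sum_le_sum fun l hl =>
      hc l (Finset.mem_range.1 (Finset.mem_filter.1 hl).1))
    simp only [countBelow_eq_card]
    refine le_trans (Finset.card_le_card fun q hq => ?_) Finset.card_biUnion_le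
    simp only [Finset.mem_filter, Finset.mem_range, Finset.mem_biUnion] at hq ⊢
    obtain ⟨h1, h2⟩ := hf q hq.1 hq.2.1
    exact ⟨f q, ⟨h1, hq.2.2 _ h1 h2⟩, hq.1, hq.2.1, rfl⟩
  · intro h
    obtain ⟨f, hf, hc⟩ := exists_assignment (k := k) ((Finset.range n).filter fun q => p ≤ q) N cap
      (by
        intro T hT Q hQ hQT
        obtain ⟨t, ht, hd⟩ := exists_digits (B := 2) k (fun i => if i ∈ T then 1 else 0)
          (fun i _ => by split_ifs <;> omega)
        have h1 := h t ht
        unfold HallAt at h1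
        rw [countBelow_eq_card, ← Finset.sum_filter] at h1
        have h2 : (Finset.range k).filter (fun l => 1 ≤ t / 2 ^ l % 2) = T := by
          ext l
          simp only [Finset.mem_filter, Finset.mem_range]
          constructor
          · rintro ⟨hl, h⟩
            rw [hd l hl] at h
            by_contra hlT
            simp [hlT] at h
          · intro hl
            have := Finset.mem_range.1 (hT hl)
            exact ⟨this, by rw [hd l this]; simp [hl]⟩
        rw [h2] at h1
        refine le_trans (Finset.card_le_card fun q hq => ?_) h1
        have hqm := hQ hq
        simp only [Finset.mem_filter, Finset.mem_range] at hqm ⊢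
        refine ⟨hqm.1, hqm.2, fun l hl hN => ?_⟩
        rw [hd l hl, if_pos (hQT q hq l hl hN)])
    refine ⟨f, fun q hq hpq => hf q (by simp [hq, hpq]), fun l hl => ?_⟩
    rw [countBelow_eq_card, ← Finset.filter_filter]
    exact hc l hl

/-- Test Hall's condition for the points after `p`. -/
def Program.hall : Program :=
  .seq (.set Reg.extends' (.const 1)) (.for Reg.r (.var Reg.subsets)
    (.seq (.set Reg.total (.const 0))
    (.seq (.for Reg.j .k (.cond (.natLe (.const 1) (.read Reg.subset (.var Reg.j)))
        (.set Reg.total (.add (.var Reg.total) (.read Reg.cap (.var Reg.j)))) .skip))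
    (.seq (.count Reg.q Reg.cnt .n
        (.count Reg.j Reg.cnt' .k .skip
          (.conj (.realLe (.d (.var Reg.q) (.read Reg.center (.var Reg.j)))
              (.read Reg.rad (.var Reg.j)))
            (.natLe (.read Reg.subset (.var Reg.j)) (.const 0))))
        (.conj (.natLe (.add (.var Reg.p) (.const 1)) (.var Reg.q))
          (.natLe (.var Reg.cnt') (.const 0))))
    (.seq (.cond (.natLe (.var Reg.cnt) (.var Reg.total)) .skip (.set Reg.extends' (.const 0)))
      (.increment Reg.subset .k (.const 2)))))))

/-- The running time of `Program.hall`. -/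
def hallTime (n k : ℕ) : ℕ :=
  3 + forTime (.var Reg.subsets) (2 ^ k) (3 + (forTime .k k 16 +
    (countTime .n (.conj (.natLe (.add (.var Reg.p) (.const 1)) (.var Reg.q))
          (.natLe (.var Reg.cnt') (.const 0))) n
        (countTime .k (.conj (.realLe (.d (.var Reg.q) (.read Reg.center (.var Reg.j)))
              (.read Reg.rad (.var Reg.j)))
            (.natLe (.read Reg.subset (.var Reg.j)) (.const 0))) k 1) +
      (20 + incrementTime .k (.const 2) k))))

/-- The cluster `l` reaches the point `q`. -/
def State.Reaches (s : State) (q l : ℕ) : Prop :=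
  s.d q (s.nat Reg.center l) ≤ s.real Reg.rad l

theorem ens_hall {s : State} {n k : ℕ} (hn : s.nat Reg.size 0 = n) (hk : s.nat Reg.size 1 = k)
    (hS : s.nat Reg.subsets 0 = 2 ^ k) (h0 : ∀ i < k, s.nat Reg.subset i = 0) :
    Ens .hall s (hallTime n k) fun s' =>
      (1 ≤ s'.nat Reg.extends' 0 ↔
        Extends n k s.Reaches (s.nat Reg.cap) (s.nat Reg.p 0 + 1)) ∧
      ∀ i < k, s'.nat Reg.subset i = 0 := by
  have hset : Frame .hall s (s.putNat Reg.extends' 0 1) :=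
    ⟨fun a ha => by
      have : a ≠ 35 := by rintro rfl; exact ha (by decide)
      simp [this], fun a _ => rfl⟩
  unfold Program.hall hallTime
  refine Ens.seq (Ens.flat (p := .set Reg.extends' (.const 1)) trivial ?_)
  simp only [Program.exec, NatExpr.eval]
  refine (ens_for (2 ^ k) _ (fun t s' =>
    (∀ i < k, s'.nat Reg.subset i = t / 2 ^ i % 2) ∧
    ((s'.nat Reg.extends' 0 = 1 ∧
        ∀ t' < t, HallAt n k s.Reaches (s.nat Reg.cap) (s.nat Reg.p 0 + 1) t') ∨
      (s'.nat Reg.extends' 0 = 0 ∧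
        ¬ ∀ t' < t, HallAt n k s.Reaches (s.nat Reg.cap) (s.nat Reg.p 0 + 1) t')))
    ?_ ?_ ?_ ?_ ?_).mono le_rfl ?_
  · decide
  · intro s' hF
    have := hF.nat Reg.subsets (by decide)
    simp only [NatExpr.eval, this]
    simpa using hS
  · intro j s' x h
    simpa using h
  · refine ⟨fun i hi => ?_, .inl ⟨by simp, by simp⟩⟩
    simpa using h0 i hi
  · rintro t ht s1 hF hst ⟨hdig, hext⟩
    have hF1 : Frame .hall s s1 := hset.trans (hF.mono (by decide) (by decide))
    have hsz : s1.nat Reg.size = s.nat Reg.size := hF1.nat _ (by decide)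
    refine Ens.seq (Ens.flat (p := .set Reg.total (.const 0)) trivial ?_)
    simp only [Program.exec, NatExpr.eval]
    refine Ens.seq ((ens_for k 16 (fun j s' => s'.nat Reg.total 0 =
      ∑ l ∈ Finset.range j, if 1 ≤ t / 2 ^ l % 2 then s.nat Reg.cap l else 0)
      (by decide) ?_ ?_ ?_ ?_).imp ?_)
    · intro s' hF'
      rw [NatExpr.k, NatExpr.eval, hF'.nat _ (by decide)]
      simp [NatExpr.eval, hsz, hk]
    · intro j s' x h; simpa using h
    · simp
    · intro j hj s' hF' hj' hI
      refine Ens.flat_le ?_ ⟨trivial, trivial⟩ (by decide)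
      have h1 : s'.nat Reg.subset j = t / 2 ^ j % 2 := by
        rw [hF'.nat _ (by decide)]; simpa using hdig j hj
      have h2 : s'.nat Reg.cap = s.nat Reg.cap := by
        rw [hF'.nat _ (by decide), ← hF1.nat _ (by decide)]; simp
      rw [Finset.sum_range_succ, ← hI]
      simp only [Program.exec, Test.Holds, NatExpr.eval, hj', h1, h2]
      split_ifs <;> simp
    · intro s2 hF2 htot
      have hF2' : Frame .hall s1 s2 := by
        refine Frame.trans (s' := s1.putNat Reg.total 0 0) ⟨fun a ha => ?_, fun a _ => rfl⟩
          (hF2.mono (by decide) (by decide))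
        have : a ≠ 36 := by rintro rfl; exact ha (by decide)
        simp [this]
      have hF2s := hF1.trans hF2'
      have hsub2 : s2.nat Reg.subset = s1.nat Reg.subset := by
        rw [hF2.nat _ (by decide)]; simp
      have hext2 : s2.nat Reg.extends' = s1.nat Reg.extends' := by
        rw [hF2.nat _ (by decide)]; simp
      refine Ens.seq ((ens_count n _ (fun q => s.nat Reg.p 0 + 1 ≤ q ∧
        ∀ l < k, s.Reaches q l → 1 ≤ t / 2 ^ l % 2) (by decide) (by decide) (by decide)
        ?_ ?_).imp ?_)
      · intro s' hF'
        have := (hF'.nat Reg.size (by decide)).trans (hF2s.nat _ (by decide))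
        rw [NatExpr.n, NatExpr.eval, this]
        exact hn
      · intro q hq s' hF' hsq
        have hFs : Frame .hall s s' := hF2s.trans (hF'.mono (by decide) (by decide))
        refine (ens_count k _ (fun j => s.Reaches q j ∧ t / 2 ^ j % 2 ≤ 0) (by decide) (by decide)
          (by decide) ?_ ?_).imp ?_
        · intro s'' hF''
          have := (hF''.nat Reg.size (by decide)).trans (hFs.nat _ (by decide))
          rw [NatExpr.k, NatExpr.eval, this]
          exact hk
        · intro j hj s'' hF'' hsj
          refine Ens.flat (p := .skip) trivial ?_
          have hFs'' : Frame .hall s s'' := hFs.trans (hF''.mono (by decide) (by decide))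
          have h1 : s''.nat Reg.q 0 = q := by rw [hF''.nat _ (by decide), hsq]
          have h2 : s''.nat Reg.center = s.nat Reg.center := hFs''.nat _ (by decide)
          have h3 : s''.nat Reg.row = s.nat Reg.row := hFs''.nat _ (by decide)
          have h4 : s''.nat Reg.subset j = t / 2 ^ j % 2 := by
            rw [hF''.nat _ (by decide), hF'.nat _ (by decide), hsub2, hdig j hj]
          have h5 : s''.real = s.real := funext fun a => hFs''.real a (by
            rw [show Program.hall.realWrites = [] from rfl]; simp)
          simp only [Program.exec, Test.Holds, NatExpr.eval, RealExpr.eval, h1, h2, h3, h4, h5,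
            hsj, State.Reaches, State.d]
        · intro s'' hF'' hc
          have h1 : s''.nat Reg.q 0 = q := by rw [hF''.nat _ (by decide), hsq]
          have h2 : s''.nat Reg.p = s.nat Reg.p := by
            rw [hF''.nat _ (by decide), hFs.nat _ (by decide)]
          simp only [Test.Holds, NatExpr.eval, h1, h2, hc, Nat.le_zero, countBelow_eq_zero]
          refine and_congr_right fun _ => forall₂_congr fun l _ => ?_
          constructor
          · intro h hr
            by_contra hlt
            exact h ⟨hr, by omega⟩
          · rintro h ⟨h3, h4⟩
            have := h h3
            omega
      · intro s3 hF3 hcnt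
        refine Ens.seq ((Ens.flat_le (p := .cond (.natLe (.var Reg.cnt) (.var Reg.total)) .skip
            (.set Reg.extends' (.const 0))) (T := 20) (Q := fun s4 =>
            ((s4.nat Reg.extends' 0 = 1 ∧ ∀ t' < t + 1,
              HallAt n k s.Reaches (s.nat Reg.cap) (s.nat Reg.p 0 + 1) t') ∨
            (s4.nat Reg.extends' 0 = 0 ∧ ¬ ∀ t' < t + 1,
              HallAt n k s.Reaches (s.nat Reg.cap) (s.nat Reg.p 0 + 1) t')))
            ?_ ⟨trivial, trivial⟩ (by decide)).imp ?_)
        · have htot3 : s3.nat Reg.total 0 = s2.nat Reg.total 0 := by rw [hF3.nat _ (by decide)]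
          have hiff : (Test.natLe (.var Reg.cnt) (.var Reg.total)).Holds s3 ↔
              HallAt n k s.Reaches (s.nat Reg.cap) (s.nat Reg.p 0 + 1) t := by
            simp only [Test.Holds, NatExpr.eval]
            rw [hcnt, htot3, htot]; rfl
          have hext3 : s3.nat Reg.extends' 0 = s1.nat Reg.extends' 0 := by
            rw [hF3.nat _ (by decide), hext2]
          rw [Program.exec]
          by_cases hh : HallAt n k s.Reaches (s.nat Reg.cap) (s.nat Reg.p 0 + 1) t
          · rw [if_pos (hiff.2 hh), Program.exec, hext3]
            rcases hext with ⟨h1, h2⟩ | ⟨h1, h2⟩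
            · refine .inl ⟨h1, fun t' ht' => ?_⟩
              rcases Nat.lt_succ_iff_lt_or_eq.1 ht' with h | rfl
              · exact h2 t' h
              · exact hh
            · exact .inr ⟨h1, fun h => h2 fun t' ht' => h t' (by omega)⟩
          · rw [if_neg fun h => hh (hiff.1 h)]
            refine .inr ⟨by simp [Program.exec, NatExpr.eval], fun h => hh (h t (by omega))⟩
        · intro s4 hF4 hext4
          have hsz4 : s4.nat Reg.size = s.nat Reg.size := by
            rw [hF4.nat _ (by decide), hF3.nat _ (by decide), hF2s.nat _ (by decide)]
          have hsub4 : s4.nat Reg.subset = s1.nat Reg.subset := by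
            rw [hF4.nat _ (by decide), hF3.nat _ (by decide), hsub2]
          refine (ens_increment (t := t) (M := k) (B := 2) (by decide) (by norm_num) ?_ ?_
            ?_).imp ?_
          · intro s' hF'
            rw [NatExpr.k, NatExpr.eval, hF'.nat _ (by decide), hsz4]
            exact hk
          · intro s' hF'; rfl
          · intro i hi
            rw [hsub4]; exact hdig i hi
          · intro s5 hF5 h5
            refine ⟨h5, ?_⟩
            rw [hF5.nat Reg.extends' (by decide)]
            exact hext4
  · rintro s' ⟨h1, h2⟩
    refine ⟨?_, fun i hi => ?_⟩
    · rw [extends_iff]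
      rcases h2 with ⟨h2, h3⟩ | ⟨h2, h3⟩
      · simp only [h2, le_refl, true_iff]; exact h3
      · simp only [h2, h3, iff_false]; decide
    -- After `2 ^ k` increments the binary counter has wrapped around to zero, ready for the next
    -- test.
    · rw [h1 i hi]
      obtain ⟨r, rfl⟩ : ∃ r, k = i + 1 + r := ⟨k - (i + 1), by omega⟩
      have : 2 ^ (i + 1 + r) = 2 ^ i * (2 * 2 ^ r) := by ring
      rw [this, Nat.mul_div_cancel_left _ (by positivity), Nat.mul_mod_right]

/-! ### Assigning the points to given centers -/

/-- The memory holds the instance `D`. -/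
structure Env (D : Data) (s : State) : Prop where
  n : s.nat Reg.size 0 = D.n
  k : s.nat Reg.size 1 = D.k
  d : ∀ i < D.n, ∀ j < D.n, s.d i j = D.d i j
  eta : ∀ i < D.n, s.nat Reg.eta i = D.η i
  subsets : s.nat Reg.subsets 0 = 2 ^ D.k

theorem Env.frame {D : Data} {p : Program} {s s' : State} (h : Env D s) (hF : Frame p s s')
    (hn : ∀ a ∈ [Reg.size, Reg.row, Reg.eta, Reg.subsets], a ∉ p.natWrites)
    (hr : Reg.dist ∉ p.realWrites) : Env D s' := by
  have h1 := hF.nat Reg.size (hn _ (by simp))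
  have h2 := hF.nat Reg.row (hn _ (by simp))
  have h3 := hF.nat Reg.eta (hn _ (by simp))
  have h4 := hF.nat Reg.subsets (hn _ (by simp))
  have h5 := hF.real Reg.dist hr
  refine ⟨by rw [h1, h.n], by rw [h1, h.k], fun i hi j hj => ?_, fun i hi => ?_,
    by rw [h4, h.subsets]⟩
  · rw [← h.d i hi j hj, State.d, h5, h2, State.d]
  · rw [h3, h.eta i hi]

/-- A multiple of a real. -/
def RealExpr.times13 (r : RealExpr) : RealExpr :=
  .add (.add (.add (.add r r) (.add r r)) (.add (.add r r) (.add r r)))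
    (.add (.add (.add r r) (.add r r)) r)

theorem RealExpr.eval_times13 (s : State) (r : RealExpr) :
    r.times13.eval s = 13 * r.eval s := by
  simp only [RealExpr.times13, RealExpr.eval]; ring

/-- Test whether the centers are distinct points, mark them, and set the capacities and radii. -/
def Program.prepare : Program :=
  .seq (.set Reg.good (.const 1))
  (.seq (.setReal Reg.cost (.const 0) (.cast (.const 0)))
  (.seq (.for Reg.x .n (.setNat Reg.mark (.var Reg.x) (.const 0)))
    (.for Reg.l .k
      (.seq (.cond (.natLe .n (.read Reg.center (.var Reg.l))) (.set Reg.good (.const 0)) .skip)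
      (.seq (.cond (.natLe (.const 1) (.read Reg.mark (.read Reg.center (.var Reg.l))))
        (.set Reg.good (.const 0)) .skip)
      (.seq (.setNat Reg.mark (.read Reg.center (.var Reg.l)) (.const 1))
      (.seq (.setNat Reg.cap (.var Reg.l) (.read Reg.eta (.read Reg.center (.var Reg.l))))
      (.seq (.setReal Reg.rad (.var Reg.l) (.times13 (.read Reg.rho (.var Reg.l))))
        (.setReal Reg.cost (.const 0)
          (.add (.var Reg.cost) (.read Reg.rad (.var Reg.l))))))))))))

/-- The running time of `Program.prepare`. -/
def prepareTime (n k : ℕ) : ℕ := 3 + (4 + (forTime .n n 10 + forTime .k k 200))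

/-- The marks detect repeated centers during the loop and are reused as the indicator of the centers
in the output. The flag `good` can only fall, so one defect is remembered. -/
theorem ens_prepare {s : State} {n k : ℕ} (hn : s.nat Reg.size 0 = n)
    (hk : s.nat Reg.size 1 = k) :
    Ens .prepare s (prepareTime n k) fun s' =>
      s'.nat Reg.good 0 ≤ 1 ∧
      (s'.nat Reg.good 0 = 1 ↔ (∀ l < k, s.nat Reg.center l < n) ∧
        Set.InjOn (s.nat Reg.center) (Set.Iio k)) ∧
      (∀ x < n, s'.nat Reg.mark x = 1 ↔ ∃ l < k, s.nat Reg.center l = x) ∧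
      (∀ l < k, s'.nat Reg.cap l = s.nat Reg.eta (s.nat Reg.center l)) ∧
      (∀ l < k, s'.real Reg.rad l = 13 * s.real Reg.rho l) ∧
      s'.real Reg.cost 0 = ∑ l ∈ Finset.range k, 13 * s.real Reg.rho l := by
  unfold Program.prepare prepareTime
  refine Ens.seq (Ens.flat (p := .set Reg.good (.const 1)) trivial ?_)
  refine Ens.seq (Ens.flat (p := .setReal Reg.cost (.const 0) (.cast (.const 0))) trivial ?_)
  simp only [Program.exec, NatExpr.eval, RealExpr.eval, Nat.cast_zero]
  set s0 := (s.putNat Reg.good 0 1).putReal Reg.cost 0 0 with hs0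
  have hF0 : Frame .prepare s s0 := by
    refine ⟨fun a ha => ?_, fun a ha => ?_⟩
    · have : a ≠ 33 := by rintro rfl; exact ha (by decide)
      simp [hs0, this]
    · have : a ≠ 7 := by rintro rfl; exact ha (by decide)
      simp [hs0, this]
  have hsz0 : s0.nat Reg.size = s.nat Reg.size := hF0.nat _ (by decide)
  refine Ens.seq ((ens_for n 10 (fun j s' => ∀ x < j, s'.nat Reg.mark x = 0)
    (by decide) ?_ ?_ ?_ ?_).imp ?_)
  · intro s' hF
    rw [NatExpr.n, NatExpr.eval, hF.nat _ (by decide), hsz0]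
    exact hn
  · intro j s' x h; simpa using h
  · simp
  · intro j hj s' hF hsj hI
    refine Ens.flat_le ?_ trivial (by decide)
    intro x hx
    simp only [Program.exec, NatExpr.eval, hsj]
    rcases Nat.lt_succ_iff_lt_or_eq.1 hx with hx | rfl
    · simp [Function.update_of_ne hx.ne, hI x hx]
    · simp
  intro s1 hF1 hmark
  have hF1s : Frame .prepare s s1 := hF0.trans (hF1.mono (by decide) (by decide))
  have hsz1 : s1.nat Reg.size = s.nat Reg.size := hF1s.nat _ (by decide)
  refine (ens_for k 200 (fun j s' => s'.nat Reg.good 0 ≤ 1 ∧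
      (s'.nat Reg.good 0 = 1 ↔ (∀ l < j, s.nat Reg.center l < n) ∧
        Set.InjOn (s.nat Reg.center) (Set.Iio j)) ∧
      (∀ x < n, s'.nat Reg.mark x ≤ 1) ∧
      (∀ x < n, s'.nat Reg.mark x = 1 ↔ ∃ l < j, s.nat Reg.center l = x) ∧
      (∀ l < j, s'.nat Reg.cap l = s.nat Reg.eta (s.nat Reg.center l)) ∧
      (∀ l < j, s'.real Reg.rad l = 13 * s.real Reg.rho l) ∧
      s'.real Reg.cost 0 = ∑ l ∈ Finset.range j, 13 * s.real Reg.rho l)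
    (by decide) ?_ ?_ ?_ ?_).mono le_rfl ?_
  · intro s' hF
    rw [NatExpr.k, NatExpr.eval, hF.nat _ (by decide), hsz1]
    exact hk
  · intro j s' x h; simpa using h
  · have hg : s1.nat Reg.good 0 = 1 := by rw [hF1.nat _ (by decide)]; simp [hs0]
    have hc : s1.real Reg.cost 0 = 0 := by
      rw [hF1.real _ (by decide)]; simp [hs0]
    refine ⟨hg.le, ?_, fun x hx => by rw [hmark x hx]; omega, fun x hx => by simp [hmark x hx],
      by simp, by simp, by simp [hc]⟩
    simp only [hg, true_iff]
    exact ⟨by simp, fun a ha => absurd ha (by simp)⟩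
  · rintro j hj s' hF hsj ⟨hle, hgood, hm1, hm, hcap, hrad, hcost⟩
    have hFs : Frame .prepare s s' := hF1s.trans (hF.mono (by decide) (by decide))
    have hce : s'.nat Reg.center = s.nat Reg.center := hFs.nat _ (by decide)
    have heta : s'.nat Reg.eta = s.nat Reg.eta := hFs.nat _ (by decide)
    have hrho : s'.real Reg.rho = s.real Reg.rho := hFs.real _ (by decide)
    have hsz : s'.nat Reg.size 0 = n := by rw [hFs.nat _ (by decide), hn]
    refine Ens.flat_le ?_ (by simp [Program.IsFlat]) (by decide)
    have hb : (n ≤ s.nat Reg.center j ∨ 1 ≤ s'.nat Reg.mark (s.nat Reg.center j)) ∨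
        (s.nat Reg.center j < n ∧ s'.nat Reg.mark (s.nat Reg.center j) = 0) := by omega
    have hnew : s.nat Reg.center j < n →
        (s'.nat Reg.mark (s.nat Reg.center j) = 0 ↔
          ∀ l < j, s.nat Reg.center l ≠ s.nat Reg.center j) := by
      intro hlt
      have h1 := hm _ hlt
      have h2 := hm1 _ hlt
      constructor
      · intro h0 l hl heq
        have := h1.2 ⟨l, hl, heq⟩
        omega
      · intro h
        have : ¬ s'.nat Reg.mark (s.nat Reg.center j) = 1 := by
          rw [h1]; rintro ⟨l, hl, heq⟩; exact h l hl heq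
        omega
    have hinj : (∀ l < j + 1, s.nat Reg.center l < n) ∧
        Set.InjOn (s.nat Reg.center) (Set.Iio (j + 1)) ↔
        ((∀ l < j, s.nat Reg.center l < n) ∧ Set.InjOn (s.nat Reg.center) (Set.Iio j)) ∧
        (s.nat Reg.center j < n ∧ s'.nat Reg.mark (s.nat Reg.center j) = 0) := by
      constructor
      · rintro ⟨h1, h2⟩
        refine ⟨⟨fun l hl => h1 l (by omega), h2.mono fun a ha => ?_⟩, h1 j (by omega), ?_⟩
        · simp only [Set.mem_Iio] at ha ⊢; omega
        · rw [hnew (h1 j (by omega))]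
          intro l hl heq
          have := h2 (show l ∈ Set.Iio (j + 1) by simp only [Set.mem_Iio]; omega)
            (by simp) heq
          omega
      · rintro ⟨⟨h1, h2⟩, h3, h4⟩
        rw [hnew h3] at h4
        refine ⟨fun l hl => ?_, fun a ha b hb hab => ?_⟩
        · rcases Nat.lt_succ_iff_lt_or_eq.1 hl with hl | rfl
          · exact h1 l hl
          · exact h3
        · rcases Nat.lt_succ_iff_lt_or_eq.1 ha with ha | rfl
          · rcases Nat.lt_succ_iff_lt_or_eq.1 hb with hb | rfl
            · exact h2 ha hb hab
            · exact absurd hab (h4 a ha)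
          · rcases Nat.lt_succ_iff_lt_or_eq.1 hb with hb | rfl
            · exact absurd hab.symm (h4 b hb)
            · rfl
    set v : ℕ := if n ≤ s.nat Reg.center j ∨ 1 ≤ s'.nat Reg.mark (s.nat Reg.center j) then 0
      else s'.nat Reg.good 0 with hv
    have hexec : ∃ s'', s'' = Program.exec (.seq (.cond (.natLe .n (.read Reg.center (.var Reg.l)))
        (.set Reg.good (.const 0)) .skip)
        (.seq (.cond (.natLe (.const 1) (.read Reg.mark (.read Reg.center (.var Reg.l))))
          (.set Reg.good (.const 0)) .skip)
        (.seq (.setNat Reg.mark (.read Reg.center (.var Reg.l)) (.const 1))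
        (.seq (.setNat Reg.cap (.var Reg.l) (.read Reg.eta (.read Reg.center (.var Reg.l))))
        (.seq (.setReal Reg.rad (.var Reg.l) (.times13 (.read Reg.rho (.var Reg.l))))
          (.setReal Reg.cost (.const 0)
            (.add (.var Reg.cost) (.read Reg.rad (.var Reg.l))))))))) s' ∧
        s''.nat Reg.good 0 = v ∧
        s''.nat Reg.mark = Function.update (s'.nat Reg.mark) (s.nat Reg.center j) 1 ∧
        s''.nat Reg.cap =
          Function.update (s'.nat Reg.cap) j (s.nat Reg.eta (s.nat Reg.center j)) ∧
        s''.real Reg.rad = Function.update (s'.real Reg.rad) j (13 * s.real Reg.rho j) ∧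
        s''.real Reg.cost 0 = s'.real Reg.cost 0 + 13 * s.real Reg.rho j := by
      refine ⟨_, rfl, ?_⟩
      simp only [Reg.center, Reg.eta, Reg.rho, Reg.size, Reg.l, Reg.mark, Reg.good] at *
      by_cases h1 : n ≤ s.nat 12 j
      · by_cases h2 : 1 ≤ s'.nat 16 (s.nat 12 j)
        · simp [Program.exec, Test.Holds, NatExpr.eval, hce, heta, hrho, hsz, hsj, h1, h2, hv,
            RealExpr.eval_times13, RealExpr.eval]
        · simp [Program.exec, Test.Holds, NatExpr.eval, hce, heta, hrho, hsz, hsj, h1, h2, hv,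
            RealExpr.eval_times13, RealExpr.eval]
      · by_cases h2 : 1 ≤ s'.nat 16 (s.nat 12 j)
        · simp [Program.exec, Test.Holds, NatExpr.eval, hce, heta, hrho, hsz, hsj, h1, h2, hv,
            RealExpr.eval_times13, RealExpr.eval]
        · simp [Program.exec, Test.Holds, NatExpr.eval, hce, heta, hrho, hsz, hsj, h1, h2, hv,
            RealExpr.eval_times13, RealExpr.eval]
    obtain ⟨s'', hs'', e1, e2, e3, e4, e5⟩ := hexec
    rw [← hs'']
    refine ⟨?_, ?_, fun x hx => ?_, fun x hx => ?_, fun l hl => ?_, fun l hl => ?_, ?_⟩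
    · rw [e1, hv]; split_ifs <;> omega
    · rw [e1, hinj, ← hgood, hv]
      split_ifs with h
      · simp only [false_iff]
        rintro ⟨-, h3, h4⟩
        omega
      · have h' := hb.resolve_left h
        simp [h']
    · rw [e2]
      by_cases h : x = s.nat Reg.center j
      · subst h; simp
      · rw [Function.update_of_ne h]; exact hm1 x hx
    · rw [e2]
      by_cases h : x = s.nat Reg.center j
      · subst h
        simp only [Function.update_self, true_iff]
        exact ⟨j, by omega, rfl⟩
      · rw [Function.update_of_ne h, hm x hx]
        constructor
        · rintro ⟨l, hl, he⟩; exact ⟨l, by omega, he⟩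
        · rintro ⟨l, hl, he⟩
          rcases Nat.lt_succ_iff_lt_or_eq.1 hl with hl | rfl
          · exact ⟨l, hl, he⟩
          · exact absurd he.symm h
    · rw [e3]
      rcases Nat.lt_succ_iff_lt_or_eq.1 hl with hl | rfl
      · rw [Function.update_of_ne hl.ne, hcap l hl]
      · simp
    · rw [e4]
      rcases Nat.lt_succ_iff_lt_or_eq.1 hl with hl | rfl
      · rw [Function.update_of_ne hl.ne, hrad l hl]
      · simp
    · rw [e5, hcost, Finset.sum_range_succ]
  · rintro s' ⟨h1, h2, -, h3, h4, h5, h6⟩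
    exact ⟨h1, h2, h3, h4, h5, h6⟩

/-- The first point takes one place of its cluster in a given extension; the same assignment
restricted to the later points respects the reduced capacities. -/
theorem Extends.step {n k : ℕ} {N : ℕ → ℕ → Prop} {cap : ℕ → ℕ} {p : ℕ}
    (h : Extends n k N cap p) (hp : p < n) :
    ∃ l < k, N p l ∧ 1 ≤ cap l ∧
      Extends n k N (Function.update cap l (cap l - 1)) (p + 1) := by
  obtain ⟨f, hf, hc⟩ := h
  obtain ⟨h1, h2⟩ := hf p hp le_rfl
  have h3 : countBelow (fun q => p + 1 ≤ q ∧ f q = f p) n <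
      countBelow (fun q => p ≤ q ∧ f q = f p) n :=
    countBelow_lt (j := p) (fun j _ h => ⟨by omega, h.2⟩) hp (by simp) (by simp)
  have h4 := hc _ h1
  refine ⟨f p, h1, h2, by omega, f, fun q hq hpq => hf q hq (by omega), fun l hl => ?_⟩
  by_cases hlp : l = f p
  · subst hlp
    rw [Function.update_self]
    omega
  · rw [Function.update_of_ne hlp]
    exact (countBelow_mono fun j _ h => ⟨by omega, h.2⟩).trans (hc l hl)

/-- Assign the points one by one, keeping Hall's condition for the remaining ones. -/
def Program.serve : Program :=
  .for Reg.p .n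
    (.seq (.set Reg.found (.const 0))
    (.seq (.for Reg.l .k
      (.cond (.conj (.natLe (.var Reg.found) (.const 0))
          (.conj (.realLe (.d (.var Reg.p) (.read Reg.center (.var Reg.l)))
            (.read Reg.rad (.var Reg.l)))
          (.natLe (.const 1) (.read Reg.cap (.var Reg.l)))))
        (.seq (.setNat Reg.cap (.var Reg.l) (.sub (.read Reg.cap (.var Reg.l)) (.const 1)))
        (.seq .hall
          (.cond (.natLe (.const 1) (.var Reg.extends'))
            (.seq (.set Reg.found (.const 1)) (.setNat Reg.label (.var Reg.p) (.var Reg.l)))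
            (.setNat Reg.cap (.var Reg.l) (.add (.read Reg.cap (.var Reg.l)) (.const 1))))))
        .skip))
      (.cond (.natLe (.const 1) (.var Reg.found)) .skip (.set Reg.good (.const 0)))))

theorem State.reaches_congr {s s' : State} (h1 : s'.real Reg.dist = s.real Reg.dist)
    (h2 : s'.nat Reg.row = s.nat Reg.row) (h3 : s'.nat Reg.center = s.nat Reg.center)
    (h4 : s'.real Reg.rad = s.real Reg.rad) : s'.Reaches = s.Reaches := by
  funext q l
  unfold State.Reaches State.d
  rw [h1, h2, h3, h4]

/-- The running time of `Program.serve`. -/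
def serveTime (n k : ℕ) : ℕ :=
  forTime .n n (3 + (forTime .k k (hallTime n k + 120) + 10))

/-- A label is accepted only if the later points can still be placed, so no choice is ever revised.
Soundness does not use this: accepted labels respect distances and remaining capacities in any case.
Completeness is the statement that an extension survives every step. -/
theorem ens_serve {s : State} {n k : ℕ} (hn : s.nat Reg.size 0 = n) (hk : s.nat Reg.size 1 = k)
    (hS : s.nat Reg.subsets 0 = 2 ^ k) (h0 : ∀ i < k, s.nat Reg.subset i = 0)
    (hg : s.nat Reg.good 0 ≤ 1) :
    Ens .serve s (serveTime n k) fun s' =>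
      (∀ i < k, s'.nat Reg.subset i = 0) ∧ s'.nat Reg.good 0 ≤ 1 ∧
      (s'.nat Reg.good 0 = 1 → s.nat Reg.good 0 = 1 ∧
        (∀ q < n, s'.nat Reg.label q < k ∧ s.Reaches q (s'.nat Reg.label q)) ∧
        ∀ l < k, countBelow (fun q => s'.nat Reg.label q = l) n ≤ s.nat Reg.cap l) ∧
      (s.nat Reg.good 0 = 1 → Extends n k s.Reaches (s.nat Reg.cap) 0 →
        s'.nat Reg.good 0 = 1) := by
  classical
  unfold Program.serve serveTime
  -- The array `cap` holds the places that remain; places used plus places left never exceed the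
  -- initial capacity.
  refine (ens_for n (3 + (forTime .k k (hallTime n k + 120) + 10)) (fun p s' =>
      (∀ i < k, s'.nat Reg.subset i = 0) ∧ s'.nat Reg.good 0 ≤ 1 ∧
      (s'.nat Reg.good 0 = 1 → s.nat Reg.good 0 = 1 ∧
        (∀ q < p, s'.nat Reg.label q < k ∧ s.Reaches q (s'.nat Reg.label q)) ∧
        ∀ l < k, countBelow (fun q => s'.nat Reg.label q = l) p + s'.nat Reg.cap l ≤
          s.nat Reg.cap l) ∧
      (s.nat Reg.good 0 = 1 → Extends n k s.Reaches (s.nat Reg.cap) 0 →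
        s'.nat Reg.good 0 = 1 ∧ Extends n k s.Reaches (s'.nat Reg.cap) p))
    (by decide) ?_ ?_ ?_ ?_).mono le_rfl ?_
  · intro s' hF
    rw [NatExpr.n, NatExpr.eval, hF.nat _ (by decide)]
    exact hn
  · intro j s' x h; simpa using h
  · exact ⟨h0, hg, fun h => ⟨h, by simp, fun l _ => by simp [countBelow]⟩, fun h h' => ⟨h, h'⟩⟩
  · rintro p hp s1 hF hsp ⟨hz, hg1, hA, hB⟩
    have hF1 : Frame .serve s s1 := hF
    refine Ens.seq (Ens.flat (p := .set Reg.found (.const 0)) trivial ?_)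
    simp only [Program.exec, NatExpr.eval]
    set s2 := s1.putNat Reg.found 0 0 with hs2
    have hF2 : Frame .serve s s2 := hF1.trans ⟨fun a ha => by
      have : a ≠ 34 := by rintro rfl; exact ha (by decide)
      simp [hs2, this], fun a _ => rfl⟩
    have hcap2 : s2.nat Reg.cap = s1.nat Reg.cap := by simp [hs2]
    have hlab2 : s2.nat Reg.label = s1.nat Reg.label := by simp [hs2]
    have hz2 : s2.nat Reg.subset = s1.nat Reg.subset := by simp [hs2]
    have hgood2 : s2.nat Reg.good = s1.nat Reg.good := by simp [hs2]
    have hp2 : s2.nat Reg.p = s1.nat Reg.p := by simp [hs2]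
    have hf2 : s2.nat Reg.found 0 = 0 := by simp [hs2]
    clear_value s2
    set Works : ℕ → Prop := fun l => s.Reaches p l ∧ 1 ≤ s1.nat Reg.cap l ∧
      Extends n k s.Reaches (Function.update (s1.nat Reg.cap) l (s1.nat Reg.cap l - 1)) (p + 1)
      with hWorks
    refine Ens.seq ((ens_for k (hallTime n k + 120) (fun l s' =>
      (∀ i < k, s'.nat Reg.subset i = 0) ∧
      ((s'.nat Reg.found 0 = 0 ∧ s'.nat Reg.cap = s1.nat Reg.cap ∧
          s'.nat Reg.label = s1.nat Reg.label ∧ ∀ l' < l, ¬ Works l') ∨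
        (s'.nat Reg.found 0 = 1 ∧ ∃ l' < k, Works l' ∧
          s'.nat Reg.cap = Function.update (s1.nat Reg.cap) l' (s1.nat Reg.cap l' - 1) ∧
          s'.nat Reg.label = Function.update (s1.nat Reg.label) p l')))
      (by decide) ?_ ?_ ?_ ?_).imp ?_)
    · intro s' hF'
      rw [NatExpr.k, NatExpr.eval, hF'.nat _ (by decide), hF2.nat _ (by decide)]
      exact hk
    · intro j s' x h; simpa using h
    · exact ⟨fun i hi => by rw [hz2]; exact hz i hi, .inl ⟨hf2, hcap2, hlab2, by simp⟩⟩
    · rintro l hl s3 hF3 hsl ⟨hz3, h3⟩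
      have hF3s : Frame .serve s s3 := hF2.trans (hF3.mono (by decide) (by decide))
      have hreach3 : s3.Reaches = s.Reaches := State.reaches_congr (hF3s.real _ (by decide))
        (hF3s.nat _ (by decide)) (hF3s.nat _ (by decide)) (hF3s.real _ (by decide))
      have hp3 : s3.nat Reg.p 0 = p := by
        rw [hF3.nat Reg.p (by decide), hp2]; exact hsp
      have htest : (Test.conj (.natLe (.var Reg.found) (.const 0))
          (.conj (.realLe (.d (.var Reg.p) (.read Reg.center (.var Reg.l)))
            (.read Reg.rad (.var Reg.l)))
          (.natLe (.const 1) (.read Reg.cap (.var Reg.l))))).Holds s3 ↔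
          s3.nat Reg.found 0 ≤ 0 ∧ s.Reaches p l ∧ 1 ≤ s3.nat Reg.cap l := by
        rw [← hreach3]
        simp only [Test.Holds, NatExpr.eval, RealExpr.eval, hp3, hsl]
        rfl
      refine (Ens.cond (T := hallTime n k + 40) (T' := 1) (fun hb => ?_) (fun hb => ?_)).mono
        (by simp only [Test.time, NatExpr.time, RealExpr.time]; omega) fun _ h => h
      · rw [htest] at hb
        obtain ⟨hf, hreach, hc⟩ := hb
        obtain ⟨hf3, hcap3, hlab3, hno⟩ := h3.resolve_right (by rintro ⟨h, -⟩; omega)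
        rw [hcap3] at hc
        refine (Ens.seq (T' := hallTime n k + 30) (Ens.flat (p := .setNat Reg.cap (.var Reg.l)
          (.sub (.read Reg.cap (.var Reg.l)) (.const 1))) trivial ?_)).mono (by
            simp only [Program.flatTime, NatExpr.time]; omega) fun _ h => h
        simp only [Program.exec, NatExpr.eval, hsl, hcap3]
        set s4 := s3.putNat Reg.cap l (s1.nat Reg.cap l - 1) with hs4
        have hcap4 : s4.nat Reg.cap =
            Function.update (s1.nat Reg.cap) l (s1.nat Reg.cap l - 1) := by
          simp only [Reg.cap] at hcap3 ⊢; simp [hs4, hcap3]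
        have h4 : ∀ a, a ≠ Reg.cap → s4.nat a = s3.nat a := by
          intro a ha; simp only [Reg.cap] at ha; simp [hs4, ha]
        have h4r : s4.real = s3.real := rfl
        clear_value s4
        have hreach4 : s4.Reaches = s.Reaches := by
          rw [← hreach3]
          exact State.reaches_congr (by rw [h4r]) (h4 _ (by decide)) (h4 _ (by decide))
            (by rw [h4r])
        refine (Ens.seq (T := hallTime n k) (T' := 25) ((ens_hall (n := n) (k := k) ?_ ?_ ?_
          ?_).imp ?_)).mono (by omega) fun _ h => h
        · rw [h4 _ (by decide), hF3s.nat _ (by decide), hn]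
        · rw [h4 _ (by decide), hF3s.nat _ (by decide), hk]
        · rw [h4 _ (by decide), hF3s.nat _ (by decide), hS]
        · rw [h4 _ (by decide)]; exact hz3
        rintro s5 hF5 ⟨hext, hz5⟩
        rw [hreach4, hcap4, h4 Reg.p (by decide), hp3] at hext
        have hl5 : s5.nat Reg.l 0 = l := by
          rw [hF5.nat _ (by decide), h4 _ (by decide)]; exact hsl
        have hp5 : s5.nat Reg.p 0 = p := by
          rw [hF5.nat _ (by decide), h4 _ (by decide)]; exact hp3
        have hcap5 : s5.nat Reg.cap =
            Function.update (s1.nat Reg.cap) l (s1.nat Reg.cap l - 1) := by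
          rw [hF5.nat _ (by decide), hcap4]
        have hlab5 : s5.nat Reg.label = s1.nat Reg.label := by
          rw [hF5.nat _ (by decide), h4 _ (by decide), hlab3]
        have hf5 : s5.nat Reg.found 0 = 0 := by
          rw [hF5.nat _ (by decide), h4 _ (by decide), hf3]
        refine (Ens.cond (T := 10) (T' := 10) (fun hb => ?_) (fun hb => ?_)).mono
          (by simp only [Test.time, NatExpr.time]; omega) fun _ h => h
        · simp only [Test.Holds, NatExpr.eval] at hb
          refine Ens.flat_le (T := 10) ?_ ⟨trivial, trivial⟩ (by decide)
          simp only [Program.exec, NatExpr.eval]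
          refine ⟨fun i hi => by simpa using hz5 i hi, .inr ⟨by simp, l, hl, ⟨hreach, hc,
            hext.1 hb⟩, ?_, ?_⟩⟩
          · rw [← hcap5]; simp
          · rw [← hlab5]
            simp only [Reg.p, Reg.l, Reg.found, Reg.label] at hp5 hl5 ⊢
            simp [hp5, hl5]
        · simp only [Test.Holds, NatExpr.eval] at hb
          refine Ens.flat_le (T := 10) ?_ trivial (by decide)
          simp only [Program.exec, NatExpr.eval]
          refine ⟨fun i hi => by simpa using hz5 i hi, .inl ⟨by simpa using hf5, ?_,
            by simpa using hlab5, fun l' hl' hw => ?_⟩⟩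
          · rw [hl5, hcap5, State.putNat_nat, if_pos rfl, hcap5]
            simp [Nat.sub_add_cancel hc]
          · rcases Nat.lt_succ_iff_lt_or_eq.1 hl' with hl' | rfl
            · exact hno l' hl' hw
            · exact hb (hext.2 hw.2.2)
      · rw [htest] at hb
        refine Ens.flat_le (T := 1) ?_ trivial (by decide)
        refine ⟨hz3, ?_⟩
        rcases h3 with ⟨h1, h2, h3, h4⟩ | h3
        · refine .inl ⟨h1, h2, h3, fun l' hl' hw => ?_⟩
          rcases Nat.lt_succ_iff_lt_or_eq.1 hl' with hl' | rfl
          · exact h4 l' hl' hw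
          · exact hb ⟨h1.le, hw.1, by rw [h2]; exact hw.2.1⟩
        · exact .inr h3
    · rintro s3 hF3 ⟨hz3, h3⟩
      have hfr3 : s3.nat Reg.good = s1.nat Reg.good := by rw [hF3.nat _ (by decide), hgood2]
      refine Ens.flat_le (T := 10) ?_ ⟨trivial, trivial⟩ (by decide)
      rcases h3 with ⟨hf, hcap, hlab, hno⟩ | ⟨hf, l, hl, ⟨hreach, hc, hext⟩, hcap, hlab⟩
      · have hex : Program.exec (.cond (.natLe (.const 1) (.var Reg.found)) .skip
            (.set Reg.good (.const 0))) s3 = s3.putNat Reg.good 0 0 := by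
          rw [Program.exec, if_neg]
          · rfl
          · simp only [Test.Holds, NatExpr.eval, hf]; decide
        rw [hex]
        refine ⟨fun i hi => by simpa using hz3 i hi, by simp, fun h => by simp at h,
          fun h h' => ?_⟩
        -- If an extension existed before `p`, some label would have worked, so the flag is cleared
        -- only when there is none.
        obtain ⟨l, hl, hw⟩ := (hB h h').2.step hp
        exact absurd hw (hno l hl)
      · have hex : Program.exec (.cond (.natLe (.const 1) (.var Reg.found)) .skip
            (.set Reg.good (.const 0))) s3 = s3 := by
          rw [Program.exec, if_pos]
          · rfl
          · simp only [Test.Holds, NatExpr.eval, hf]; exact le_rfl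
        rw [hex, hfr3, hcap, hlab]
        refine ⟨hz3, hg1, fun h => ?_, fun h h' => ⟨(hB h h').1, hext⟩⟩
        obtain ⟨h1, h2, h3⟩ := hA h
        refine ⟨h1, fun q hq => ?_, fun l' hl' => ?_⟩
        · rcases Nat.lt_succ_iff_lt_or_eq.1 hq with hq | rfl
          · rw [Function.update_of_ne hq.ne]; exact h2 q hq
          · rw [Function.update_self]; exact ⟨hl, hreach⟩
        · have h4 := h3 l' hl'
          rw [countBelow_succ, Function.update_self, countBelow_congr (Q := fun q =>
            s1.nat Reg.label q = l') fun q hq => by rw [Function.update_of_ne hq.ne]]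
          by_cases hll : l = l'
          · subst hll
            rw [if_pos rfl, Function.update_self]
            omega
          · rw [if_neg hll, Function.update_of_ne (Ne.symm hll)]
            omega
  · rintro s' ⟨h1, h2, h3, h4⟩
    refine ⟨h1, h2, fun h => ⟨(h3 h).1, (h3 h).2.1, fun l hl => ?_⟩, fun h h' => (h4 h h').1⟩
    have := (h3 h).2.2 l hl
    omega

theorem Ens.seq_le {p q : Program} {s : State} {T T' U : ℕ} {Q : State → Prop}
    (h : Ens p s T fun s' => Ens q s' T' Q) (hU : T + T' ≤ U) : Ens (.seq p q) s U Q :=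
  (Ens.seq h).mono hU fun _ h => h

theorem Ens.cond_le {b : Test} {p q : Program} {s : State} {T T' U : ℕ} {Q : State → Prop}
    (h : b.Holds s → Ens p s T Q) (h' : ¬ b.Holds s → Ens q s T' Q)
    (hU : b.time + T + T' + 1 ≤ U) : Ens (.cond b p q) s U Q :=
  (Ens.cond h h').mono hU fun _ h => h

theorem Frame.of_putNat {p : Program} {s : State} {a i v : ℕ} (h : a ∈ p.natWrites) :
    Frame p s (s.putNat a i v) :=
  ⟨fun b hb => by
    have : b ≠ a := by rintro rfl; exact hb h
    simp [this], fun _ _ => rfl⟩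

theorem Frame.of_putReal {p : Program} {s : State} {a i : ℕ} {v : ℝ} (h : a ∈ p.realWrites) :
    Frame p s (s.putReal a i v) :=
  ⟨fun _ _ => rfl, fun b hb => by
    have : b ≠ a := by rintro rfl; exact hb h
    simp [this]⟩

/-! ### Recording the cheapest assignment -/

/-- Output the assignment that has been found, if there is one and it is cheaper than the previous
ones. -/
def Program.record : Program :=
  .cond (.conj (.natLe (.const 1) (.var Reg.good))
      (.neg (.conj (.natLe (.const 1) (.var Reg.flag))
        (.realLe (.var Reg.outCost) (.var Reg.cost)))))
    (.seq (.set Reg.flag (.const 1))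
    (.seq (.setReal Reg.outCost (.const 0) (.var Reg.cost))
    (.seq (.for Reg.x .n
      (.seq (.setNat Reg.outCenter (.var Reg.x) (.read Reg.mark (.var Reg.x)))
        (.setNat Reg.outAssign (.var Reg.x) (.read Reg.center (.read Reg.label (.var Reg.x))))))
      (.for Reg.l .k (.setReal Reg.outRadius (.read Reg.center (.var Reg.l))
        (.read Reg.rad (.var Reg.l)))))))
    .skip

/-- The running time of `Program.record`. -/
def recordTime (n k : ℕ) : ℕ := 40 + (forTime .n n 20 + forTime .k k 20)

/-- An output is replaced only by a strictly cheaper one, so the recorded cost never increases and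
`Found` persists. The radii are written at the indices of their centers, hence the need for distinct
centers. -/
theorem ens_record {s : State} {n k : ℕ} (hn : s.nat Reg.size 0 = n) (hk : s.nat Reg.size 1 = k)
    (hinj : s.nat Reg.good 0 = 1 → Set.InjOn (s.nat Reg.center) (Set.Iio k))
    (hg : s.nat Reg.good 0 ≤ 1) (hfl : s.nat Reg.flag 0 ≤ 1) :
    Ens .record s (recordTime n k) fun s' =>
      (s' = s ∧ (s.nat Reg.good 0 = 1 →
        s.nat Reg.flag 0 = 1 ∧ s.real Reg.outCost 0 ≤ s.real Reg.cost 0)) ∨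
      (s.nat Reg.good 0 = 1 ∧
        (s.nat Reg.flag 0 = 1 → s.real Reg.cost 0 ≤ s.real Reg.outCost 0) ∧
        s'.nat Reg.flag 0 = 1 ∧ s'.real Reg.outCost 0 = s.real Reg.cost 0 ∧
        (∀ x < n, s'.nat Reg.outCenter x = s.nat Reg.mark x ∧
          s'.nat Reg.outAssign x = s.nat Reg.center (s.nat Reg.label x)) ∧
        ∀ l < k, s'.real Reg.outRadius (s.nat Reg.center l) = s.real Reg.rad l) := by
  have htest : (Test.conj (.natLe (.const 1) (.var Reg.good))
      (.neg (.conj (.natLe (.const 1) (.var Reg.flag))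
        (.realLe (.var Reg.outCost) (.var Reg.cost))))).Holds s ↔
      1 ≤ s.nat Reg.good 0 ∧
        ¬ (1 ≤ s.nat Reg.flag 0 ∧ s.real Reg.outCost 0 ≤ s.real Reg.cost 0) := Iff.rfl
  unfold recordTime
  refine Ens.cond_le (T := 7 + (forTime .n n 20 + forTime .k k 20)) (T' := 1)
    (fun hb => ?_) (fun hb => ?_) (by simp only [Test.time, NatExpr.time, RealExpr.time]; omega)
  · rw [htest] at hb
    obtain ⟨hb1, hb2⟩ := hb
    refine Ens.seq_le (T := 3) (T' := 4 + (forTime .n n 20 + forTime .k k 20))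
      (Ens.flat_le ?_ trivial (by decide)) (by omega)
    refine Ens.seq_le (T := 4) (T' := (forTime .n n 20 + forTime .k k 20))
      (Ens.flat_le ?_ trivial (by decide)) (by omega)
    simp only [Program.exec, NatExpr.eval, RealExpr.eval]
    set s0 := (s.putNat Reg.flag 0 1).putReal Reg.outCost 0
      ((s.putNat Reg.flag 0 1).real Reg.cost 0) with hs0
    have hF0 : Frame .record s s0 :=
      (Frame.of_putNat (by decide)).trans (Frame.of_putReal (by decide))
    have hfl0 : s0.nat Reg.flag 0 = 1 := by simp [hs0]
    have hoc0 : s0.real Reg.outCost 0 = s.real Reg.cost 0 := by simp [hs0]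
    clear_value s0
    refine Ens.seq ((ens_for n 20 (fun j s' =>
      ∀ x < j, s'.nat Reg.outCenter x = s.nat Reg.mark x ∧
          s'.nat Reg.outAssign x = s.nat Reg.center (s.nat Reg.label x))
      (by decide) ?_ ?_ (by simp) ?_).imp ?_)
    · intro s' hF
      rw [NatExpr.n, NatExpr.eval, hF.nat _ (by decide), hF0.nat _ (by decide)]
      exact hn
    · intro j s' x h; simpa using h
    · intro j hj s' hF hsj hI
      have hFs : Frame .record s s' := hF0.trans (hF.mono (by decide) (by decide))
      refine Ens.flat_le ?_ ⟨trivial, trivial⟩ (by decide)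
      have h1 := hFs.nat Reg.center (by decide)
      have h2 := hFs.nat Reg.label (by decide)
      have h3 := hFs.nat Reg.mark (by decide)
      intro x hx
      rcases Nat.lt_succ_iff_lt_or_eq.1 hx with hx | rfl
      · obtain ⟨h4, h5⟩ := hI x hx
        simp only [Reg.center, Reg.label, Reg.mark, Reg.outCenter, Reg.outAssign, Reg.x] at *
        simp [Program.exec, NatExpr.eval, hsj, Function.update_of_ne hx.ne, h4, h5]
      · simp only [Reg.center, Reg.label, Reg.mark, Reg.outCenter, Reg.outAssign, Reg.x] at *
        simp [Program.exec, NatExpr.eval, hsj, h1, h2, h3]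
    intro s1 hF1 hI1
    have hF1s : Frame .record s s1 := hF0.trans (hF1.mono (by decide) (by decide))
    refine (ens_for k 20 (fun j s' =>
      ∀ l < j, s'.real Reg.outRadius (s.nat Reg.center l) = s.real Reg.rad l)
      (by decide) ?_ ?_ (by simp) ?_).imp ?_
    · intro s' hF
      rw [NatExpr.k, NatExpr.eval, hF.nat _ (by decide), hF1s.nat _ (by decide)]
      exact hk
    · intro j s' x h; simpa using h
    · intro j hj s' hF hsj hI
      have hFs : Frame .record s s' := hF1s.trans (hF.mono (by decide) (by decide))
      refine Ens.flat_le ?_ trivial (by decide)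
      have h1 := hFs.nat Reg.center (by decide)
      have h2 := hFs.real Reg.rad (by decide)
      simp only [Program.exec, NatExpr.eval, RealExpr.eval, hsj, h1, h2]
      intro l hl
      rcases Nat.lt_succ_iff_lt_or_eq.1 hl with hl' | rfl
      · have hne : s.nat Reg.center l ≠ s.nat Reg.center j := fun h =>
          hl'.ne (hinj (by omega) (hl'.trans hj) hj h)
        rw [State.putReal_real, if_pos rfl, Function.update_of_ne hne, hI l hl']
      · simp
    · intro s' hF hI
      refine .inr ⟨by omega, fun h => ?_, ?_, ?_, fun x hx => ?_, hI⟩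
      · by_contra hlt
        exact hb2 ⟨h.ge, (not_le.1 hlt).le⟩
      · rw [hF.nat _ (by decide), hF1.nat _ (by decide), hfl0]
      · rw [hF.real _ (by decide), hF1.real _ (by decide), hoc0]
      · rw [hF.nat _ (by decide), hF.nat _ (by decide)]; exact hI1 x hx
  · rw [htest] at hb
    refine Ens.flat_le ?_ trivial (by decide)
    refine .inl ⟨rfl, fun h => ?_⟩
    by_contra h'
    exact hb ⟨h.ge, fun h2 => h' ⟨by omega, h2.2⟩⟩

/-- The memory holds an output with the centers `ce`, the assignment `f` and the radii `r`. -/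
structure Announces (D : Data) (s : State) (ce f r : ℕ → ℕ) : Prop where
  center_lt : ∀ l < D.k, ce l < D.n
  inj : Set.InjOn ce (Set.Iio D.k)
  map_lt : ∀ p < D.n, f p < D.k
  dist_le : ∀ p < D.n, D.d p (ce (f p)) ≤ r (f p)
  capacity : ∀ l < D.k, countBelow (fun p => f p = l) D.n ≤ D.η (ce l)
  outCenter : ∀ x < D.n, s.nat Reg.outCenter x = 1 ↔ ∃ l < D.k, ce l = x
  outAssign : ∀ x < D.n, s.nat Reg.outAssign x = ce (f x)
  outRadius : ∀ l < D.k, s.real Reg.outRadius (ce l) = r l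
  outCost : s.real Reg.outCost 0 = ∑ l ∈ Finset.range D.k, (r l : ℝ)

/-- The memory holds a correct output, or none. -/
def OutputOk (D : Data) (s : State) : Prop :=
  s.nat Reg.flag 0 = 0 ∨ (s.nat Reg.flag 0 = 1 ∧ ∃ ce f r, Announces D s ce f r)

/-- The memory holds an output of cost at most `C`. -/
def Found (s : State) (C : ℝ) : Prop := s.nat Reg.flag 0 = 1 ∧ s.real Reg.outCost 0 ≤ C

theorem OutputOk.frame {D : Data} {p : Program} {s s' : State} (h : OutputOk D s)
    (hF : Frame p s s') (hn : ∀ a ∈ [Reg.flag, Reg.outCenter, Reg.outAssign], a ∉ p.natWrites)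
    (hr : ∀ a ∈ [Reg.outRadius, Reg.outCost], a ∉ p.realWrites) : OutputOk D s' := by
  have h1 := hF.nat Reg.flag (hn _ (by simp))
  have h2 := hF.nat Reg.outCenter (hn _ (by simp))
  have h3 := hF.nat Reg.outAssign (hn _ (by simp))
  have h4 := hF.real Reg.outRadius (hr _ (by simp))
  have h5 := hF.real Reg.outCost (hr _ (by simp))
  unfold OutputOk
  rw [h1]
  refine h.imp id fun h => ⟨h.1, ?_⟩
  obtain ⟨-, ce, f, r, h⟩ := h
  exact ⟨ce, f, r, h.center_lt, h.inj, h.map_lt, h.dist_le, h.capacity, by rw [h2]; exact h.outCenter,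
    by rw [h3]; exact h.outAssign, by rw [h4]; exact h.outRadius, by rw [h5]; exact h.outCost⟩

theorem Found.frame {p : Program} {s s' : State} {C : ℝ} (h : Found s C)
    (hF : Frame p s s') (hn : Reg.flag ∉ p.natWrites) (hr : Reg.outCost ∉ p.realWrites) :
    Found s' C := by
  unfold Found
  rw [hF.nat _ hn, hF.real _ hr]
  exact h

/-- Try to assign the points to the current centers. -/
def Program.assign : Program := .seq .prepare (.seq .serve .record)

/-- The running time of `Program.assign`. -/
def assignTime (n k : ℕ) : ℕ := prepareTime n k + (serveTime n k + recordTime n k)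

/-- For arbitrary centers, even repeated or out of range, the output stays correct and does not get
worse. For servable centers Hall's condition holds at the start, so an assignment is found, and the
recorded cost is at most that of the current radii. -/
theorem ens_assign {D : Data} {s : State} (hE : Env D s)
    (hρ : ∀ l < D.k, ∃ m : ℕ, s.real Reg.rho l = m)
    (h0 : ∀ i < D.k, s.nat Reg.subset i = 0) (hO : OutputOk D s) :
    Ens .assign s (assignTime D.n D.k) fun s' =>
      (∀ i < D.k, s'.nat Reg.subset i = 0) ∧ OutputOk D s' ∧ (∀ C, Found s C → Found s' C) ∧
      (D.Servable (s.real Reg.rho) (s.nat Reg.center) →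
        Found s' (∑ l ∈ Finset.range D.k, 13 * s.real Reg.rho l)) := by
  refine Ens.seq ((ens_prepare hE.n hE.k).imp ?_)
  rintro s1 hF1 ⟨hg1, hg, hmark, hcap, hrad, hcost⟩
  have hE1 : Env D s1 := hE.frame hF1 (by decide) (by decide)
  have hO1 : OutputOk D s1 := hO.frame hF1 (by decide) (by decide)
  have hce1 : s1.nat Reg.center = s.nat Reg.center := hF1.nat _ (by decide)
  have hreach : (∀ l < D.k, s.nat Reg.center l < D.n) → ∀ q < D.n, ∀ l < D.k, (s1.Reaches q l ↔
      D.d q (s.nat Reg.center l) ≤ 13 * s.real Reg.rho l) := by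
    intro hlt q hq l hl
    rw [State.Reaches, hrad l hl, hce1, hE1.d q hq _ (hlt l hl)]
  refine Ens.seq ((ens_serve hE1.n hE1.k hE1.subsets (fun i hi => ?_) hg1).imp ?_)
  · rw [hF1.nat _ (by decide)]; exact h0 i hi
  rintro s2 hF2 ⟨hz2, hg2, hsound, hcomp⟩
  have hE2 : Env D s2 := hE1.frame hF2 (by decide) (by decide)
  have hO2 : OutputOk D s2 := hO1.frame hF2 (by decide) (by decide)
  have hce2 : s2.nat Reg.center = s.nat Reg.center := by rw [hF2.nat _ (by decide), hce1]
  have hmk2 : s2.nat Reg.mark = s1.nat Reg.mark := hF2.nat _ (by decide)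
  have hrad2 : s2.real Reg.rad = s1.real Reg.rad := hF2.real _ (by decide)
  have hcost2 : s2.real Reg.cost = s1.real Reg.cost := hF2.real _ (by decide)
  have hserv : D.Servable (s.real Reg.rho) (s.nat Reg.center) → s2.nat Reg.good 0 = 1 := by
    rintro ⟨h1, h2, f, h3, h4⟩
    refine hcomp (hg.2 ⟨h2, h1⟩) ⟨f, fun q hq _ => ⟨(h3 q hq).1, ?_⟩, fun l hl => ?_⟩
    · exact (hreach h2 q hq _ (h3 q hq).1).2 (h3 q hq).2
    · rw [hcap l hl, hE.eta _ (h2 l hl)]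
      simpa using h4 l hl
  have hC2 : ∀ C, Found s C → Found s2 C := fun C h =>
    (h.frame hF1 (by decide) (by decide)).frame hF2 (by decide) (by decide)
  have hfl : s2.nat Reg.flag 0 ≤ 1 := by rcases hO2 with h | h <;> omega
  refine (ens_record hE2.n hE2.k (fun h => ?_) hg2 hfl).imp ?_
  · rw [hce2]
    exact (hg.1 (hsound h).1).2
  rintro s3 hF3 h3
  refine ⟨fun i hi => by rw [hF3.nat _ (by decide)]; exact hz2 i hi, ?_⟩
  rcases h3 with ⟨rfl, h3⟩ | ⟨h3, h4, h5, h6, h7, h8⟩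
  · refine ⟨hO2, hC2, fun h => ?_⟩
    rw [← hcost, ← hcost2]
    exact h3 (hserv h)
  · rw [hcost2, hcost] at h4 h6
    rw [hce2, hrad2] at h8
    rw [hmk2, hce2] at h7
    refine ⟨.inr ⟨h5, ?_⟩, fun C hC => ⟨h5, ?_⟩, fun _ => ⟨h5, h6.le⟩⟩
    · obtain ⟨h9, h10, h11⟩ := hsound h3
      obtain ⟨h12, h13⟩ := hg.1 h9
      -- The current radii are natural numbers, so their 13-fold multiples are legitimate radii of a
      -- solution.
      choose! m hm using hρ
      refine ⟨s.nat Reg.center, s2.nat Reg.label, fun l => 13 * m l, h12, h13,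
        fun p hp => (h10 p hp).1, fun p hp => ?_, fun l hl => ?_, fun x hx => ?_,
        fun x hx => (h7 x hx).2, fun l hl => ?_, ?_⟩
      · obtain ⟨h14, h15⟩ := h10 p hp
        rw [hreach h12 p hp _ h14, hm _ h14] at h15
        push_cast
        exact h15
      · rw [← hE.eta _ (h12 l hl), ← hcap l hl]; exact h11 l hl
      · rw [(h7 x hx).1]; exact hmark x hx
      · rw [h8 l hl, hrad l hl, hm l hl]; push_cast; rfl
      · rw [h6]
        refine Finset.sum_congr rfl fun l hl => ?_
        rw [hm l (Finset.mem_range.1 hl)]; push_cast; rfl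
    · obtain ⟨h9, h10⟩ := hC2 C hC
      rw [h6]
      exact (h4 h9).trans h10

/-! ### One round -/

/-- The memory holds the radii `ρ` and the anchors `a`. -/
structure Stores (D : Data) (ρ : ℕ → ℝ) (a : Anchors) (s : State) : Prop where
  rho : ∀ l < D.k, s.real Reg.rho l = ρ l
  hit : ∀ l < D.k, (1 ≤ s.nat Reg.hit l ↔ l ∈ a.hit)
  pt : ∀ l < D.k, l ∈ a.hit → s.nat Reg.pt l = a.pt l
  pt_lt : ∀ l < D.k, l ∈ a.hit → a.pt l < D.n
  bit : ∀ j < D.k, j ∈ a.hit → ∀ i < D.k,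
    s.nat Reg.guess (s.nat Reg.bits j + i) = a.bit j i
  known_lt : ∀ j, s.nat Reg.known j < D.n

theorem Stores.frame {D : Data} {ρ : ℕ → ℝ} {a : Anchors} {p : Program} {s s' : State}
    (h : Stores D ρ a s) (hF : Frame p s s')
    (hn : ∀ b ∈ [Reg.hit, Reg.pt, Reg.guess, Reg.bits], b ∉ p.natWrites)
    (hr : Reg.rho ∉ p.realWrites) (hk : ∀ j, s'.nat Reg.known j < D.n) : Stores D ρ a s' := by
  have h1 := hF.nat Reg.hit (hn _ (by simp))
  have h2 := hF.nat Reg.pt (hn _ (by simp))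
  have h3 := hF.nat Reg.guess (hn _ (by simp))
  have h4 := hF.nat Reg.bits (hn _ (by simp))
  have h5 := hF.real Reg.rho hr
  exact ⟨by rw [h5]; exact h.rho, by rw [h1]; exact h.hit, by rw [h2]; exact h.pt, h.pt_lt,
    by rw [h3, h4]; exact h.bit, hk⟩

/-- A multiple of a real. -/
def RealExpr.times5 (r : RealExpr) : RealExpr := .add (.add (.add r r) (.add r r)) r

theorem RealExpr.eval_times5 (s : State) (r : RealExpr) : r.times5.eval s = 5 * r.eval s := by
  simp only [RealExpr.times5, RealExpr.eval]; ring

/-- The guess at the given position of the current block. -/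
abbrev NatExpr.blk (e : NatExpr) : NatExpr := .read Reg.guess (.add (.var Reg.off) e)

theorem Test.holds_disj (s : State) (b c : Test) :
    (Test.disj b c).Holds s ↔ b.Holds s ∨ c.Holds s := by
  simp only [Test.Holds]; tauto

/-- The test whether `y` precedes `x`. -/
def Test.precedes : Test :=
  .disj (.natLe (.add (.read Reg.eta (.var Reg.x)) (.const 1)) (.read Reg.eta (.var Reg.y)))
    (.conj (.natLe (.read Reg.eta (.var Reg.x)) (.read Reg.eta (.var Reg.y)))
      (.natLe (.add (.var Reg.y) (.const 1)) (.var Reg.x)))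

theorem Test.holds_precedes (s : State) :
    Test.precedes.Holds s ↔ Precedes (s.nat Reg.eta) (s.nat Reg.y 0) (s.nat Reg.x 0) := by
  unfold Test.precedes
  rw [Test.holds_disj]
  simp only [Test.Holds, NatExpr.eval, Precedes]
  omega

/-- The test whether a point is near the anchor of the current cluster. -/
abbrev Test.nearAnchor (x : ℕ) : Test :=
  .realLe (.d (.read Reg.pt (.var Reg.l)) (.var x)) (.times5 (.read Reg.rho (.var Reg.l)))

/-- Choose the centers of the anchored clusters. -/
def Program.chooseHit : Program :=
  .for Reg.l .k
    (.seq (.setNat Reg.center (.var Reg.l) (.const 0))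
    (.cond (.natLe (.const 1) (.read Reg.hit (.var Reg.l)))
      (.seq (.for Reg.x .n
        (.seq (.count Reg.y Reg.cnt .n .skip (.conj (.nearAnchor Reg.y) .precedes))
        (.cond (.conj (.nearAnchor Reg.x) (.conj (.natLe (.var Reg.cnt) (.blk (.var Reg.l)))
            (.natLe (.blk (.var Reg.l)) (.var Reg.cnt))))
          (.setNat Reg.center (.var Reg.l) (.var Reg.x)) .skip)))
        (.setNat Reg.known (.var Reg.l) (.read Reg.pt (.var Reg.l))))
      .skip))

/-- The running time of `Program.chooseHit`. -/
def chooseHitTime (n k : ℕ) : ℕ :=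
  forTime .k k (30 + forTime .n n (100 +
    countTime .n (.conj (.nearAnchor Reg.y) .precedes) n 1))

/-- The rank of a candidate is found by counting the points of the ball that precede it, and later
matches overwrite earlier ones, as in `pickLast`. The last clause is kept for every guess, right or
wrong, so that later reads of distances stay inside the table. -/
theorem ens_chooseHit {D : Data} {ρ : ℕ → ℝ} {a : Anchors} {s : State} (hE : Env D s)
    (hH : Stores D ρ a s) :
    Ens .chooseHit s (chooseHitTime D.n D.k) fun s' =>
      (∀ l < D.k, s'.nat Reg.center l =
        D.hitCenters ρ a (fun r => s.nat Reg.guess (s.nat Reg.off 0 + r)) l) ∧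
      (∀ l < D.k, l ∈ a.hit → s'.nat Reg.known l = a.pt l) ∧
      ∀ j, s'.nat Reg.known j < D.n := by
  classical
  set m : ℕ → ℕ := fun r => s.nat Reg.guess (s.nat Reg.off 0 + r) with hm
  unfold Program.chooseHit chooseHitTime
  refine (ens_for D.k _ (fun i s' =>
      (∀ l < i, s'.nat Reg.center l = D.hitCenters ρ a m l) ∧
      (∀ l < i, l ∈ a.hit → s'.nat Reg.known l = a.pt l) ∧
      ∀ j, s'.nat Reg.known j < D.n) (by decide) ?_ ?_ ?_ ?_).mono le_rfl ?_
  · intro s' hF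
    rw [NatExpr.k, NatExpr.eval, hF.nat _ (by decide)]
    exact hE.k
  · intro j s' x h; simpa using h
  · exact ⟨by simp, by simp, hH.known_lt⟩
  · rintro l hl s1 hF1 hsl ⟨h1, h2, h3⟩
    have hF1s : Frame .chooseHit s s1 := hF1
    refine Ens.seq_le (T := 4) (T' := 20 + forTime .n D.n (100 +
      countTime .n (.conj (.nearAnchor Reg.y) .precedes) D.n 1))
      (Ens.flat_le ?_ trivial (by decide)) (by omega)
    simp only [Program.exec, NatExpr.eval, hsl]
    set s2 := s1.putNat Reg.center l 0 with hs2
    have hF2 : Frame .chooseHit s s2 := hF1s.trans (Frame.of_putNat (by decide))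
    have hc2 : s2.nat Reg.center = Function.update (s1.nat Reg.center) l 0 := by simp [hs2]
    have hkn2 : s2.nat Reg.known = s1.nat Reg.known := by simp [hs2]
    have hl2 : s2.nat Reg.l 0 = l := by simpa [hs2] using hsl
    clear_value s2
    have hE2 : Env D s2 := hE.frame hF2 (by decide) (by decide)
    have hH2 : Stores D ρ a s2 := hH.frame hF2 (by decide) (by decide) (by rw [hkn2]; exact h3)
    refine Ens.cond_le (T := 10 + forTime .n D.n (100 +
      countTime .n (.conj (.nearAnchor Reg.y) .precedes) D.n 1)) (T' := 1) (fun hb => ?_)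
      (fun hb => ?_) (by simp only [Test.time, NatExpr.time]; omega)
    · simp only [Test.Holds, NatExpr.eval, hl2] at hb
      have hla := (hH2.hit l hl).1 hb
      set P : ℕ → Prop := fun x => D.d (a.pt l) x ≤ 5 * ρ l ∧
        rankIn D.n D.η (fun y => D.d (a.pt l) y ≤ 5 * ρ l) x = m l with hP
      have hnear : ∀ s' : State, Frame .chooseHit s s' → s'.nat Reg.l 0 = l →
          ∀ v, s'.nat v 0 < D.n → ((Test.nearAnchor v).Holds s' ↔
            D.d (a.pt l) (s'.nat v 0) ≤ 5 * ρ l) := by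
        intro s' hF hl' v hv
        have hE' : Env D s' := hE.frame hF (by decide) (by decide)
        rw [Test.Holds, RealExpr.eval_times5, RealExpr.eval, RealExpr.eval]
        simp only [NatExpr.eval, hl']
        rw [hF.real Reg.rho (by decide), hH.rho l hl, hF.nat Reg.pt (by decide), hH.pt l hl hla,
          ← hE'.d _ (hH.pt_lt l hl hla) _ hv]
        rfl
      refine Ens.seq_le (T := forTime .n D.n (100 +
        countTime .n (.conj (.nearAnchor Reg.y) .precedes) D.n 1)) (T' := 10)
        ((ens_for D.n _ (fun x s' => s'.nat Reg.center =
          Function.update (s1.nat Reg.center) l (pickLast P x)) (by decide) ?_ ?_ ?_ ?_).imp ?_)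
        (by omega)
      · intro s' hF'
        rw [NatExpr.n, NatExpr.eval, hF'.nat _ (by decide)]
        exact hE2.n
      · intro j s' x h; simpa using h
      · exact hc2
      · rintro x hx s3 hF3 hsx hc3
        have hF3s : Frame .chooseHit s s3 := hF2.trans (hF3.mono (by decide) (by decide))
        have hE3 : Env D s3 := hE.frame hF3s (by decide) (by decide)
        have hl3 : s3.nat Reg.l 0 = l := by rw [hF3.nat _ (by decide), hl2]
        refine Ens.seq_le (T' := 100) ((ens_count D.n 1 (fun y => D.d (a.pt l) y ≤ 5 * ρ l ∧
          Precedes D.η y x) (by decide) (by decide) (by decide) ?_ ?_).imp ?_) (by omega)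
        · intro s' hF'
          rw [NatExpr.n, NatExpr.eval, hF'.nat _ (by decide)]
          exact hE3.n
        · intro y hy s4 hF4 hsy
          have hF4s : Frame .chooseHit s s4 := hF3s.trans (hF4.mono (by decide) (by decide))
          have hE4 : Env D s4 := hE.frame hF4s (by decide) (by decide)
          refine Ens.flat_le ?_ trivial (by decide)
          rw [Program.exec, Test.Holds, hnear s4 hF4s (by rw [hF4.nat _ (by decide), hl3]) Reg.y
            (by rw [hsy]; exact hy), Test.holds_precedes, hsy, hF4.nat Reg.x (by decide), hsx]
          unfold Precedes
          rw [hE4.eta x hx, hE4.eta y hy]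
        · rintro s4 hF4 hcnt
          have hF4s : Frame .chooseHit s s4 := hF3s.trans (hF4.mono (by decide) (by decide))
          have hl4 : s4.nat Reg.l 0 = l := by rw [hF4.nat _ (by decide), hl3]
          have hx4 : s4.nat Reg.x 0 = x := by rw [hF4.nat _ (by decide), hsx]
          have hc4 : s4.nat Reg.center = s3.nat Reg.center := hF4.nat _ (by decide)
          have htest : (Test.conj (.nearAnchor Reg.x)
              (.conj (.natLe (.var Reg.cnt) (.blk (.var Reg.l)))
                (.natLe (.blk (.var Reg.l)) (.var Reg.cnt)))).Holds s4 ↔ P x := by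
            rw [Test.Holds, hnear s4 hF4s hl4 Reg.x (by rw [hx4]; exact hx), hx4]
            simp only [Test.Holds, NatExpr.eval, hl4, hcnt, hF4s.nat Reg.guess (by decide),
              hF4s.nat Reg.off (by decide), hP, rankIn, hm]
            exact and_congr_right fun _ => ⟨fun h => le_antisymm h.1 h.2, fun h => ⟨h.le, h.ge⟩⟩
          refine Ens.flat_le ?_ ⟨trivial, trivial⟩ (by decide)
          rw [Program.exec, pickLast]
          by_cases hPx : P x
          · rw [if_pos (htest.2 hPx), if_pos hPx]
            simp only [Program.exec, NatExpr.eval, hl4, hx4, State.putNat_nat, if_true, hc4, hc3,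
              Function.update_idem]
          · rw [if_neg fun h => hPx (htest.1 h), if_neg hPx, Program.exec, hc4, hc3]
      · rintro s3 hF3 hc3
        have hl3 : s3.nat Reg.l 0 = l := by rw [hF3.nat _ (by decide), hl2]
        have hF3s : Frame .chooseHit s s3 := hF2.trans (hF3.mono (by decide) (by decide))
        have hkn3 : s3.nat Reg.known = s1.nat Reg.known := by rw [hF3.nat _ (by decide), hkn2]
        have hpt3 : s3.nat Reg.pt l = a.pt l := by rw [hF3s.nat _ (by decide), hH.pt l hl hla]
        refine Ens.flat_le ?_ trivial (by decide)
        have hex : (Program.setNat Reg.known (.var Reg.l) (.read Reg.pt (.var Reg.l))).exec s3 =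
            s3.putNat Reg.known l (a.pt l) := by
          simp only [Program.exec, NatExpr.eval, hl3, hpt3]
        have hc : (s3.putNat Reg.known l (a.pt l)).nat Reg.center = s3.nat Reg.center := by simp
        have hk : (s3.putNat Reg.known l (a.pt l)).nat Reg.known =
          Function.update (s1.nat Reg.known) l (a.pt l) := by rw [← hkn3]; simp
        rw [hex, hc, hk, hc3]
        refine ⟨fun l' hl' => ?_, fun l' hl' hh => ?_, fun j => ?_⟩
        · rcases Nat.lt_succ_iff_lt_or_eq.1 hl' with hl' | rfl
          · rw [Function.update_of_ne hl'.ne, h1 l' hl']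
          · rw [Function.update_self, Data.hitCenters, if_pos ⟨hla, hl⟩]
        · rcases Nat.lt_succ_iff_lt_or_eq.1 hl' with hl' | rfl
          · rw [Function.update_of_ne hl'.ne, h2 l' hl' hh]
          · rw [Function.update_self]
        · by_cases hj : j = l
          · subst hj; rw [Function.update_self]; exact hH.pt_lt j hl hla
          · rw [Function.update_of_ne hj]; exact h3 j
    · simp only [Test.Holds, NatExpr.eval, hl2] at hb
      have hla : l ∉ a.hit := fun h => hb ((hH2.hit l hl).2 h)
      refine Ens.flat_le ?_ trivial (by decide)
      rw [Program.exec, hc2, hkn2]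
      refine ⟨fun l' hl' => ?_, fun l' hl' hh => ?_, h3⟩
      · rcases Nat.lt_succ_iff_lt_or_eq.1 hl' with hl' | rfl
        · rw [Function.update_of_ne hl'.ne, h1 l' hl']
        · rw [Function.update_self, Data.hitCenters, if_neg fun h => hla h.1]
      · rcases Nat.lt_succ_iff_lt_or_eq.1 hl' with hl' | rfl
        · exact h2 l' hl' hh
        · exact absurd hh hla
  · exact fun s' h => h

/-- If no point is admissible the default index `0` is returned. It is a point, so even a wrong
guess leads to a valid entry of `known`. -/
theorem pickBest_lt (P : ℕ → Prop) (score : ℕ → ℕ) {m : ℕ} (hm : 0 < m) :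
    (pickBest P score m).2 < m := by
  classical
  induction m with
  | zero => omega
  | succ m ih =>
    rw [pickBest]
    split_ifs with h
    · exact Nat.lt_succ_self m
    · rcases Nat.eq_zero_or_pos m with rfl | hm
      · simp [pickBest]
      · exact (ih hm).trans (Nat.lt_succ_self m)

/-- The radius of the cluster `e`. -/
abbrev RealExpr.ρ (e : NatExpr) : RealExpr := .read Reg.rho e

/-- The test whether the cluster `j` excludes the point `x` as a center of the cluster `l`. -/
def Test.bad : Test :=
  .disj (.conj (.disj (.natLe (.const 1) (.read Reg.hit (.var Reg.j)))
        (.natLe (.add (.var Reg.j) (.const 1)) (.var Reg.l)))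
      (.realLe (.d (.read Reg.known (.var Reg.j)) (.var Reg.x)) (.times5 (.ρ (.var Reg.l)))))
    (.conj (.natLe (.const 1) (.read Reg.hit (.var Reg.j)))
      (.disj (.conj (.natLe (.read Reg.guess (.add (.read Reg.bits (.var Reg.j)) (.var Reg.l)))
            (.const 0))
          (.realLe (.d (.read Reg.pt (.var Reg.j)) (.var Reg.x))
            (.add (.add (.add (.ρ (.var Reg.j)) (.ρ (.var Reg.j)))
                (.add (.ρ (.var Reg.j)) (.ρ (.var Reg.j))))
              (.add (.ρ (.var Reg.l)) (.ρ (.var Reg.l))))))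
        (.conj (.natLe (.read Reg.center (.var Reg.j)) (.var Reg.x))
          (.natLe (.var Reg.x) (.read Reg.center (.var Reg.j))))))

theorem Test.holds_bad {D : Data} {ρ : ℕ → ℝ} {a : Anchors} {s : State} {ce : ℕ → ℕ} {i j x : ℕ}
    (hE : Env D s) (hH : Stores D ρ a s) (hi : i < D.k) (hj : j < D.k) (hx : x < D.n)
    (hce : ∀ l < D.k, s.nat Reg.center l = ce l)
    (hkn : ∀ l < D.k, l ∈ a.hit ∨ l < i → s.nat Reg.known l = a.known ce l)
    (hsl : s.nat Reg.l 0 = i) (hsj : s.nat Reg.j 0 = j) (hsx : s.nat Reg.x 0 = x) :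
    Test.bad.Holds s ↔ D.Bad ρ a ce i j x := by
  unfold Test.bad
  simp only [Test.Holds, not_and_or, not_or, not_not, RealExpr.eval_times5]
  simp only [RealExpr.eval, NatExpr.eval, hsl, hsj, hsx, hce j hj, hH.rho i hi, hH.rho j hj,
    hH.hit j hj]
  have h1 : s.real Reg.dist (s.nat Reg.row (s.nat Reg.known j) + x) =
    D.d (s.nat Reg.known j) x := hE.d _ (hH.known_lt j) x hx
  rw [h1]
  unfold Data.Bad
  refine or_congr (Iff.trans (b := (j ∈ a.hit ∨ j < i) ∧ D.d (s.nat Reg.known j) x ≤ 5 * ρ i)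
    Iff.rfl ?_) (and_congr_right fun hh => or_congr ?_ ?_)
  · exact and_congr_right fun h => by rw [hkn j hj h]
  · have h2 : s.real Reg.dist (s.nat Reg.row (s.nat Reg.pt j) + x) = D.d (a.pt j) x := by
      rw [hH.pt j hj hh]; exact hE.d _ (hH.pt_lt j hj hh) x hx
    rw [h2, hH.bit j hj hh i hi, Nat.le_zero]
    refine and_congr_right fun _ => ?_
    rw [show ρ j + ρ j + (ρ j + ρ j) + (ρ i + ρ i) = 4 * ρ j + 2 * ρ i by ring]
  · exact ⟨fun h => le_antisymm h.1 h.2, fun h => ⟨h.le, h.ge⟩⟩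

/-- The number of points that the current point can serve, after these have been counted. -/
abbrev NatExpr.score : NatExpr :=
  .sub (.read Reg.eta (.var Reg.x)) (.sub (.read Reg.eta (.var Reg.x)) (.var Reg.cnt'))

/-- The test whether `y` is near `x`. -/
abbrev Test.near : Test := .realLe (.d (.var Reg.x) (.var Reg.y)) (.ρ (.var Reg.l))

/-- Choose the centers of the clusters that are not anchored. -/
def Program.chooseFree : Program :=
  .for Reg.l .k
    (.cond (.natLe (.const 1) (.read Reg.hit (.var Reg.l))) .skip
      (.seq (.set Reg.bestScore (.const 0))
      (.seq (.set Reg.best (.const 0))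
      (.seq (.for Reg.x .n
        (.seq (.count Reg.j Reg.cnt .k .skip .bad)
        (.seq (.count Reg.y Reg.cnt' .n .skip .near)
        (.cond (.conj (.natLe (.var Reg.cnt) (.const 0)) (.natLe (.var Reg.bestScore) .score))
          (.seq (.set Reg.bestScore .score) (.set Reg.best (.var Reg.x))) .skip))))
      (.seq (.setNat Reg.center (.var Reg.l) (.var Reg.best))
        (.setNat Reg.known (.var Reg.l) (.var Reg.best)))))))

/-- The running time of the choice of a center. -/
def chooseTime (n k : ℕ) : ℕ :=
  forTime .n n (countTime .k .bad k 1 + (countTime .n .near n 1 + 60))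

/-- The running time of `Program.chooseFree`. -/
def chooseFreeTime (n k : ℕ) : ℕ := forTime .k k (40 + chooseTime n k)

/-- In the middle of the loop `known` is right only for anchored clusters and for those already
treated. `Data.Bad` looks at no others. -/
theorem ens_chooseFree {D : Data} {ρ : ℕ → ℝ} {a : Anchors} {s : State} {m : ℕ → ℕ}
    (hn : 0 < D.n) (hE : Env D s) (hH : Stores D ρ a s)
    (hce : ∀ l < D.k, s.nat Reg.center l = D.hitCenters ρ a m l)
    (hkn : ∀ l < D.k, l ∈ a.hit → s.nat Reg.known l = a.pt l) :
    Ens .chooseFree s (chooseFreeTime D.n D.k) fun s' =>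
      (∀ l < D.k, s'.nat Reg.center l = D.centers ρ a m l) ∧
      (∀ l < D.k, s'.nat Reg.known l = a.known (D.centers ρ a m) l) ∧
      ∀ j, s'.nat Reg.known j < D.n := by
  classical
  unfold Program.chooseFree chooseFreeTime
  refine (ens_for D.k _ (fun i s' =>
      (∀ l < D.k, s'.nat Reg.center l = D.centersUpTo ρ a m i l) ∧
      (∀ l < D.k, l ∈ a.hit ∨ l < i → s'.nat Reg.known l = a.known (D.centersUpTo ρ a m i) l) ∧
      ∀ j, s'.nat Reg.known j < D.n) (by decide) ?_ ?_ ?_ ?_).mono le_rfl ?_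
  · intro s' hF
    rw [NatExpr.k, NatExpr.eval, hF.nat _ (by decide)]
    exact hE.k
  · intro j s' x h; simpa using h
  · refine ⟨hce, fun l hl h => ?_, hH.known_lt⟩
    have h : l ∈ a.hit := h.resolve_right (by omega)
    rw [hkn l hl h, Anchors.known, if_pos h]
  · rintro i hi s1 hF1 hsl ⟨h1, h2, h3⟩
    have hF1s : Frame .chooseFree s s1 := hF1
    have hE1 : Env D s1 := hE.frame hF1s (by decide) (by decide)
    have hH1 : Stores D ρ a s1 := hH.frame hF1s (by decide) (by decide) h3
    set ce := D.centersUpTo ρ a m i with hcedef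
    refine Ens.cond_le (T := 1) (T' := 30 + chooseTime D.n D.k) (fun hb => ?_) (fun hb => ?_)
      (by simp only [Test.time, NatExpr.time]; omega)
    · simp only [Test.Holds, NatExpr.eval, hsl] at hb
      have hia := (hH1.hit i hi).1 hb
      refine Ens.flat_le ?_ trivial (by decide)
      have hup : D.centersUpTo ρ a m (i + 1) = ce := by
        rw [Data.centersUpTo, if_pos hia]
      rw [Program.exec, hup]
      refine ⟨h1, fun l hl h => h2 l hl ?_, h3⟩
      rcases h with h | h
      · exact .inl h
      · rcases Nat.lt_succ_iff_lt_or_eq.1 h with h | rfl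
        · exact .inr h
        · exact .inl hia
    · simp only [Test.Holds, NatExpr.eval, hsl] at hb
      have hia : i ∉ a.hit := fun h => hb ((hH1.hit i hi).2 h)
      set P : ℕ → Prop := fun x => ∀ j < D.k, ¬ D.Bad ρ a ce i j x with hP
      refine Ens.seq_le (T := 3) (T' := 23 + chooseTime D.n D.k)
        (Ens.flat_le ?_ trivial (by decide)) (by omega)
      refine Ens.seq_le (T := 3) (T' := 20 + chooseTime D.n D.k)
        (Ens.flat_le ?_ trivial (by decide)) (by omega)
      simp only [Program.exec, NatExpr.eval]
      set s2 := (s1.putNat Reg.bestScore 0 0).putNat Reg.best 0 0 with hs2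
      have hF2 : Frame .chooseFree s1 s2 :=
        (Frame.of_putNat (by decide)).trans (Frame.of_putNat (by decide))
      have hc2 : s2.nat Reg.center = s1.nat Reg.center := by simp [hs2]
      have hk2 : s2.nat Reg.known = s1.nat Reg.known := by simp [hs2]
      have hl2 : s2.nat Reg.l 0 = i := by simpa [hs2] using hsl
      have hb2 : s2.nat Reg.best 0 = 0 ∧ s2.nat Reg.bestScore 0 = 0 := by simp [hs2]
      clear_value s2
      have hE2 : Env D s2 := hE1.frame hF2 (by decide) (by decide)
      have hH2 : Stores D ρ a s2 := hH1.frame hF2 (by decide) (by decide) (by rw [hk2]; exact h3)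
      refine Ens.seq_le (T := chooseTime D.n D.k) (T' := 10)
        ((ens_for D.n _ (fun x s' => (s'.nat Reg.bestScore 0, s'.nat Reg.best 0) =
          pickBest P (D.score (ρ i)) x) (by decide) ?_ ?_ ?_ ?_).imp ?_)
        (by omega)
      · intro s' hF'
        rw [NatExpr.n, NatExpr.eval, hF'.nat _ (by decide)]
        exact hE2.n
      · intro j s' x h; simpa using h
      · rw [hb2.1, hb2.2]; rfl
      · rintro x hx s3 hF3 hsx hb3
        have hE3 : Env D s3 := hE2.frame hF3 (by decide) (by decide)
        have hl3 : s3.nat Reg.l 0 = i := by rw [hF3.nat _ (by decide), hl2]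
        have hc3 : s3.nat Reg.center = s1.nat Reg.center := by rw [hF3.nat _ (by decide), hc2]
        have hk3 : s3.nat Reg.known = s1.nat Reg.known := by rw [hF3.nat _ (by decide), hk2]
        have hH3 : Stores D ρ a s3 := hH2.frame hF3 (by decide) (by decide)
          (by rw [hk3]; exact h3)
        refine Ens.seq ((ens_count D.k 1 (fun j => D.Bad ρ a ce i j x) (by decide)
          (by decide) (by decide) ?_ ?_).imp ?_)
        · intro s' hF'
          rw [NatExpr.k, NatExpr.eval, hF'.nat _ (by decide)]
          exact hE3.k
        · intro j hj s4 hF4 hsj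
          have hE4 : Env D s4 := hE3.frame hF4 (by decide) (by decide)
          have hc4 : s4.nat Reg.center = s1.nat Reg.center := by rw [hF4.nat _ (by decide), hc3]
          have hk4 : s4.nat Reg.known = s1.nat Reg.known := by rw [hF4.nat _ (by decide), hk3]
          have hH4 : Stores D ρ a s4 := hH3.frame hF4 (by decide) (by decide)
            (by rw [hk4]; exact h3)
          refine Ens.flat_le ?_ trivial (by decide)
          rw [Program.exec]
          exact Test.holds_bad hE4 hH4 hi hj hx (by rw [hc4]; exact h1) (by rw [hk4]; exact h2)
            (by rw [hF4.nat _ (by decide), hl3]) hsj (by rw [hF4.nat _ (by decide), hsx])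
        intro s4 hF4 hcnt4
        have hE4 : Env D s4 := hE3.frame hF4 (by decide) (by decide)
        have hl4 : s4.nat Reg.l 0 = i := by rw [hF4.nat _ (by decide), hl3]
        have hx4 : s4.nat Reg.x 0 = x := by rw [hF4.nat _ (by decide), hsx]
        refine Ens.seq ((ens_count D.n 1 (fun y => D.d x y ≤ ρ i) (by decide)
          (by decide) (by decide) ?_ ?_).imp ?_)
        · intro s' hF'
          rw [NatExpr.n, NatExpr.eval, hF'.nat _ (by decide)]
          exact hE4.n
        · intro y hy s5 hF5 hsy
          have hE5 : Env D s5 := hE4.frame hF5 (by decide) (by decide)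
          have hl5 : s5.nat Reg.l 0 = i := by rw [hF5.nat _ (by decide), hl4]
          have hx5 : s5.nat Reg.x 0 = x := by rw [hF5.nat _ (by decide), hx4]
          have hr5 : s5.real Reg.rho i = ρ i := by
            rw [hF5.real _ (by decide), hF4.real _ (by decide), hH3.rho i hi]
          refine Ens.flat_le ?_ trivial (by decide)
          simp only [Program.exec, Test.Holds, RealExpr.eval, NatExpr.eval, hl5, hx5, hsy, hr5]
          rw [← hE5.d x hx y hy]
          rfl
        intro s5 hF5 hcnt5
        have hE5 : Env D s5 := hE4.frame hF5 (by decide) (by decide)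
        have hx5 : s5.nat Reg.x 0 = x := by rw [hF5.nat _ (by decide), hx4]
        have hb5 : (s5.nat Reg.bestScore 0, s5.nat Reg.best 0) =
            pickBest P (D.score (ρ i)) x := by
          rw [← hb3, hF5.nat Reg.best (by decide), hF4.nat Reg.best (by decide),
            hF5.nat Reg.bestScore (by decide), hF4.nat Reg.bestScore (by decide)]
        have hcnt : s5.nat Reg.cnt 0 = countBelow (fun j => D.Bad ρ a ce i j x) D.k := by
          rw [hF5.nat _ (by decide), hcnt4]
        have hsc : NatExpr.score.eval s5 = D.score (ρ i) x := by
          simp only [NatExpr.eval, hx5, hcnt5, hE5.eta x hx, Data.score]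
        have hbs : s5.nat Reg.bestScore 0 = (pickBest P (D.score (ρ i)) x).1 := by rw [← hb5]
        have htest : (Test.conj (.natLe (.var Reg.cnt) (.const 0))
            (.natLe (.var Reg.bestScore) .score)).Holds s5 ↔
            P x ∧ (pickBest P (D.score (ρ i)) x).1 ≤ D.score (ρ i) x := by
          rw [Test.Holds, Test.Holds, Test.Holds, hsc]
          simp only [NatExpr.eval, hcnt, hbs, Nat.le_zero, countBelow_eq_zero, hP]
        refine Ens.flat_le ?_ ⟨⟨trivial, trivial⟩, trivial⟩ (by decide)
        rw [Program.exec, pickBest]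
        by_cases hPx : P x ∧ (pickBest P (D.score (ρ i)) x).1 ≤ D.score (ρ i) x
        · rw [if_pos (htest.2 hPx), if_pos hPx]
          simp only [Program.exec, hsc]
          simp only [NatExpr.eval]
          simp only [Reg.x] at hx5
          simp [hx5]
        · rw [if_neg fun h => hPx (htest.1 h), if_neg hPx, Program.exec, hb5]
      · rintro s3 hF3 hb3
        have hl3 : s3.nat Reg.l 0 = i := by rw [hF3.nat _ (by decide), hl2]
        have hc3 : s3.nat Reg.center = s1.nat Reg.center := by rw [hF3.nat _ (by decide), hc2]
        have hk3 : s3.nat Reg.known = s1.nat Reg.known := by rw [hF3.nat _ (by decide), hk2]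
        set w := (pickBest P (D.score (ρ i)) D.n).2 with hw
        have hwb : s3.nat Reg.best 0 = w := by rw [hw, ← hb3]
        have hwn : w < D.n := pickBest_lt _ _ hn
        have hup : D.centersUpTo ρ a m (i + 1) = Function.update ce i w := by
          rw [Data.centersUpTo, if_neg hia]
        refine Ens.flat_le ?_ ⟨trivial, trivial⟩ (by decide)
        have hex : Program.exec (.seq (.setNat Reg.center (.var Reg.l) (.var Reg.best))
            (.setNat Reg.known (.var Reg.l) (.var Reg.best))) s3 =
            (s3.putNat Reg.center i w).putNat Reg.known i w := by
          simp only [Program.exec, NatExpr.eval, hl3, hwb]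
          simp only [Reg.l, Reg.best] at hl3 hwb
          simp [hl3, hwb]
        have hc : ((s3.putNat Reg.center i w).putNat Reg.known i w).nat Reg.center =
            Function.update (s1.nat Reg.center) i w := by rw [← hc3]; simp
        have hk : ((s3.putNat Reg.center i w).putNat Reg.known i w).nat Reg.known =
            Function.update (s1.nat Reg.known) i w := by rw [← hk3]; simp
        rw [hex, hc, hk, hup]
        refine ⟨fun l hl => ?_, fun l hl h => ?_, fun j => ?_⟩
        · by_cases hli : l = i
          · subst hli; simp
          · rw [Function.update_of_ne hli, Function.update_of_ne hli, h1 l hl]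
        · by_cases hli : l = i
          · subst hli; simp [Anchors.known, hia]
          · rw [Function.update_of_ne hli, h2 l hl (h.imp id fun h => by omega)]
            unfold Anchors.known
            rw [Function.update_of_ne hli]
        · by_cases hli : j = i
          · subst hli; rw [Function.update_self]; exact hwn
          · rw [Function.update_of_ne hli]; exact h3 j
  · rintro s' ⟨h1, h2, h3⟩
    exact ⟨h1, fun l hl => h2 l hl (.inr hl), h3⟩

/-- Anchor a cluster at one of the known points, as guessed, and go to the next block. -/
def Program.anchor : Program :=
  .seq (.setNat Reg.pt (.blk .k) (.read Reg.known (.blk (.add .k (.const 1)))))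
  (.seq (.setNat Reg.bits (.blk .k) (.add (.var Reg.off) (.add .k (.const 2))))
  (.seq (.setNat Reg.hit (.blk .k) (.const 1))
    (.set Reg.off (.add (.var Reg.off) (.add .k (.add .k (.const 2)))))))

/-- If the guessed source is out of range, an arbitrary cell of `known` becomes the anchor. It is
still a point, so some anchors are stored in any case, but the equality with `Data.event` needs a
source below `k`. -/
theorem ens_anchor {D : Data} {ρ : ℕ → ℝ} {a : Anchors} {s : State} {m : ℕ → ℕ}
    (hE : Env D s) (hS : Stores D ρ a s) (hm : m = fun r => s.nat Reg.guess (s.nat Reg.off 0 + r))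
    (hkn : ∀ l < D.k, s.nat Reg.known l = a.known (D.centers ρ a m) l) :
    Ens .anchor s 60 fun s' => ∃ a', Stores D ρ a' s' ∧
      (m (D.k + 1) < D.k → a' = D.event ρ a m) ∧
      s'.nat Reg.off 0 = s.nat Reg.off 0 + (2 * D.k + 2) := by
  classical
  refine Ens.flat_le ?_ ⟨trivial, trivial, trivial, trivial⟩ (by decide)
  have hk : s.nat Reg.size 1 = D.k := hE.k
  have h1 : s.nat Reg.guess (s.nat Reg.off 0 + D.k) = m D.k := by rw [hm]
  have h2 : s.nat Reg.guess (s.nat Reg.off 0 + (D.k + 1)) = m (D.k + 1) := by rw [hm]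
  have hex : ∃ s', s' = Program.anchor.exec s ∧
      s'.nat Reg.pt = Function.update (s.nat Reg.pt) (m D.k) (s.nat Reg.known (m (D.k + 1))) ∧
      s'.nat Reg.bits =
        Function.update (s.nat Reg.bits) (m D.k) (s.nat Reg.off 0 + (D.k + 2)) ∧
      s'.nat Reg.hit = Function.update (s.nat Reg.hit) (m D.k) 1 ∧
      s'.nat Reg.off 0 = s.nat Reg.off 0 + (D.k + (D.k + 2)) ∧
      s'.nat Reg.known = s.nat Reg.known ∧ s'.nat Reg.guess = s.nat Reg.guess ∧
      s'.real = s.real := by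
    refine ⟨_, rfl, ?_⟩
    clear hm
    simp only [Reg.size, Reg.guess, Reg.off] at *
    simp [Program.anchor, Program.exec, NatExpr.eval, hk, h1, h2]
  obtain ⟨s', hs', e1, e2, e3, e4, e5, e6, e7⟩ := hex
  rw [← hs']
  refine ⟨⟨insert (m D.k) a.hit, Function.update a.pt (m D.k) (s.nat Reg.known (m (D.k + 1))),
    Function.update a.bit (m D.k) fun i => if i < D.k then m (D.k + 2 + i) else 0⟩, ⟨?_, ?_, ?_, ?_,
    ?_, ?_⟩, fun hlt => ?_, by rw [e4]; omega⟩
  · rw [e7]; exact hS.rho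
  · intro l hl
    rw [e3, Set.mem_insert_iff]
    by_cases h : l = m D.k
    · subst h; simp
    · rw [Function.update_of_ne h, hS.hit l hl]; simp [h]
  · intro l hl h
    rw [e1]
    by_cases hlm : l = m D.k
    · subst hlm; simp
    · rw [Function.update_of_ne hlm]
      simp only [Function.update_of_ne hlm]
      exact hS.pt l hl (h.resolve_left hlm)
  · intro l hl h
    by_cases hlm : l = m D.k
    · subst hlm
      simp only [Function.update_self]
      exact hS.known_lt _
    · simp only [Function.update_of_ne hlm]
      exact hS.pt_lt l hl (h.resolve_left hlm)
  · intro j hj h i hi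
    rw [e2, e6]
    by_cases hjm : j = m D.k
    · subst hjm
      simp only [Function.update_self, if_pos hi]
      rw [hm]
      simp only [add_assoc]
    · simp only [Function.update_of_ne hjm]
      exact hS.bit j hj (h.resolve_left hjm) i hi
  · rw [e5]; exact hS.known_lt
  · unfold Data.event
    rw [hkn _ hlt]

theorem Data.servable_congr {D : Data} {ρ ρ' : ℕ → ℝ} {ce ce' : ℕ → ℕ}
    (hρ : ∀ l < D.k, ρ l = ρ' l) (hce : ∀ l < D.k, ce l = ce' l) (h : D.Servable ρ ce) :
    D.Servable ρ' ce' := by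
  obtain ⟨h1, h2, f, h3, h4⟩ := h
  refine ⟨fun a ha b hb hab => h1 ha hb (by rw [hce a ha, hce b hb, hab]),
    fun l hl => hce l hl ▸ h2 l hl, f, fun p hp => ⟨(h3 p hp).1, ?_⟩,
    fun l hl => hce l hl ▸ h4 l hl⟩
  rw [← hce _ (h3 p hp).1, ← hρ _ (h3 p hp).1]
  exact (h3 p hp).2

/-- Choose the centers, try to assign the points to them, and anchor another cluster. -/
def Program.round : Program := .seq .chooseHit (.seq .chooseFree (.seq .assign .anchor))

/-- The running time of `Program.round`. -/
def roundTime (n k : ℕ) : ℕ :=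
  chooseHitTime n k + (chooseFreeTime n k + (assignTime n k + 60))

/-- Correctness of the output and the persistence of `Found` hold for every guess. The round
succeeds as soon as the centers prescribed by the stored anchors and the current block are servable.
-/
theorem ens_round {D : Data} {ρ : ℕ → ℝ} {a : Anchors} {s : State} {m : ℕ → ℕ}
    (hn : 0 < D.n) (hE : Env D s) (hS : Stores D ρ a s)
    (hm : m = fun r => s.nat Reg.guess (s.nat Reg.off 0 + r))
    (hρ : ∀ l < D.k, ∃ r : ℕ, ρ l = r)
    (h0 : ∀ i < D.k, s.nat Reg.subset i = 0) (hO : OutputOk D s) :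
    Ens .round s (roundTime D.n D.k) fun s' =>
      (∃ a', Stores D ρ a' s' ∧ (m (D.k + 1) < D.k → a' = D.event ρ a m)) ∧
      s'.nat Reg.off 0 = s.nat Reg.off 0 + (2 * D.k + 2) ∧
      (∀ i < D.k, s'.nat Reg.subset i = 0) ∧ OutputOk D s' ∧ (∀ C, Found s C → Found s' C) ∧
      (D.Servable ρ (D.centers ρ a m) → Found s' (∑ l ∈ Finset.range D.k, 13 * ρ l)) := by
  refine Ens.seq ((ens_chooseHit hE hS).imp ?_)
  rw [← hm]
  rintro s1 hF1 ⟨hc1, hk1, hkn1⟩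
  have hE1 : Env D s1 := hE.frame hF1 (by decide) (by decide)
  have hO1 : OutputOk D s1 := hO.frame hF1 (by decide) (by decide)
  have hS1 : Stores D ρ a s1 := hS.frame hF1 (by decide) (by decide) hkn1
  refine Ens.seq ((ens_chooseFree hn hE1 hS1 hc1 hk1).imp ?_)
  rintro s2 hF2 ⟨hc2, hk2, hkn2⟩
  have hE2 : Env D s2 := hE1.frame hF2 (by decide) (by decide)
  have hO2 : OutputOk D s2 := hO1.frame hF2 (by decide) (by decide)
  have hS2 : Stores D ρ a s2 := hS1.frame hF2 (by decide) (by decide) hkn2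
  refine Ens.seq ((ens_assign hE2 (fun l hl => ?_) (fun i hi => ?_) hO2).imp ?_)
  · rw [hS2.rho l hl]; exact hρ l hl
  · rw [hF2.nat _ (by decide), hF1.nat _ (by decide)]; exact h0 i hi
  rintro s3 hF3 ⟨hz3, hO3, hC3, hserv⟩
  have hE3 : Env D s3 := hE2.frame hF3 (by decide) (by decide)
  have hk3 : s3.nat Reg.known = s2.nat Reg.known := hF3.nat _ (by decide)
  have hS3 : Stores D ρ a s3 := hS2.frame hF3 (by decide) (by decide) (by rw [hk3]; exact hkn2)
  have hoff : s3.nat Reg.off = s.nat Reg.off := by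
    rw [hF3.nat _ (by decide), hF2.nat _ (by decide), hF1.nat _ (by decide)]
  have hguess : s3.nat Reg.guess = s.nat Reg.guess := by
    rw [hF3.nat _ (by decide), hF2.nat _ (by decide), hF1.nat _ (by decide)]
  refine (ens_anchor (m := m) hE3 hS3 (by rw [hoff, hguess, hm]) (by rw [hk3]; exact hk2)).imp ?_
  rintro s4 hF4 ⟨a', ha', hev, hoff4⟩
  refine ⟨⟨a', ha', hev⟩, by rw [hoff4, hoff], fun i hi => ?_,
    hO3.frame hF4 (by decide) (by decide), fun C hC => ?_, fun hs => ?_⟩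
  · rw [hF4.nat _ (by decide)]; exact hz3 i hi
  · refine (hC3 C ?_).frame hF4 (by decide) (by decide)
    exact (hC.frame hF1 (by decide) (by decide)).frame hF2 (by decide) (by decide)
  · have := hserv (Data.servable_congr (fun l hl => (hS2.rho l hl).symm)
      (fun l hl => (hc2 l hl).symm) hs)
    rw [Finset.sum_congr rfl fun l hl => by
      rw [← hS2.rho l (Finset.mem_range.1 hl)]]
    exact this.frame hF4 (by decide) (by decide)

/-! ### All rounds of one guess -/

/-- The largest integer below a real. -/
def RealExpr.floor (r : RealExpr) : RealExpr :=
  .sub (.cast (.const 0)) (.ceil (.sub (.cast (.const 0)) r))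

theorem RealExpr.eval_floor (s : State) (r : RealExpr) : r.floor.eval s = ⌊r.eval s⌋ := by
  simp [RealExpr.floor, RealExpr.eval, NatExpr.eval, Int.ceil_neg]

/-- The number of rounds. -/
abbrev NatExpr.rounds : NatExpr := .add (.add .k .k) (.const 1)

/-- Try the current guess with the current unit. -/
def Program.search : Program :=
  .seq (.for Reg.l .k
    (.seq (.setReal Reg.rho (.var Reg.l)
        (.floor (.read Reg.table (.read Reg.guess (.var Reg.l)))))
      (.setNat Reg.hit (.var Reg.l) (.const 0))))
  (.seq (.set Reg.off .k) (.for Reg.e .rounds .round))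

/-- The running time of `Program.search`. -/
def searchTime (n k : ℕ) : ℕ :=
  forTime .k k 25 + (4 + forTime .rounds (2 * k + 1) (roundTime n k))

/-- The stored anchors agree with `Data.anchors` as long as the sources guessed so far are in range.
Success in any one round is enough, because later rounds cannot raise the recorded cost. -/
theorem ens_search {D : Data} {s : State} {u : ℝ} {g : ℕ → ℕ} (hn : 0 < D.n) (hE : Env D s)
    (hu : 0 ≤ u) (hg : s.nat Reg.guess = g)
    (htab : ∀ l < D.k, s.real Reg.table (g l) = g l * u)
    (hkn : ∀ j, s.nat Reg.known j < D.n)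
    (h0 : ∀ i < D.k, s.nat Reg.subset i = 0) (hO : OutputOk D s) :
    Ens .search s (searchTime D.n D.k) fun s' =>
      (∀ j, s'.nat Reg.known j < D.n) ∧ (∀ i < D.k, s'.nat Reg.subset i = 0) ∧ OutputOk D s' ∧
      (∀ C, Found s C → Found s' C) ∧
      (D.Good u g → Found s' (∑ l ∈ Finset.range D.k, 13 * gridRadius D.k u g l)) := by
  classical
  set ρ := gridRadius D.k u g with hρ
  refine Ens.seq ((ens_for D.k 25 (fun i s' => (∀ l < i, s'.real Reg.rho l = ρ l) ∧
    ∀ l < i, s'.nat Reg.hit l = 0) (by decide) ?_ ?_ (by simp) ?_).imp ?_)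
  · intro s' hF
    rw [NatExpr.k, NatExpr.eval, hF.nat _ (by decide)]
    exact hE.k
  · intro j s' x h; simpa using h
  · rintro i hi s1 hF1 hsl ⟨h1, h2⟩
    have hg1 : s1.nat Reg.guess = g := by rw [hF1.nat _ (by decide), hg]
    have ht1 : s1.real Reg.table = s.real Reg.table := hF1.real _ (by decide)
    refine Ens.flat_le ?_ ⟨trivial, trivial⟩ (by decide)
    have hval : ((⌊(g i : ℝ) * u⌋ : ℤ) : ℝ) = ρ i := by rw [hρ, gridRadius, if_pos hi]
    have hex : Program.exec (.seq (.setReal Reg.rho (.var Reg.l)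
        (.floor (.read Reg.table (.read Reg.guess (.var Reg.l)))))
        (.setNat Reg.hit (.var Reg.l) (.const 0))) s1 =
        (s1.putReal Reg.rho i (ρ i)).putNat Reg.hit i 0 := by
      simp only [Program.exec, RealExpr.eval_floor, RealExpr.eval, NatExpr.eval, hsl, hg1, ht1,
        htab i hi, hval, State.putReal_nat]
    rw [hex]
    refine ⟨fun l hl => ?_, fun l hl => ?_⟩
    · rcases Nat.lt_succ_iff_lt_or_eq.1 hl with hl | rfl
      · simpa [Function.update_of_ne hl.ne] using h1 l hl
      · simp
    · rcases Nat.lt_succ_iff_lt_or_eq.1 hl with hl | rfl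
      · simpa [Function.update_of_ne hl.ne] using h2 l hl
      · simp
  rintro s1 hF1 ⟨hr1, hh1⟩
  have hE1 : Env D s1 := hE.frame hF1 (by decide) (by decide)
  have hO1 : OutputOk D s1 := hO.frame hF1 (by decide) (by decide)
  have hg1 : s1.nat Reg.guess = g := by rw [hF1.nat _ (by decide), hg]
  have hC1 : ∀ C, Found s C → Found s1 C := fun C h => h.frame hF1 (by decide) (by decide)
  have hz1 : ∀ i < D.k, s1.nat Reg.subset i = 0 := by rw [hF1.nat _ (by decide)]; exact h0
  have hkn1 : ∀ j, s1.nat Reg.known j < D.n := by rw [hF1.nat _ (by decide)]; exact hkn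
  have hS1 : Stores D ρ ⟨∅, 0, 0⟩ s1 :=
    ⟨hr1, fun l hl => by simp [hh1 l hl], by simp, by simp, by simp, hkn1⟩
  refine Ens.seq (Ens.flat_le (p := .set Reg.off .k) (T := 4) ?_ trivial (by decide))
  -- The first `k` digits of the guess are the multiples of the unit, so the blocks start at offset
  -- `k`.
  have hex : (Program.set Reg.off .k).exec s1 = s1.putNat Reg.off 0 D.k := by
    rw [← hE1.k]; simp only [Program.exec, NatExpr.eval]
  rw [hex]
  have hF2 : Frame (Program.set Reg.off .k) s1 (s1.putNat Reg.off 0 D.k) :=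
    Frame.of_putNat (by decide)
  have hoff2 : (s1.putNat Reg.off 0 D.k).nat Reg.off 0 = D.k := by simp
  set s2 := s1.putNat Reg.off 0 D.k with hs2
  clear_value s2
  have hE2 : Env D s2 := hE1.frame hF2 (by decide) (by decide)
  have hO2 : OutputOk D s2 := hO1.frame hF2 (by decide) (by decide)
  have hg2 : s2.nat Reg.guess = g := by rw [hF2.nat _ (by decide), hg1]
  have hC2 : ∀ C, Found s C → Found s2 C := fun C h =>
    (hC1 C h).frame hF2 (by decide) (by decide)
  have hz2 : ∀ i < D.k, s2.nat Reg.subset i = 0 := by rw [hF2.nat _ (by decide)]; exact hz1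
  have hS2 : Stores D ρ ⟨∅, 0, 0⟩ s2 := hS1.frame hF2 (by decide) (by decide)
    (by rw [hF2.nat _ (by decide)]; exact hkn1)
  have hρn : ∀ l < D.k, ∃ r : ℕ, ρ l = r := by
    intro l hl
    obtain ⟨r, hr⟩ := Int.eq_ofNat_of_zero_le
      (Int.floor_nonneg.2 (mul_nonneg (Nat.cast_nonneg (g l)) hu))
    refine ⟨r, ?_⟩
    rw [hρ, gridRadius, if_pos hl, hr]; simp
  refine (ens_for (2 * D.k + 1) _ (fun e s' => ∃ a, Stores D ρ a s' ∧
      ((∀ e' < e, block D.k g e' (D.k + 1) < D.k) → a = D.anchors ρ (block D.k g) e) ∧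
      s'.nat Reg.off 0 = D.k + e * (2 * D.k + 2) ∧
      (∀ i < D.k, s'.nat Reg.subset i = 0) ∧ OutputOk D s' ∧ (∀ C, Found s C → Found s' C) ∧
      ∀ e' < e, (∀ e'' ≤ 2 * D.k, block D.k g e'' (D.k + 1) < D.k) →
        D.Servable ρ (D.centers ρ (D.anchors ρ (block D.k g) e') (block D.k g e')) →
          Found s' (∑ l ∈ Finset.range D.k, 13 * ρ l)) (by decide) ?_ ?_ ?_ ?_).mono le_rfl ?_
  · intro s' hF
    simp only [NatExpr.eval, hF.nat Reg.size (by decide), hE2.k]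
    ring
  · rintro j s' x ⟨a, h1, h2, h3, h4, h5, h6, h7⟩
    have hF : Frame (Program.set Reg.e (.const 0)) s' (s'.putNat Reg.e 0 x) :=
      Frame.of_putNat (by decide)
    refine ⟨a, h1.frame hF (by decide) (by decide) (by simpa using h1.known_lt), h2,
      by simpa using h3, by simpa using h4, h5.frame hF (by decide) (by decide),
      fun C hC => (h6 C hC).frame hF (by decide) (by decide),
      fun e' he' h h' => (h7 e' he' h h').frame hF (by decide) (by decide)⟩
  · exact ⟨_, hS2, fun _ => rfl, by simpa using hoff2, hz2, hO2, hC2, by simp⟩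
  · rintro e he s3 hF3 hse ⟨a, h1, h2, h3, h4, h5, h6, h7⟩
    have hE3 : Env D s3 := hE2.frame hF3 (by decide) (by decide)
    have hg3 : s3.nat Reg.guess = g := by rw [hF3.nat _ (by decide), hg2]
    have hm : block D.k g e = fun r => s3.nat Reg.guess (s3.nat Reg.off 0 + r) := by
      rw [hg3, h3]; rfl
    refine (ens_round hn hE3 h1 hm hρn h4 h5).imp ?_
    rintro s4 hF4 ⟨⟨a', g1, g2⟩, g3, g4, g5, g6, g7⟩
    refine ⟨a', g1, fun h => ?_, ?_, g4, g5, fun C hC => g6 C (h6 C hC), fun e' he' hv hs => ?_⟩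
    · rw [g2 (h e (Nat.lt_succ_self e)), h2 fun e' he' => h e' (by omega)]
      rfl
    · rw [g3, h3]; ring
    · rcases Nat.lt_succ_iff_lt_or_eq.1 he' with he' | rfl
      · exact g6 _ (h7 e' he' hv hs)
      · rw [← h2 fun e'' he'' => hv e'' (by omega)] at hs
        exact g7 hs
  · rintro s' ⟨a, h1, h2, h3, h4, h5, h6, h7⟩
    refine ⟨h1.known_lt, h4, h5, h6, ?_⟩
    rintro ⟨hv, e, he, hs⟩
    exact h7 e (by omega) hv hs

/-- Only the multiples of the unit and the blocks of `2 * k + 1` rounds are read. Hence finitely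
many digits suffice, although a guess is a function on all of `ℕ`. -/
theorem Data.good_congr {D : Data} {u : ℝ} {g g' : ℕ → ℕ}
    (h : ∀ i < D.k + (2 * D.k + 1) * (2 * D.k + 2), g i = g' i) (hg : D.Good u g) :
    D.Good u g' := by
  have hb : ∀ e ≤ 2 * D.k, ∀ r < 2 * D.k + 2, block D.k g e r = block D.k g' e r := by
    intro e he r hr
    refine h _ ?_
    have h1 : e * (2 * D.k + 2) ≤ 2 * D.k * (2 * D.k + 2) := Nat.mul_le_mul_right _ he
    have h2 : (2 * D.k + 1) * (2 * D.k + 2) = 2 * D.k * (2 * D.k + 2) + (2 * D.k + 2) := by ring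
    omega
  have hr : gridRadius D.k u g = gridRadius D.k u g' := by
    funext l
    unfold gridRadius
    split_ifs with hl
    · rw [h l (by omega)]
    · rfl
  obtain ⟨h1, e, he, h2⟩ := hg
  refine ⟨fun e he => by rw [← hb e he _ (by omega)]; exact h1 e he, e, he, ?_⟩
  rw [← hr, ← D.anchors_congr _ e fun e' he' r hr => hb e' (by omega) r hr,
    ← D.centers_congr _ _ fun l hl => hb e he l (by omega)]
  exact h2

/-! ### Running through all guesses and all units -/

/-- The memory is ready for the first guess. -/
structure Ready (D : Data) (L : ℕ) (s : State) : Prop where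
  known_lt : ∀ j, s.nat Reg.known j < D.n
  subset : ∀ i < D.k, s.nat Reg.subset i = 0
  guess : ∀ i < L, s.nat Reg.guess i = 0
  ok : OutputOk D s

theorem Ready.frame {D : Data} {L : ℕ} {p : Program} {s s' : State} (h : Ready D L s)
    (hF : Frame p s s') (hn : ∀ a ∈ [Reg.known, Reg.subset, Reg.guess, Reg.flag, Reg.outCenter,
      Reg.outAssign], a ∉ p.natWrites)
    (hr : ∀ a ∈ [Reg.outRadius, Reg.outCost], a ∉ p.realWrites) : Ready D L s' := by
  have h1 := hF.nat Reg.known (hn _ (by simp))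
  have h2 := hF.nat Reg.subset (hn _ (by simp))
  have h3 := hF.nat Reg.guess (hn _ (by simp))
  refine ⟨by rw [h1]; exact h.known_lt, by rw [h2]; exact h.subset, by rw [h3]; exact h.guess,
    h.ok.frame hF (fun a ha => hn a ?_) hr⟩
  simp only [List.mem_cons] at ha ⊢
  tauto

/-- The parameters of the search. -/
structure Params (D : Data) (H B : ℕ) (s : State) : Prop where
  expo : s.nat Reg.expo 0 = H
  base : s.nat Reg.base 0 = B
  len : s.nat Reg.len 0 = D.k + (2 * D.k + 1) * (2 * D.k + 2)
  guesses : s.nat Reg.guesses 0 = B ^ (D.k + (2 * D.k + 1) * (2 * D.k + 2))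

theorem Params.frame {D : Data} {H B : ℕ} {p : Program} {s s' : State} (h : Params D H B s)
    (hF : Frame p s s')
    (hn : ∀ a ∈ [Reg.expo, Reg.base, Reg.len, Reg.guesses], a ∉ p.natWrites) :
    Params D H B s' := by
  have h1 := hF.nat Reg.expo (hn _ (by simp))
  have h2 := hF.nat Reg.base (hn _ (by simp))
  have h3 := hF.nat Reg.len (hn _ (by simp))
  have h4 := hF.nat Reg.guesses (hn _ (by simp))
  exact ⟨by rw [h1]; exact h.expo, by rw [h2]; exact h.base, by rw [h3]; exact h.len,
    by rw [h4]; exact h.guesses⟩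

/-- Try all guesses with the current unit. -/
def Program.searchAll : Program :=
  .for Reg.t (.var Reg.guesses)
    (.seq .search (.increment Reg.guess (.var Reg.len) (.var Reg.base)))

/-- The running time of `Program.searchAll`. -/
def searchAllTime (n k B L : ℕ) : ℕ :=
  forTime (.var Reg.guesses) (B ^ L)
    (searchTime n k + incrementTime (.var Reg.len) (.var Reg.base) L)

/-- The array `guess` is a counter in base `B`, so all digit strings of length `L` occur. After `B ^
L` increments it is zero again, and the next unit starts from a ready memory without any reset. -/
theorem ens_searchAll {D : Data} {s : State} {u : ℝ} {H B L : ℕ} (hn : 0 < D.n) (hE : Env D s)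
    (hL : L = D.k + (2 * D.k + 1) * (2 * D.k + 2)) (hB : 0 < B)
    (hP : Params D H B s) (hR : Ready D L s) (hu : 0 ≤ u)
    (htab : ∀ j < B, s.real Reg.table j = j * u) :
    Ens .searchAll s (searchAllTime D.n D.k B L) fun s' =>
      Ready D L s' ∧ (∀ C, Found s C → Found s' C) ∧
      ∀ g : ℕ → ℕ, (∀ i, g i < B) → D.Good u g →
        Found s' (∑ l ∈ Finset.range D.k, 13 * gridRadius D.k u g l) := by
  unfold Program.searchAll searchAllTime
  refine (ens_for (B ^ L) _ (fun t s' => (∀ j, s'.nat Reg.known j < D.n) ∧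
      (∀ i < D.k, s'.nat Reg.subset i = 0) ∧ OutputOk D s' ∧ (∀ C, Found s C → Found s' C) ∧
      (∀ i < L, s'.nat Reg.guess i = t / B ^ i % B) ∧
      ∀ t' < t, ∀ g : ℕ → ℕ, (∀ i < L, t' / B ^ i % B = g i) → D.Good u g →
        Found s' (∑ l ∈ Finset.range D.k, 13 * gridRadius D.k u g l)) (by decide) ?_ ?_ ?_
    ?_).mono le_rfl ?_
  · intro s' hF
    have hP' : Params D H B s' := hP.frame hF (by decide)
    rw [NatExpr.eval, NatExpr.eval, hP'.guesses, hL]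
  · rintro j s' x ⟨h1, h2, h3, h4, h5, h6⟩
    have hF : Frame (Program.set Reg.t (.const 0)) s' (s'.putNat Reg.t 0 x) :=
      Frame.of_putNat (by decide)
    exact ⟨by simpa using h1, by simpa using h2, h3.frame hF (by decide) (by decide),
      fun C hC => (h4 C hC).frame hF (by decide) (by decide), by simpa using h5,
      fun t' ht' g hg hG => (h6 t' ht' g hg hG).frame hF (by decide) (by decide)⟩
  · exact ⟨hR.known_lt, hR.subset, hR.ok, fun _ h => h, fun i hi => by simp [hR.guess i hi],
      by simp⟩
  · rintro t ht s1 hF1 hst ⟨h1, h2, h3, h4, h5, h6⟩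
    have hE1 : Env D s1 := hE.frame hF1 (by decide) (by decide)
    have hP1 : Params D H B s1 := hP.frame hF1 (by decide)
    refine Ens.seq ((ens_search hn hE1 hu rfl (fun l hl => ?_) h1 h2 h3).imp ?_)
    · rw [hF1.real _ (by decide)]
      refine htab _ ?_
      rw [h5 l (by omega)]
      exact Nat.mod_lt _ hB
    rintro s2 hF2 ⟨g1, g2, g3, g4, g5⟩
    have hP2 : Params D H B s2 := hP1.frame hF2 (by decide)
    refine (ens_increment (t := t) (M := L) (B := B) (by decide) hB ?_ ?_ ?_).imp ?_
    · intro s' hF'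
      have hP' : Params D H B s' := hP2.frame hF' (by decide)
      rw [NatExpr.eval, NatExpr.eval, hP'.len, hL]
    · intro s' hF'
      have hP' : Params D H B s' := hP2.frame hF' (by decide)
      rw [NatExpr.eval, NatExpr.eval, hP'.base]
    · intro i hi
      rw [hF2.nat _ (by decide)]; exact h5 i hi
    rintro s3 hF3 f1
    refine ⟨by rw [hF3.nat _ (by decide)]; exact g1, by rw [hF3.nat _ (by decide)]; exact g2,
      g3.frame hF3 (by decide) (by decide),
      fun C hC => (g4 C (h4 C hC)).frame hF3 (by decide) (by decide), f1,
      fun t' ht' g hg hG => ?_⟩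
    refine Found.frame ?_ hF3 (by decide) (by decide)
    rcases Nat.lt_succ_iff_lt_or_eq.1 ht' with ht' | rfl
    · exact g4 _ (h6 t' ht' g hg hG)
    · have hgg : ∀ i < L, g i = s1.nat Reg.guess i := fun i hi => by rw [h5 i hi, hg i hi]
      have := g5 (Data.good_congr (by rw [← hL]; exact hgg) hG)
      refine ⟨this.1, this.2.trans (Finset.sum_le_sum fun l hl => le_of_eq ?_)⟩
      have hl := Finset.mem_range.1 hl
      unfold gridRadius
      rw [if_pos hl, if_pos hl, hgg l (by omega)]
  · rintro s' ⟨h1, h2, h3, h4, h5, h6⟩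
    refine ⟨⟨h1, h2, fun i hi => ?_, h3⟩, h4, fun g hg hG => ?_⟩
    · rw [h5 i hi]
      obtain ⟨r, rfl⟩ : ∃ r, L = i + 1 + r := ⟨L - (i + 1), by omega⟩
      have : B ^ (i + 1 + r) = B ^ i * (B * B ^ r) := by ring
      rw [this, Nat.mul_div_cancel_left _ (by positivity), Nat.mul_mod_right]
    · obtain ⟨t, ht, hd⟩ := exists_digits (B := B) L g fun i _ => hg i
      exact h6 t ht g hd hG

theorem Data.IsMetric.nonneg {D : Data} (h : D.IsMetric) {x y : ℕ} (hx : x < D.n) (hy : y < D.n) :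
    0 ≤ D.d x y := by
  have h1 := h.triangle x hx y hy x hx
  rw [h.self x hx, h.symm y hy x hx] at h1
  linarith

/-- Set the unit, and compute its multiples. -/
def Program.scale : Program :=
  .seq (.setReal Reg.unit (.const 0)
    (.ceil (.d (.read Reg.far (.var Reg.a)) (.var Reg.z))))
  (.seq (.for Reg.j (.var Reg.expo) (.setReal Reg.unit (.const 0) (.half (.var Reg.unit))))
  (.seq (.setReal Reg.table (.const 0) (.cast (.const 0)))
  (.for Reg.j (.var Reg.base)
    (.setReal Reg.table (.add (.var Reg.j) (.const 1))
      (.add (.read Reg.table (.var Reg.j)) (.var Reg.unit))))))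

/-- The running time of `Program.scale`. -/
def scaleTime (H B : ℕ) : ℕ :=
  20 + (forTime (.var Reg.expo) H 10 + (10 + forTime (.var Reg.base) B 20))

/-- Without multiplication, the division by `2 ^ H` becomes `H` halvings and the multiples of the
unit are tabulated by repeated addition. A guessed digit is then an index into this table. -/
theorem ens_scale {D : Data} {s : State} {v : ℝ} {H B : ℕ} (hP : Params D H B s)
    (hval : s.d (s.nat Reg.far (s.nat Reg.a 0)) (s.nat Reg.z 0) = v) :
    Ens .scale s (scaleTime H B) fun s' =>
      ∀ j < B, s'.real Reg.table j = j * ((⌈v⌉ : ℝ) / 2 ^ H) := by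
  unfold Program.scale scaleTime
  have hex : (Program.setReal Reg.unit (.const 0)
      (.ceil (.d (.read Reg.far (.var Reg.a)) (.var Reg.z)))).exec s =
      s.putReal Reg.unit 0 ⌈v⌉ := by
    rw [← hval]; rfl
  refine Ens.seq (Ens.flat_le ?_ trivial (by decide))
  rw [hex]
  have hF1 : Frame .scale s (s.putReal Reg.unit 0 ⌈v⌉) := Frame.of_putReal (by decide)
  have hP1 : Params D H B (s.putReal Reg.unit 0 ⌈v⌉) := hP.frame hF1 (by decide)
  refine Ens.seq ((ens_for H 10 (fun j s' => s'.real Reg.unit 0 = ⌈v⌉ / 2 ^ j) (by decide)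
    ?_ ?_ ?_ ?_).imp ?_)
  · intro s' hF
    have hP' : Params D H B s' := hP1.frame hF (by decide)
    rw [NatExpr.eval, NatExpr.eval, hP'.expo]
  · intro j s' x h; simpa using h
  · simp
  · intro j hj s' hF hsj hI
    refine Ens.flat_le ?_ trivial (by decide)
    simp only [Program.exec, RealExpr.eval, NatExpr.eval, hI]
    simp [pow_succ, div_div]
  intro s2 hF2 hu2
  have hP2 : Params D H B s2 := hP1.frame hF2 (by decide)
  refine Ens.seq (Ens.flat_le (p := .setReal Reg.table (.const 0) (.cast (.const 0))) ?_ trivial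
    (by decide))
  simp only [Program.exec, RealExpr.eval, NatExpr.eval, Nat.cast_zero]
  have hF3 : Frame .scale s2 (s2.putReal Reg.table 0 0) := Frame.of_putReal (by decide)
  have hP3 : Params D H B (s2.putReal Reg.table 0 0) := hP2.frame hF3 (by decide)
  refine (ens_for B 20 (fun j s' => ∀ i ≤ j, s'.real Reg.table i = i * ((⌈v⌉ : ℝ) / 2 ^ H))
    (by decide) ?_ ?_ ?_ ?_).mono le_rfl fun s' h j hj => h j hj.le
  · intro s' hF
    have hP' : Params D H B s' := hP3.frame hF (by decide)
    rw [NatExpr.eval, NatExpr.eval, hP'.base]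
  · intro j s' x h; simpa using h
  · intro i hi
    obtain rfl : i = 0 := by omega
    simp
  · intro j hj s' hF hsj hI
    refine Ens.flat_le ?_ trivial (by decide)
    have hu : s'.real Reg.unit 0 = ⌈v⌉ / 2 ^ H := by
      rw [hF.real _ (by decide), ← hu2]; simp
    intro i hi
    simp only [Program.exec, RealExpr.eval, NatExpr.eval, hsj, hu, hI j le_rfl]
    rw [State.putReal_real, if_pos rfl]
    by_cases hij : i = j + 1
    · subst hij
      rw [Function.update_self]; push_cast; ring
    · rw [Function.update_of_ne hij, hI i (by omega)]

/-- Try all guesses with all units. -/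
def Program.tryAll : Program :=
  .for Reg.a (.add .k (.const 1)) (.for Reg.z .n (.seq .scale .searchAll))

/-- The running time of `Program.tryAll`. -/
def tryAllTime (n k H B L : ℕ) : ℕ :=
  forTime (.add .k (.const 1)) (k + 1) (forTime .n n (scaleTime H B + searchAllTime n k B L))

/-- Every pair of a traversal point and a point supplies a unit; the one promised by
`Solution.Feasible.exists_good` is among them. -/
theorem ens_tryAll {D : Data} {s : State} {q : ℕ → ℕ} {H B L : ℕ} (hn : 0 < D.n)
    (hD : D.IsMetric) (hE : Env D s)
    (hL : L = D.k + (2 * D.k + 1) * (2 * D.k + 2)) (hB : 0 < B)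
    (hP : Params D H B s) (hR : Ready D L s) (hq : s.nat Reg.far = q)
    (hqn : ∀ b ≤ D.k, q b < D.n) :
    Ens .tryAll s (tryAllTime D.n D.k H B L) fun s' => OutputOk D s' ∧
      ∀ b ≤ D.k, ∀ z < D.n, ∀ g : ℕ → ℕ, (∀ i, g i < B) →
        D.Good ((⌈D.d (q b) z⌉ : ℝ) / 2 ^ H) g →
        Found s' (∑ l ∈ Finset.range D.k, 13 * gridRadius D.k ((⌈D.d (q b) z⌉ : ℝ) / 2 ^ H) g l) := by
  unfold Program.tryAll tryAllTime
  refine (ens_for (D.k + 1) _ (fun b s' => Ready D L s' ∧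
      ∀ b' < b, ∀ z < D.n, ∀ g : ℕ → ℕ, (∀ i, g i < B) →
        D.Good ((⌈D.d (q b') z⌉ : ℝ) / 2 ^ H) g →
        Found s' (∑ l ∈ Finset.range D.k,
          13 * gridRadius D.k ((⌈D.d (q b') z⌉ : ℝ) / 2 ^ H) g l)) (by decide) ?_ ?_ ?_
    ?_).mono le_rfl ?_
  · intro s' hF
    have hE' : Env D s' := hE.frame hF (by decide) (by decide)
    simp only [NatExpr.eval, hE'.k]
  · rintro j s' x ⟨h1, h2⟩
    have hF : Frame (Program.set Reg.a (.const 0)) s' (s'.putNat Reg.a 0 x) :=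
      Frame.of_putNat (by decide)
    exact ⟨h1.frame hF (by decide) (by decide),
      fun b hb z hz g hg hG => (h2 b hb z hz g hg hG).frame hF (by decide) (by decide)⟩
  · exact ⟨hR, by simp⟩
  · rintro b hb s1 hF1 hsb ⟨h1, h2⟩
    have hE1 : Env D s1 := hE.frame hF1 (by decide) (by decide)
    refine (ens_for D.n _ (fun z s' => Ready D L s' ∧ (∀ C, Found s1 C → Found s' C) ∧
      ∀ z' < z, ∀ g : ℕ → ℕ, (∀ i, g i < B) →
        D.Good ((⌈D.d (q b) z'⌉ : ℝ) / 2 ^ H) g →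
        Found s' (∑ l ∈ Finset.range D.k,
          13 * gridRadius D.k ((⌈D.d (q b) z'⌉ : ℝ) / 2 ^ H) g l)) (by decide) ?_ ?_ ?_
      ?_).mono le_rfl ?_
    · intro s' hF
      have hE' : Env D s' := hE1.frame hF (by decide) (by decide)
      simp only [NatExpr.eval, hE'.n]
    · rintro j s' x ⟨h1, h2, h3⟩
      have hF : Frame (Program.set Reg.z (.const 0)) s' (s'.putNat Reg.z 0 x) :=
        Frame.of_putNat (by decide)
      exact ⟨h1.frame hF (by decide) (by decide),
        fun C hC => (h2 C hC).frame hF (by decide) (by decide),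
        fun z hz g hg hG => (h3 z hz g hg hG).frame hF (by decide) (by decide)⟩
    · exact ⟨h1, fun _ h => h, by simp⟩
    · rintro z hz s2 hF2 hsz ⟨g1, g2, g3⟩
      have hE2 : Env D s2 := hE1.frame hF2 (by decide) (by decide)
      have hP2 : Params D H B s2 := (hP.frame hF1 (by decide)).frame hF2 (by decide)
      have hq2 : s2.nat Reg.far = q := by
        rw [hF2.nat _ (by decide), hF1.nat _ (by decide), hq]
      have hb2 : s2.nat Reg.a 0 = b := by rw [hF2.nat _ (by decide), hsb]
      have hqb := hqn b (by omega)
      refine Ens.seq ((ens_scale (v := D.d (q b) z) hP2 ?_).imp ?_)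
      · rw [hq2, hb2, hsz, hE2.d _ hqb _ hz]
      intro s3 hF3 htab
      have hE3 : Env D s3 := hE2.frame hF3 (by decide) (by decide)
      have hu : (0 : ℝ) ≤ (⌈D.d (q b) z⌉ : ℝ) / 2 ^ H := by
        refine div_nonneg ?_ (by positivity)
        exact_mod_cast Int.ceil_nonneg (hD.nonneg hqb hz)
      refine (ens_searchAll hn hE3 hL hB (hP2.frame hF3 (by decide))
        (g1.frame hF3 (by decide) (by decide)) hu htab).mono le_rfl ?_
      rintro s4 ⟨f1, f2, f3⟩
      refine ⟨f1, fun C hC => f2 C ((g2 C hC).frame hF3 (by decide) (by decide)),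
        fun z' hz' g hg hG => ?_⟩
      rcases Nat.lt_succ_iff_lt_or_eq.1 hz' with hz' | rfl
      · exact f2 _ ((g3 z' hz' g hg hG).frame hF3 (by decide) (by decide))
      · exact f3 g hg hG
    · rintro s2 ⟨g1, g2, g3⟩
      refine ⟨g1, fun b' hb' z hz g hg hG => ?_⟩
      rcases Nat.lt_succ_iff_lt_or_eq.1 hb' with hb' | rfl
      · exact g2 _ (h2 b' hb' z hz g hg hG)
      · exact g3 z hz g hg hG
  · rintro s' ⟨h1, h2⟩
    exact ⟨h1.ok, fun b hb => h2 b (by omega)⟩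

/-! ### Preprocessing: row offsets, farthest-first traversal, parameters -/

/-- Compute the offsets of the rows of the distance matrix, and the number of sets of clusters. -/
def Program.layout : Program :=
  .seq (.for Reg.x .n (.setNat Reg.row (.add (.var Reg.x) (.const 1))
    (.add (.read Reg.row (.var Reg.x)) .n)))
  (.seq (.set Reg.subsets (.const 1))
    (.for Reg.j .k (.set Reg.subsets (.add (.var Reg.subsets) (.var Reg.subsets)))))

/-- The running time of `Program.layout`. -/
def layoutTime (n k : ℕ) : ℕ := forTime .n n 20 + (3 + forTime .k k 20)

theorem ens_layout {s : State} {n k : ℕ} (hn : s.nat Reg.size 0 = n) (hk : s.nat Reg.size 1 = k)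
    (h0 : s.nat Reg.row 0 = 0) :
    Ens .layout s (layoutTime n k) fun s' =>
      (∀ i ≤ n, s'.nat Reg.row i = i * n) ∧ s'.nat Reg.subsets 0 = 2 ^ k := by
  unfold Program.layout layoutTime
  refine Ens.seq ((ens_for n 20 (fun j s' => ∀ i ≤ j, s'.nat Reg.row i = i * n) (by decide)
    ?_ ?_ ?_ ?_).imp ?_)
  · intro s' hF
    rw [NatExpr.n, NatExpr.eval, hF.nat _ (by decide)]; exact hn
  · intro j s' x h; simpa using h
  · intro i hi
    obtain rfl : i = 0 := by omega
    rw [h0, zero_mul]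
  · intro j hj s' hF hsj hI
    refine Ens.flat_le ?_ trivial (by decide)
    have hs : s'.nat Reg.size 0 = n := by rw [hF.nat _ (by decide), hn]
    intro i hi
    simp only [Program.exec, NatExpr.eval, hsj, hI j le_rfl, hs]
    rw [State.putNat_nat, if_pos rfl]
    by_cases hij : i = j + 1
    · subst hij
      rw [Function.update_self]; ring
    · rw [Function.update_of_ne hij, hI i (by omega)]
  intro s1 hF1 h1
  refine Ens.seq (Ens.flat_le (p := .set Reg.subsets (.const 1)) ?_ trivial (by decide))
  simp only [Program.exec, NatExpr.eval]
  refine (ens_for k 20 (fun j s' => (∀ i ≤ n, s'.nat Reg.row i = i * n) ∧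
    s'.nat Reg.subsets 0 = 2 ^ j) (by decide) ?_ ?_ ?_ ?_).mono le_rfl fun _ h => h
  · intro s' hF
    rw [NatExpr.k, NatExpr.eval, hF.nat _ (by decide)]
    have h := hF1.nat Reg.size (by decide)
    simp only [Reg.size] at hk h
    simp [NatExpr.eval, h, hk]
  · intro j s' x h; simpa using h
  · exact ⟨by simpa using h1, by simp⟩
  · rintro j hj s' hF hsj ⟨h2, h3⟩
    refine Ens.flat_le ?_ trivial (by decide)
    simp only [Program.exec, NatExpr.eval, h3]
    refine ⟨by simpa using h2, ?_⟩
    rw [State.putNat_nat, if_pos rfl, Function.update_self, pow_succ]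
    ring

/-- The new point maximizes the distance to the earlier ones. So it is at least the old maximum away
from each of them, and the new minimal distances are below the old ones. -/
theorem Data.Spread.step {D : Data} {q : ℕ → ℕ} {j z : ℕ} {md md' : ℕ → ℝ} (h : D.Spread q j md)
    (hz : z < D.n) (hmax : ∀ x < D.n, md x ≤ md z)
    (hmd : ∀ x < D.n, md' x = min (md x) (D.d z x)) :
    D.Spread (Function.update q (j + 1) z) (j + 1) md' := by
  obtain ⟨h1, h2, h3, h4⟩ := h
  have hq : ∀ b ≤ j, Function.update q (j + 1) z b = q b := fun b hb =>
    Function.update_of_ne (by omega) _ _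
  refine ⟨fun b hb => ?_, fun x hx => ?_, fun b hb x hx => ?_, fun b c hbc hc x hx => ?_⟩
  · rcases Nat.le_succ_iff.1 hb with hb | rfl
    · rw [hq b hb]; exact h1 b hb
    · rw [Function.update_self]; exact hz
  · rw [hmd x hx]
    rcases min_choice (md x) (D.d z x) with h | h
    · obtain ⟨b, hb, h'⟩ := h2 x hx
      exact ⟨b, by omega, by rw [h, hq b hb, h']⟩
    · exact ⟨j + 1, le_rfl, by rw [h, Function.update_self]⟩
  · rw [hmd x hx]
    rcases Nat.le_succ_iff.1 hb with hb | rfl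
    · rw [hq b hb]; exact (min_le_left _ _).trans (h3 b hb x hx)
    · rw [Function.update_self]; exact min_le_right _ _
  · rw [hmd x hx, hq b (by omega)]
    refine (min_le_left _ _).trans ?_
    rcases Nat.le_succ_iff.1 hc with hc | rfl
    · rw [hq c hc]; exact h4 b c hbc hc x hx
    · rw [Function.update_self]; exact (hmax x hx).trans (h3 b (by omega) z hz)

/-- Choose points that are far from each other. -/
def Program.farthest : Program :=
  .seq (.for Reg.x .n (.setReal Reg.gap (.var Reg.x) (.d (.read Reg.far (.const 0)) (.var Reg.x))))
  (.for Reg.a .k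
    (.seq (.set Reg.best (.const 0))
    (.seq (.for Reg.x .n
      (.cond (.realLe (.read Reg.gap (.var Reg.best)) (.read Reg.gap (.var Reg.x)))
        (.set Reg.best (.var Reg.x)) .skip))
    (.seq (.setNat Reg.far (.add (.var Reg.a) (.const 1)) (.var Reg.best))
    (.for Reg.x .n
      (.cond (.realLe (.read Reg.gap (.var Reg.x)) (.d (.var Reg.best) (.var Reg.x))) .skip
        (.setReal Reg.gap (.var Reg.x) (.d (.var Reg.best) (.var Reg.x)))))))))

/-- The running time of `Program.farthest`. -/
def farthestTime (n k : ℕ) : ℕ :=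
  forTime .n n 20 + forTime .k k (3 + (forTime .n n 30 + (10 + forTime .n n 40)))

theorem ens_farthest {D : Data} {s : State} (hn : 0 < D.n) (hE : Env D s)
    (h0 : s.nat Reg.far 0 = 0) :
    Ens .farthest s (farthestTime D.n D.k) fun s' =>
      D.Spread (s'.nat Reg.far) D.k (s'.real Reg.gap) := by
  unfold Program.farthest farthestTime
  refine Ens.seq ((ens_for D.n 20 (fun j s' => ∀ x < j, s'.real Reg.gap x = D.d 0 x) (by decide)
    ?_ ?_ (by simp) ?_).imp ?_)
  · intro s' hF
    have hE' : Env D s' := hE.frame hF (by decide) (by decide)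
    rw [NatExpr.n, NatExpr.eval, NatExpr.eval, hE'.n]
  · intro j s' x h; simpa using h
  · intro j hj s' hF hsj hI
    have hE' : Env D s' := hE.frame hF (by decide) (by decide)
    have hf : s'.nat Reg.far 0 = 0 := by rw [hF.nat _ (by decide), h0]
    refine Ens.flat_le ?_ trivial (by decide)
    have hex : (Program.setReal Reg.gap (.var Reg.x)
        (.d (.read Reg.far (.const 0)) (.var Reg.x))).exec s' = s'.putReal Reg.gap j (D.d 0 j) := by
      rw [← hE'.d 0 hn j hj]
      simp only [Program.exec, RealExpr.eval, NatExpr.eval, hsj, hf]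
      rfl
    intro x hx
    rw [hex, State.putReal_real, if_pos rfl]
    rcases Nat.lt_succ_iff_lt_or_eq.1 hx with hx | rfl
    · rw [Function.update_of_ne hx.ne, hI x hx]
    · rw [Function.update_self]
  intro s1 hF1 hI1
  have hE1 : Env D s1 := hE.frame hF1 (by decide) (by decide)
  have hf1 : s1.nat Reg.far 0 = 0 := by rw [hF1.nat _ (by decide), h0]
  refine ens_for D.k _ (fun j s' => D.Spread (s'.nat Reg.far) j (s'.real Reg.gap)) (by decide)
    ?_ ?_ ?_ ?_
  · intro s' hF
    have hE' : Env D s' := hE1.frame hF (by decide) (by decide)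
    rw [NatExpr.k, NatExpr.eval, NatExpr.eval, hE'.k]
  · intro j s' x h; simpa using h
  · refine ⟨fun b hb => ?_, fun x hx => ⟨0, le_rfl, ?_⟩, fun b hb x hx => ?_,
      fun b c hbc hc => by omega⟩
    · obtain rfl : b = 0 := by omega
      rw [hf1]; exact hn
    · rw [hf1, hI1 x hx]
    · obtain rfl : b = 0 := by omega
      rw [hf1, hI1 x hx]
  · intro j hj s2 hF2 hsj hI2
    have hE2 : Env D s2 := hE1.frame hF2 (by decide) (by decide)
    refine Ens.seq (Ens.flat_le (p := .set Reg.best (.const 0)) ?_ trivial (by decide))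
    simp only [Program.exec, NatExpr.eval]
    have hF3 : Frame (.set Reg.best (.const 0)) s2 (s2.putNat Reg.best 0 0) :=
      Frame.of_putNat (by decide)
    have hb3 : (s2.putNat Reg.best 0 0).nat Reg.best 0 = 0 := by simp
    set s3 := s2.putNat Reg.best 0 0
    clear_value s3
    have hE3 : Env D s3 := hE2.frame hF3 (by decide) (by decide)
    refine Ens.seq ((ens_for D.n 30 (fun x s' => s'.nat Reg.best 0 < D.n ∧
      ∀ y < x, s2.real Reg.gap y ≤ s2.real Reg.gap (s'.nat Reg.best 0)) (by decide)
      ?_ ?_ ?_ ?_).imp ?_)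
    · intro s' hF
      have hE' : Env D s' := hE3.frame hF (by decide) (by decide)
      rw [NatExpr.n, NatExpr.eval, NatExpr.eval, hE'.n]
    · intro j s' x h; simpa using h
    · exact ⟨by rw [hb3]; exact hn, by simp⟩
    · rintro x hx s4 hF4 hsx ⟨h1, h2⟩
      have hg4 : s4.real Reg.gap = s2.real Reg.gap := by
        rw [hF4.real _ (by decide), hF3.real _ (by decide)]
      refine Ens.flat_le ?_ ⟨trivial, trivial⟩ (by decide)
      have htest : (Test.realLe (.read Reg.gap (.var Reg.best))
          (.read Reg.gap (.var Reg.x))).Holds s4 ↔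
          s2.real Reg.gap (s4.nat Reg.best 0) ≤ s2.real Reg.gap x := by
        simp only [Test.Holds, RealExpr.eval, NatExpr.eval, hg4, hsx]
      rw [Program.exec]
      by_cases hle : s2.real Reg.gap (s4.nat Reg.best 0) ≤ s2.real Reg.gap x
      · rw [if_pos (htest.2 hle)]
        have hb : ((Program.set Reg.best (.var Reg.x)).exec s4).nat Reg.best 0 = x := by
          simp only [Program.exec, NatExpr.eval, hsx]
          rw [State.putNat_nat, if_pos rfl, Function.update_self]
        rw [hb]
        refine ⟨hx, fun y hy => ?_⟩
        rcases Nat.lt_succ_iff_lt_or_eq.1 hy with hy | rfl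
        · exact (h2 y hy).trans hle
        · exact le_rfl
      · rw [if_neg fun h => hle (htest.1 h), Program.exec]
        refine ⟨h1, fun y hy => ?_⟩
        rcases Nat.lt_succ_iff_lt_or_eq.1 hy with hy | rfl
        · exact h2 y hy
        · exact (not_le.1 hle).le
    rintro s4 hF4 ⟨hz, hmax⟩
    have hE4 : Env D s4 := hE3.frame hF4 (by decide) (by decide)
    have hg4 : s4.real Reg.gap = s2.real Reg.gap := by
      rw [hF4.real _ (by decide), hF3.real _ (by decide)]
    have hf4 : s4.nat Reg.far = s2.nat Reg.far := by
      rw [hF4.nat _ (by decide), hF3.nat _ (by decide)]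
    have ha4 : s4.nat Reg.a 0 = j := by
      rw [hF4.nat _ (by decide), hF3.nat _ (by decide), hsj]
    set z := s4.nat Reg.best 0 with hzdef
    refine Ens.seq (Ens.flat_le (p := .setNat Reg.far (.add (.var Reg.a) (.const 1))
      (.var Reg.best)) ?_ trivial (by decide))
    have hex : (Program.setNat Reg.far (.add (.var Reg.a) (.const 1)) (.var Reg.best)).exec s4 =
        s4.putNat Reg.far (j + 1) z := by
      simp only [Program.exec, NatExpr.eval, ha4, hzdef]
    rw [hex]
    have hF5 : Frame (.setNat Reg.far (.const 0) (.const 0)) s4 (s4.putNat Reg.far (j + 1) z) :=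
      Frame.of_putNat (by decide)
    have hf5 : (s4.putNat Reg.far (j + 1) z).nat Reg.far =
        Function.update (s2.nat Reg.far) (j + 1) z := by rw [← hf4]; simp
    set s5 := s4.putNat Reg.far (j + 1) z
    clear_value s5
    have hE5 : Env D s5 := hE4.frame hF5 (by decide) (by decide)
    have hz5 : s5.nat Reg.best 0 = z := by rw [hF5.nat _ (by decide)]
    have hg5 : s5.real Reg.gap = s2.real Reg.gap := by rw [hF5.real _ (by decide), hg4]
    refine (ens_for D.n 40 (fun x s' =>
      (∀ y < x, s'.real Reg.gap y = min (s2.real Reg.gap y) (D.d z y)) ∧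
      ∀ y, x ≤ y → s'.real Reg.gap y = s2.real Reg.gap y) (by decide) ?_ ?_ ?_ ?_).imp ?_
    · intro s' hF
      have hE' : Env D s' := hE5.frame hF (by decide) (by decide)
      rw [NatExpr.n, NatExpr.eval, NatExpr.eval, hE'.n]
    · intro j s' x h; simpa using h
    · exact ⟨by simp, fun y _ => by rw [hg5]⟩
    · rintro x hx s6 hF6 hsx ⟨h1, h2⟩
      have hE6 : Env D s6 := hE5.frame hF6 (by decide) (by decide)
      have hz6 : s6.nat Reg.best 0 = z := by rw [hF6.nat _ (by decide), hz5]
      refine Ens.flat_le ?_ ⟨trivial, trivial⟩ (by decide)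
      have hd : (RealExpr.d (.var Reg.best) (.var Reg.x)).eval s6 = D.d z x := by
        rw [← hE6.d z hz x hx]
        simp only [RealExpr.eval, NatExpr.eval, hz6, hsx]
        rfl
      have htest : (Test.realLe (.read Reg.gap (.var Reg.x))
          (.d (.var Reg.best) (.var Reg.x))).Holds s6 ↔ s2.real Reg.gap x ≤ D.d z x := by
        rw [Test.Holds, hd]
        simp only [RealExpr.eval, NatExpr.eval, hsx, h2 x le_rfl]
      rw [Program.exec]
      by_cases hle : s2.real Reg.gap x ≤ D.d z x
      · rw [if_pos (htest.2 hle), Program.exec]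
        refine ⟨fun y hy => ?_, fun y hy => h2 y (by omega)⟩
        rcases Nat.lt_succ_iff_lt_or_eq.1 hy with hy | rfl
        · exact h1 y hy
        · rw [min_eq_left hle, h2 y le_rfl]
      · rw [if_neg fun h => hle (htest.1 h)]
        have hg : ((Program.setReal Reg.gap (.var Reg.x)
            (.d (.var Reg.best) (.var Reg.x))).exec s6).real Reg.gap =
            Function.update (s6.real Reg.gap) x (D.d z x) := by
          rw [Program.exec, hd, State.putReal_real, if_pos rfl]
          simp only [NatExpr.eval, hsx]
        rw [hg]
        refine ⟨fun y hy => ?_, fun y hy => ?_⟩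
        · rcases Nat.lt_succ_iff_lt_or_eq.1 hy with hy | rfl
          · rw [Function.update_of_ne hy.ne, h1 y hy]
          · rw [Function.update_self, min_eq_right (not_le.1 hle).le]
        · rw [Function.update_of_ne (by omega), h2 y (by omega)]
    · rintro s6 hF6 ⟨h1, -⟩
      rw [hF6.nat _ (by decide), hf5]
      exact hI2.step hz hmax h1

/-- Sixteen times a natural number. -/
def NatExpr.times16 (e : NatExpr) : NatExpr :=
  .add (.add (.add (.add e e) (.add e e)) (.add (.add e e) (.add e e)))
    (.add (.add (.add e e) (.add e e)) (.add (.add e e) (.add e e)))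

theorem NatExpr.eval_times16 (s : State) (e : NatExpr) : e.times16.eval s = 16 * e.eval s := by
  simp only [NatExpr.times16, NatExpr.eval]; ring

/-- Compute the parameters of the search. -/
def Program.params : Program :=
  .seq (.set Reg.pow (.const 1))
  (.seq (.set Reg.expo (.const 0))
  (.seq (.for Reg.j (.times16 .k) (.cond (.natLe (.times16 .k) (.var Reg.pow)) .skip
    (.seq (.set Reg.pow (.add (.var Reg.pow) (.var Reg.pow)))
      (.set Reg.expo (.add (.var Reg.expo) (.const 1))))))
  (.seq (.set Reg.base (.add (.add (.var Reg.pow) (.var Reg.pow)) (.const 1)))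
  (.seq (.set Reg.len .k)
  (.seq (.for Reg.e .rounds (.set Reg.len (.add (.var Reg.len) (.add (.add .k .k) (.const 2)))))
  (.seq (.set Reg.guesses (.const 1))
  (.for Reg.i (.var Reg.len)
    (.seq (.set Reg.acc (.const 0))
    (.seq (.for Reg.j (.var Reg.base) (.set Reg.acc (.add (.var Reg.acc) (.var Reg.guesses))))
      (.set Reg.guesses (.var Reg.acc)))))))))))

/-- The running time of `Program.params`. -/
def paramsTime (k B L : ℕ) : ℕ :=
  3 + (3 + (forTime (.times16 .k) (16 * k) 150 + (10 + (4 + (forTime .rounds (2 * k + 1) 20 +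
    (3 + forTime (.var Reg.len) L (3 + (forTime (.var Reg.base) B 20 + 5))))))))

theorem forTime_mono (m : NatExpr) {M M' T T' : ℕ} (hM : M ≤ M') (hT : T ≤ T') :
    forTime m M T ≤ forTime m M' T' := by
  unfold forTime
  gcongr

/-- Doubling stops at the first power of two that reaches `16 * k`, which keeps the base of the
digits linear in `k`. The number of guesses is a power of the base, computed by repeated addition.
-/
theorem ens_params {D : Data} {s : State} (hk : s.nat Reg.size 1 = D.k) :
    Ens .params s (paramsTime D.k (64 * D.k + 3) (D.k + (2 * D.k + 1) * (2 * D.k + 2))) fun s' =>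
      ∃ H, 16 * D.k ≤ 2 ^ H ∧ 2 ^ H ≤ 32 * D.k + 1 ∧ Params D H (2 * 2 ^ H + 1) s' := by
  set k := D.k with hkdef
  have hmain : ∀ s', s'.nat Reg.size = s.nat Reg.size → NatExpr.k.eval s' = k := by
    intro s' h
    rw [NatExpr.eval, NatExpr.eval, h, hk]
  unfold Program.params paramsTime
  refine Ens.seq (Ens.flat_le (p := .set Reg.pow (.const 1)) ?_ trivial (by decide))
  refine Ens.seq (Ens.flat_le (p := .set Reg.expo (.const 0)) ?_ trivial (by decide))
  simp only [Program.exec, NatExpr.eval]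
  have hF0 : Frame .params s ((s.putNat Reg.pow 0 1).putNat Reg.expo 0 0) :=
    (Frame.of_putNat (by decide)).trans (Frame.of_putNat (by decide))
  have hp0 : ((s.putNat Reg.pow 0 1).putNat Reg.expo 0 0).nat Reg.pow 0 = 1 := by simp
  have he0 : ((s.putNat Reg.pow 0 1).putNat Reg.expo 0 0).nat Reg.expo 0 = 0 := by simp
  set s0 := (s.putNat Reg.pow 0 1).putNat Reg.expo 0 0
  clear_value s0
  -- Each doubling increases the power by at least one, so `16 * k` iterations reach the target;
  -- afterwards the body does nothing.
  refine Ens.seq ((ens_for (16 * k) 150 (fun j s' =>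
    s'.nat Reg.pow 0 = 2 ^ s'.nat Reg.expo 0 ∧ s'.nat Reg.pow 0 ≤ 32 * k + 1 ∧
    (16 * k ≤ s'.nat Reg.pow 0 ∨ j + 1 ≤ s'.nat Reg.pow 0)) (by decide) ?_ ?_ ?_ ?_).imp ?_)
  · intro s' hF
    rw [NatExpr.eval_times16, hmain]
    rw [hF.nat _ (by decide), hF0.nat _ (by decide)]
  · intro j s' x h; simpa using h
  · rw [hp0, he0]; simp
  · rintro j hj s1 hF1 hsj ⟨h1, h2, h3⟩
    have hk1 : NatExpr.k.times16.eval s1 = 16 * k := by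
      rw [NatExpr.eval_times16, hmain]
      rw [hF1.nat _ (by decide), hF0.nat _ (by decide)]
    refine Ens.flat_le ?_ ⟨trivial, trivial, trivial⟩ (by decide)
    have htest : (Test.natLe (.times16 .k) (.var Reg.pow)).Holds s1 ↔
        16 * k ≤ s1.nat Reg.pow 0 := by
      rw [Test.Holds, hk1]; rfl
    rw [Program.exec]
    by_cases hle : 16 * k ≤ s1.nat Reg.pow 0
    · rw [if_pos (htest.2 hle), Program.exec]
      exact ⟨h1, h2, .inl hle⟩
    · rw [if_neg fun h => hle (htest.1 h)]
      have hex : Program.exec (.seq (.set Reg.pow (.add (.var Reg.pow) (.var Reg.pow)))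
          (.set Reg.expo (.add (.var Reg.expo) (.const 1)))) s1 =
          (s1.putNat Reg.pow 0 (s1.nat Reg.pow 0 + s1.nat Reg.pow 0)).putNat Reg.expo 0
            (s1.nat Reg.expo 0 + 1) := by
        simp [Program.exec, NatExpr.eval]
      have hp : (Program.exec (.seq (.set Reg.pow (.add (.var Reg.pow) (.var Reg.pow)))
          (.set Reg.expo (.add (.var Reg.expo) (.const 1)))) s1).nat Reg.pow 0 =
            s1.nat Reg.pow 0 + s1.nat Reg.pow 0 := by rw [hex]; simp
      have he : (Program.exec (.seq (.set Reg.pow (.add (.var Reg.pow) (.var Reg.pow)))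
          (.set Reg.expo (.add (.var Reg.expo) (.const 1)))) s1).nat Reg.expo 0 =
            s1.nat Reg.expo 0 + 1 := by rw [hex]; simp
      rw [hp, he]
      refine ⟨by rw [h1, pow_succ]; ring, by omega, .inr ?_⟩
      have := h3.resolve_left hle
      omega
  rintro s1 hF1 ⟨h1, h2, h3⟩
  have hF1s : Frame .params s s1 := hF0.trans (hF1.mono (by decide) (by decide))
  set H := s1.nat Reg.expo 0 with hH
  set L := k + (2 * k + 1) * (2 * k + 2) with hL
  rw [h1] at h2 h3
  have hB : 2 * 2 ^ H + 1 ≤ 64 * k + 3 := by omega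
  set B := 2 * 2 ^ H + 1 with hBdef
  refine Ens.seq (Ens.flat_le (p := .set Reg.base (.add (.add (.var Reg.pow) (.var Reg.pow))
    (.const 1))) ?_ trivial (by decide))
  refine Ens.seq (Ens.flat_le (p := .set Reg.len .k) ?_ trivial (by decide))
  have hex : (Program.set Reg.len .k).exec ((Program.set Reg.base
      (.add (.add (.var Reg.pow) (.var Reg.pow)) (.const 1))).exec s1) =
      (s1.putNat Reg.base 0 B).putNat Reg.len 0 k := by
    have hk1 : NatExpr.k.eval (s1.putNat Reg.base 0 B) = k := by
      refine hmain _ ?_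
      rw [← hF1s.nat Reg.size (by decide)]; simp
    have hb : (Program.set Reg.base
      (.add (.add (.var Reg.pow) (.var Reg.pow)) (.const 1))).exec s1 = s1.putNat Reg.base 0 B := by
      simp only [Program.exec, NatExpr.eval, h1, hBdef, two_mul]
    rw [hb, Program.exec, hk1, NatExpr.eval]
  rw [hex]
  have hF2 : Frame .params s ((s1.putNat Reg.base 0 B).putNat Reg.len 0 k) :=
    hF1s.trans ((Frame.of_putNat (by decide)).trans (Frame.of_putNat (by decide)))
  have hb2 : ((s1.putNat Reg.base 0 B).putNat Reg.len 0 k).nat Reg.base 0 = B := by simp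
  have hl2 : ((s1.putNat Reg.base 0 B).putNat Reg.len 0 k).nat Reg.len 0 = k := by simp
  have he2 : ((s1.putNat Reg.base 0 B).putNat Reg.len 0 k).nat Reg.expo 0 = H := by simp [hH]
  set s2 := (s1.putNat Reg.base 0 B).putNat Reg.len 0 k
  clear_value s2
  refine Ens.seq ((ens_for (2 * k + 1) 20 (fun j s' =>
    s'.nat Reg.len 0 = k + j * (2 * k + 2)) (by decide) ?_ ?_ ?_ ?_).imp ?_)
  · intro s' hF
    have hk' := hmain s' (by rw [hF.nat _ (by decide), hF2.nat _ (by decide)])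
    simp only [NatExpr.eval] at hk' ⊢
    rw [hk']; ring
  · intro j s' x h; simpa using h
  · rw [hl2]; simp
  · intro j hj s' hF hsj hI
    refine Ens.flat_le ?_ trivial (by decide)
    have hk' := hmain s' (by rw [hF.nat _ (by decide), hF2.nat _ (by decide)])
    have hv : (NatExpr.add (.var Reg.len) (.add (.add .k .k) (.const 2))).eval s' =
        k + (j + 1) * (2 * k + 2) := by
      simp only [NatExpr.eval] at hk' ⊢
      rw [hI, hk']; ring
    rw [Program.exec, hv]
    simp [NatExpr.eval]
  intro s3 hF3 hl3
  rw [← hL] at hl3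
  have hb3 : s3.nat Reg.base 0 = B := by rw [hF3.nat _ (by decide), hb2]
  have he3 : s3.nat Reg.expo 0 = H := by rw [hF3.nat _ (by decide), he2]
  refine Ens.seq (Ens.flat_le (p := .set Reg.guesses (.const 1)) ?_ trivial (by decide))
  simp only [Program.exec, NatExpr.eval]
  have hF4 : Frame (.set Reg.guesses (.const 1)) s3 (s3.putNat Reg.guesses 0 1) :=
    Frame.of_putNat (by decide)
  have hg4 : (s3.putNat Reg.guesses 0 1).nat Reg.guesses 0 = 1 := by simp
  set s4 := s3.putNat Reg.guesses 0 1
  clear_value s4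
  refine ((ens_for L (3 + (forTime (.var Reg.base) B 20 + 5)) (fun i s' =>
    s'.nat Reg.guesses 0 = B ^ i) (by decide) ?_ ?_ ?_ ?_).imp ?_).mono
    (forTime_mono _ le_rfl (by
      have := forTime_mono (.var Reg.base) hB (le_refl 20)
      omega)) fun _ h => h
  · intro s' hF
    rw [NatExpr.eval, NatExpr.eval, hF.nat _ (by decide), hF4.nat _ (by decide), hl3]
  · intro j s' x h; simpa using h
  · rw [hg4]; simp
  · intro i hi s5 hF5 hsi hI
    refine Ens.seq (Ens.flat_le (p := .set Reg.acc (.const 0)) ?_ trivial (by decide))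
    simp only [Program.exec, NatExpr.eval]
    refine Ens.seq ((ens_for B 20 (fun j s' => s'.nat Reg.acc 0 = j * B ^ i) (by decide) ?_ ?_ ?_
      ?_).imp ?_)
    · intro s' hF
      rw [NatExpr.eval, NatExpr.eval, hF.nat _ (by decide), ← hb3, ← hF4.nat _ (by decide),
        ← hF5.nat _ (by decide)]
      simp
    · intro j s' x h; simpa using h
    · simp
    · intro j hj s' hF hsj hI'
      refine Ens.flat_le ?_ trivial (by decide)
      have hg' : s'.nat Reg.guesses 0 = B ^ i := by
        rw [hF.nat _ (by decide), ← hI]; simp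
      simp only [Program.exec, NatExpr.eval, hI', hg']
      rw [State.putNat_nat, if_pos rfl, Function.update_self]
      ring
    · intro s6 hF6 ha6
      refine Ens.flat_le ?_ trivial (by decide)
      simp only [Program.exec, NatExpr.eval, ha6]
      rw [State.putNat_nat, if_pos rfl, Function.update_self, pow_succ]
      ring
  · intro s5 hF5 hg5
    refine ⟨H, by omega, h2, ?_, ?_, ?_, hg5⟩
    · rw [hF5.nat _ (by decide), hF4.nat _ (by decide), he3]
    · rw [hF5.nat _ (by decide), hF4.nat _ (by decide), hb3]
    · rw [hF5.nat _ (by decide), hF4.nat _ (by decide), hl3]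

/-! ### The whole algorithm -/

/-- The algorithm. -/
def Program.main : Program := .seq .layout (.seq .farthest (.seq .params .tryAll))

/-- The number of digits of a guess. -/
def guessLength (k : ℕ) : ℕ := k + (2 * k + 1) * (2 * k + 2)

/-- The running time of the algorithm. -/
def mainTime (n k : ℕ) : ℕ :=
  layoutTime n k + (farthestTime n k + (paramsTime k (64 * k + 3) (guessLength k) +
    tryAllTime n k (32 * k + 1) (64 * k + 3) (guessLength k)))

theorem tryAllTime_mono (n k L : ℕ) {H H' B B' : ℕ} (hH : H ≤ H') (hB : B ≤ B') :
    tryAllTime n k H B L ≤ tryAllTime n k H' B' L := by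
  unfold tryAllTime
  refine forTime_mono _ le_rfl (forTime_mono _ le_rfl (Nat.add_le_add ?_ ?_))
  · unfold scaleTime
    have h1 := forTime_mono (.var Reg.expo) hH (le_refl 10)
    have h2 := forTime_mono (.var Reg.base) hB (le_refl 20)
    omega
  · exact forTime_mono _ (Nat.pow_le_pow_left hB L) le_rfl

section

variable {n : ℕ} {X : Type*} [MetricSpace X] {P : Fin n ↪ X} {k : ℕ} {η : Fin n → ℕ}

/-- All working arrays are zero initially, which gives a ready memory for the first guess. The
actual exponent and base are only known up to the rounding to a power of two, so the time bound uses
their upper bounds. -/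
theorem ens_main (hn : 0 < n) :
    Ens .main (input P k η) (mainTime n k) fun s => OutputOk (dataOf P k η) s ∧
      ∀ S : Solution n, S.Feasible P k η → Found s (15 * S.cost) := by
  set D := dataOf P k η with hD
  have hDn : D.n = n := rfl
  have hDk : D.k = k := rfl
  set s0 := input P k η with hs0
  have hz : ∀ a, 2 ≤ a → ∀ m, s0.nat a m = 0 := by
    intro a ha m
    have h1 : a ≠ 0 := by omega
    have h2 : a ≠ 1 := by omega
    simp [hs0, input, h1, h2]
  unfold mainTime
  refine Ens.seq ((ens_layout (n := n) (k := k) (by simp [hs0, input]) (by simp [hs0, input])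
    (hz _ (by decide) _)).imp ?_)
  rintro s1 hF1 ⟨hrow, hsub⟩
  have hE1 : Env D s1 := by
    refine ⟨?_, ?_, fun i hi j hj => ?_, fun i hi => ?_, hsub⟩
    · rw [hF1.nat _ (by decide)]; simp [hs0, input, hDn]
    · rw [hF1.nat _ (by decide)]; simp [hs0, input, hDk]
    · rw [State.d, hrow i (hDn ▸ hi.le), hF1.real _ (by decide)]; rfl
    · rw [hF1.nat _ (by decide)]; rfl
  refine Ens.seq ((ens_farthest (D := D) hn hE1 ?_).imp ?_)
  · rw [hF1.nat _ (by decide)]; exact hz _ (by decide) _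
  rintro s2 hF2 hsp
  have hE2 : Env D s2 := hE1.frame hF2 (by decide) (by decide)
  refine Ens.seq ((ens_params (D := D) hE2.k).imp ?_)
  rintro s3 hF3 ⟨H, hH, hH', hP⟩
  have hE3 : Env D s3 := hE2.frame hF3 (by decide) (by decide)
  have hfar : s3.nat Reg.far = s2.nat Reg.far := hF3.nat _ (by decide)
  have hzero : ∀ a, 2 ≤ a → a ∉ Program.layout.natWrites → a ∉ Program.farthest.natWrites →
      a ∉ Program.params.natWrites → ∀ m, s3.nat a m = 0 := by
    intro a ha h1 h2 h3 m
    rw [hF3.nat _ h3, hF2.nat _ h2, hF1.nat _ h1, hz a ha]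
  have hR : Ready D (guessLength k) s3 := by
    refine ⟨fun j => ?_, fun i _ => ?_, fun i _ => ?_, .inl ?_⟩
    · rw [hzero _ (by decide) (by decide) (by decide) (by decide)]; exact hn
    · exact hzero _ (by decide) (by decide) (by decide) (by decide) _
    · exact hzero _ (by decide) (by decide) (by decide) (by decide) _
    · exact hzero _ (by decide) (by decide) (by decide) (by decide) _
  refine (ens_tryAll hn dataOf_isMetric hE3 rfl (by omega) hP hR hfar hsp.1).mono
    (tryAllTime_mono _ _ _ ?_ ?_) ?_
  · exact (Nat.lt_two_pow_self).le.trans hH'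
  · have : 2 ^ H ≤ 32 * k + 1 := hH'
    omega
  · rintro s4 ⟨h1, h2⟩
    refine ⟨h1, fun S hS => ?_⟩
    obtain ⟨j, hj, x, hx, g, hg, hG, hcost⟩ := hS.exists_good hn hsp hH
    have := h2 j hj x hx g (fun i => Nat.lt_succ_of_le (hg i)) hG
    exact ⟨this.1, this.2.trans hcost⟩

theorem Announces.exists_solution {s : State} {ce f r : ℕ → ℕ}
    (h : Announces (dataOf P k η) s ce f r) (hflag : s.nat Reg.flag 0 = 1) :
    ∃ S : Solution n, Returns s S ∧ S.Feasible P k η ∧ (S.cost : ℝ) = s.real Reg.outCost 0 := by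
  classical
  have hlt : ∀ l < k, ce l < n := h.center_lt
  have hmap : ∀ p < n, f p < k := h.map_lt
  have hout : ∀ i : Fin n, s.nat Reg.outAssign i = ce (f i) := fun i => h.outAssign i i.2
  let cf : Fin k → Fin n := fun l => ⟨ce l, hlt l l.2⟩
  have hcf : Function.Injective cf := fun a b hab =>
    Fin.ext (h.inj a.2 b.2 (congrArg Fin.val hab))
  -- At a center the real cell holds a natural number, which the floor recovers; the values
  -- elsewhere play no role.
  let S : Solution n :=
    { centers := Finset.univ.image cf
      radius := fun i => ⌊s.real Reg.outRadius i⌋₊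
      assign := fun i => cf ⟨f i, hmap i i.2⟩ }
  have hrad : ∀ l : Fin k, S.radius (cf l) = r l := by
    intro l
    change ⌊s.real Reg.outRadius (ce l)⌋₊ = r l
    rw [h.outRadius l l.2, Nat.floor_natCast]
  refine ⟨S, ⟨hflag, fun i => ?_, fun i hi => ?_, fun i => hout i⟩, ⟨?_, fun i => ?_, fun i => ?_,
    fun q hq => ?_⟩, ?_⟩
  · refine Iff.trans ?_ (h.outCenter i i.2).symm
    simp only [S, Finset.mem_image, Finset.mem_univ, true_and]
    constructor
    · rintro ⟨l, rfl⟩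
      exact ⟨l, l.2, rfl⟩
    · rintro ⟨l, hl, he⟩
      exact ⟨⟨l, hl⟩, Fin.ext he⟩
  · obtain ⟨l, -, rfl⟩ := Finset.mem_image.1 hi
    rw [hrad l]
    exact h.outRadius l l.2
  · simp only [S]
    rw [Finset.card_image_of_injective _ hcf, Finset.card_univ, Fintype.card_fin]
  · exact Finset.mem_image_of_mem _ (Finset.mem_univ _)
  · have h1 := h.dist_le i i.2
    rw [dataOf_d i.2 (hlt _ (hmap i i.2))] at h1
    rw [hrad]
    exact h1
  · obtain ⟨l, -, rfl⟩ := Finset.mem_image.1 hq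
    have h1 := h.capacity l l.2
    rw [dataOf_η (hlt l l.2)] at h1
    refine le_trans (le_of_eq ?_) h1
    change _ = countBelow (fun p => f p = l) n
    rw [countBelow_eq_card_fin]
    congr 1
    ext i
    simp only [Finset.mem_filter, Finset.mem_univ, true_and]
    change cf _ = cf l ↔ _
    rw [hcf.eq_iff, Fin.ext_iff]
  · rw [h.outCost, Solution.cost]
    simp only [S]
    rw [Finset.sum_image fun a _ b _ hab => hcf hab]
    push_cast
    refine Eq.trans ?_ (Fin.sum_univ_eq_sum_range (fun l => (r l : ℝ)) k)
    exact Finset.sum_congr rfl fun l _ => by rw [← hrad l]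

end

theorem exists_output {n k : ℕ} {X : Type*} [MetricSpace X] (P : Fin n ↪ X) (η : Fin n → ℕ)
    (hn : 0 < n) :
    ∃ t s, Runs .main (input P k η) t s ∧ t ≤ mainTime n k ∧
      ((∃ S : Solution n, Returns s S ∧ S.Feasible P k η ∧
          ∀ S' : Solution n, S'.Feasible P k η → (S.cost : ℝ) ≤ 15 * S'.cost) ∨
        (ReportsInfeasible s ∧ ∀ S : Solution n, ¬ S.Feasible P k η)) := by
  obtain ⟨t, s, hr, ht, hO, hC⟩ := ens_main (P := P) (k := k) (η := η) hn
  refine ⟨t, s, hr, ht, ?_⟩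
  rcases hO with h0 | ⟨h1, ce, f, r, h⟩
  -- A feasible solution would have led to a recorded output, so an empty output proves that there
  -- is none.
  · refine .inr ⟨h0, fun S hS => ?_⟩
    have := (hC S hS).1
    omega
  · obtain ⟨S, hS1, hS2, hS3⟩ := h.exists_solution h1
    exact .inl ⟨S, hS1, hS2, fun S' hS' => by rw [hS3]; exact (hC S' hS').2⟩

end CSR

namespace CSR

/-! ### The running time -/

/-- The running times are bounded by monomials in these four quantities. -/
def weight (a b c e n k : ℕ) : ℕ :=
  n ^ a * (k + 1) ^ b * (2 ^ k) ^ c * ((64 * k + 3) ^ guessLength k) ^ e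

/-- The function `f` is bounded by a multiple of a weight. -/
def Dom (a b c e : ℕ) (f : ℕ → ℕ → ℕ) : Prop :=
  ∃ C, ∀ n k, 0 < n → f n k ≤ C * weight a b c e n k

theorem Dom.const (C : ℕ) : Dom 0 0 0 0 fun _ _ => C := ⟨C, fun n k _ => by simp [weight]⟩

theorem Dom.mono {a b c e : ℕ} {f : ℕ → ℕ → ℕ} (h : Dom a b c e f) (a' b' c' e' : ℕ)
    (ha : a ≤ a' := by decide) (hb : b ≤ b' := by decide) (hc : c ≤ c' := by decide)
    (he : e ≤ e' := by decide) : Dom a' b' c' e' f := by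
  obtain ⟨C, hC⟩ := h
  refine ⟨C, fun n k hn => (hC n k hn).trans (Nat.mul_le_mul_left _ ?_)⟩
  unfold weight
  have h1 : 0 < (64 * k + 3) ^ guessLength k := by positivity
  have h2 : 0 < 2 ^ k := by positivity
  gcongr
  all_goals omega

theorem Dom.add {a b c e : ℕ} {f g : ℕ → ℕ → ℕ} (hf : Dom a b c e f) (hg : Dom a b c e g) :
    Dom a b c e fun n k => f n k + g n k := by
  obtain ⟨C, hC⟩ := hf
  obtain ⟨C', hC'⟩ := hg
  exact ⟨C + C', fun n k hn => by rw [add_mul]; exact Nat.add_le_add (hC n k hn) (hC' n k hn)⟩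

theorem Dom.add_const {a b c e : ℕ} {f : ℕ → ℕ → ℕ} (hf : Dom a b c e f) (C : ℕ) :
    Dom a b c e fun n k => f n k + C :=
  hf.add ((Dom.const C).mono _ _ _ _ (Nat.zero_le _) (Nat.zero_le _) (Nat.zero_le _)
    (Nat.zero_le _))

theorem Dom.const_add {a b c e : ℕ} {f : ℕ → ℕ → ℕ} (hf : Dom a b c e f) (C : ℕ) :
    Dom a b c e fun n k => C + f n k :=
  ((Dom.const C).mono _ _ _ _ (Nat.zero_le _) (Nat.zero_le _) (Nat.zero_le _)
    (Nat.zero_le _)).add hf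

theorem Dom.mul {a b c e a' b' c' e' : ℕ} {f g : ℕ → ℕ → ℕ} (hf : Dom a b c e f)
    (hg : Dom a' b' c' e' g) :
    Dom (a + a') (b + b') (c + c') (e + e') fun n k => f n k * g n k := by
  obtain ⟨C, hC⟩ := hf
  obtain ⟨C', hC'⟩ := hg
  refine ⟨C * C', fun n k hn => (Nat.mul_le_mul (hC n k hn) (hC' n k hn)).trans (le_of_eq ?_)⟩
  unfold weight
  ring

theorem Dom.forTime {a b c e a' b' c' e' : ℕ} {T M : ℕ → ℕ → ℕ} (hT : Dom a b c e T)
    (m : NatExpr) (hM : Dom a' b' c' e' M) :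
    Dom (a + a') (b + b') (c + c') (e + e') fun n k => CSR.forTime m (M n k) (T n k) := by
  unfold CSR.forTime
  exact (((hT.add_const _).add_const _).mul hM).add_const _

theorem Dom.countTime {a b c e a' b' c' e' : ℕ} {T M : ℕ → ℕ → ℕ} (hT : Dom a b c e T)
    (m : NatExpr) (t : Test) (hM : Dom a' b' c' e' M) :
    Dom (a + a') (b + b') (c + c') (e + e') fun n k => CSR.countTime m t (M n k) (T n k) := by
  unfold CSR.countTime
  exact ((hT.add_const _).forTime _ hM).const_add _

theorem dom_points : Dom 1 0 0 0 fun n _ => n := ⟨1, fun n k _ => by simp [weight]⟩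

theorem dom_clusters : Dom 0 1 0 0 fun _ k => k := ⟨1, fun n k _ => by simp [weight]⟩

theorem dom_subsets : Dom 0 0 1 0 fun _ k => 2 ^ k := ⟨1, fun n k _ => by simp [weight]⟩

theorem dom_guesses : Dom 0 0 0 1 fun _ k => (64 * k + 3) ^ guessLength k :=
  ⟨1, fun n k _ => by simp [weight]⟩

theorem dom_linear (A B : ℕ) : Dom 0 1 0 0 fun _ k => A * k + B :=
  ((Dom.const A).mul dom_clusters).add_const B

theorem dom_guessLength : Dom 0 2 0 0 fun _ k => guessLength k := by
  unfold guessLength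
  exact (dom_clusters.mono _ _ _ _).add ((dom_linear 2 1).mul (dom_linear 2 2))

theorem dom_incrementTime {m b : NatExpr} {a' b' c' e' : ℕ} {M : ℕ → ℕ → ℕ}
    (hM : Dom a' b' c' e' M) : Dom a' b' c' e' fun n k => incrementTime m b (M n k) := by
  unfold incrementTime
  have := ((Dom.const (b.time + 40)).forTime m hM).const_add 3
  simpa only [zero_add] using this

theorem dom_hallTime : Dom 1 1 1 0 hallTime := by
  unfold hallTime
  refine ((Dom.forTime (a := 1) (b := 1) (c := 0) (e := 0) ?_ _ dom_subsets).const_add 3)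
  refine (Dom.add ?_ (Dom.add ?_ ((dom_incrementTime dom_clusters).mono 1 1 0 0 |>.const_add
    20))).const_add 3
  · exact ((Dom.const 16).forTime _ dom_clusters).mono 1 1 0 0
  · exact (((Dom.const 1).countTime _ _ dom_clusters).countTime _ _ dom_points).mono 1 1 0 0

theorem dom_assignTime : Dom 2 2 1 0 assignTime := by
  unfold assignTime prepareTime serveTime recordTime
  refine Dom.add ?_ (Dom.add ?_ ?_)
  · exact ((((Dom.const 10).forTime _ dom_points).mono 2 2 1 0).add
      (((Dom.const 200).forTime _ dom_clusters).mono 2 2 1 0)).const_add 4 |>.const_add 3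
  · exact ((((dom_hallTime.add_const 120).forTime _ dom_clusters).add_const 10).const_add
      3).forTime _ dom_points
  · exact ((((Dom.const 20).forTime _ dom_points).mono 2 2 1 0).add
      (((Dom.const 20).forTime _ dom_clusters).mono 2 2 1 0)).const_add 40

theorem dom_roundTime : Dom 2 2 1 0 roundTime := by
  unfold roundTime chooseHitTime chooseFreeTime chooseTime
  refine Dom.add ?_ (Dom.add ?_ (dom_assignTime.add_const 60))
  · exact (((((((Dom.const 1).countTime _ _ dom_points).const_add 100).forTime _
      dom_points).const_add 30).forTime _ dom_clusters)).mono 2 2 1 0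
  · refine Dom.mono (a := 2) (b := 2) (c := 0) (e := 0) ?_ 2 2 1 0
    refine ((Dom.forTime (a := 1) (b := 1) (c := 0) (e := 0) ?_ _ dom_points).const_add 40).forTime
      _ dom_clusters
    exact (((Dom.const 1).countTime _ _ dom_clusters).mono 1 1 0 0).add
      ((((Dom.const 1).countTime _ _ dom_points).mono 1 1 0 0).add_const 60)

theorem dom_searchAllTime :
    Dom 2 3 1 1 fun n k => searchAllTime n k (64 * k + 3) (guessLength k) := by
  unfold searchAllTime searchTime
  refine Dom.forTime (a := 2) (b := 3) (c := 1) (e := 0) ?_ _ dom_guesses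
  refine Dom.add (Dom.add ?_ (Dom.const_add ?_ 4))
    ((dom_incrementTime dom_guessLength).mono 2 3 1 0)
  · exact ((Dom.const 25).forTime _ dom_clusters).mono 2 3 1 0
  · exact dom_roundTime.forTime _ (dom_linear 2 1)

/-- Two factors `n` come from a round, where each point is placed with tests that count all points,
and the third from the choice of the unit. The four factors `k + 1` are two from a round, one from
the number of rounds and one from the traversal points. -/
theorem dom_mainTime : Dom 3 4 1 1 mainTime := by
  unfold mainTime layoutTime farthestTime paramsTime tryAllTime scaleTime
  refine Dom.add ?_ (Dom.add ?_ (Dom.add ?_ ?_))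
  · exact (((Dom.const 20).forTime _ dom_points).mono 3 4 1 1).add
      ((((Dom.const 20).forTime _ dom_clusters).mono 3 4 1 1).const_add 3)
  · refine Dom.add (((Dom.const 20).forTime _ dom_points).mono 3 4 1 1) ?_
    exact ((((((Dom.const 30).forTime _ dom_points)).add
      (((Dom.const 40).forTime _ dom_points).const_add 10)).const_add 3).forTime _
        dom_clusters).mono 3 4 1 1
  · refine Dom.mono (a := 0) (b := 3) (c := 0) (e := 0) ?_ 3 4 1 1
    refine Dom.const_add (Dom.const_add (Dom.add ?_ (Dom.const_add (Dom.const_add (Dom.add ?_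
      (Dom.const_add ?_ 3)) 4) 10)) 3) 3
    · exact ((Dom.const 150).forTime _ (dom_linear 16 0)).mono 0 3 0 0
    · exact ((Dom.const 20).forTime _ (dom_linear 2 1)).mono 0 3 0 0
    · exact ((((Dom.const 20).forTime _ (dom_linear 64 3)).add_const 5).const_add 3).forTime _
        dom_guessLength
  · refine Dom.forTime (a := 3) (b := 3) (c := 1) (e := 1) ?_ _ (dom_linear 1 1 |> fun h => by
      simpa only [one_mul] using h)
    refine Dom.forTime (a := 2) (b := 3) (c := 1) (e := 1) ?_ _ dom_points
    refine Dom.add (Dom.const_add (Dom.add ?_ (Dom.const_add ?_ 10)) 20) dom_searchAllTime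
    · exact ((Dom.const 10).forTime _ (dom_linear 32 1)).mono 2 3 1 1
    · exact ((Dom.const 20).forTime _ (dom_linear 64 3)).mono 2 3 1 1

/-- For `k ≥ 2` each factor is a power of `k`: the polynomial, the number of subsets and the number
of guesses contribute the exponents `2 * k ^ 2`, `k ^ 2` and `64 * k ^ 2`. The last one uses `64 * k
+ 3 ≤ k ^ 8` and at most `8 * k ^ 2` digits. -/
theorem weight_le_pow {k : ℕ} (hk : 2 ≤ k) : weight 0 4 1 1 1 k ≤ k ^ (67 * k ^ 2) := by
  have hk2 : k ^ 2 = k * k := by ring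
  have h1 : (k + 1) ^ 4 ≤ k ^ (2 * k ^ 2) := by
    have h : k + 1 ≤ k ^ 2 := by rw [hk2]; nlinarith
    calc (k + 1) ^ 4 ≤ (k ^ 2) ^ 4 := Nat.pow_le_pow_left h 4
      _ = k ^ 8 := by ring
      _ ≤ k ^ (2 * k ^ 2) := Nat.pow_le_pow_right (by omega) (by rw [hk2]; nlinarith)
  have h2 : 2 ^ k ≤ k ^ (k ^ 2) :=
    (Nat.pow_le_pow_left hk k).trans
      (Nat.pow_le_pow_right (by omega) (by rw [hk2]; nlinarith))
  have h3 : (64 * k + 3) ^ guessLength k ≤ k ^ (64 * k ^ 2) := by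
    have h : 64 * k + 3 ≤ k ^ 8 := by
      have h7 : 2 ^ 7 ≤ k ^ 7 := Nat.pow_le_pow_left hk 7
      calc 64 * k + 3 ≤ 2 ^ 7 * k := by omega
        _ ≤ k ^ 7 * k := Nat.mul_le_mul_right _ h7
        _ = k ^ 8 := by ring
    have hL : guessLength k ≤ 8 * k ^ 2 := by
      unfold guessLength; nlinarith
    calc (64 * k + 3) ^ guessLength k ≤ (k ^ 8) ^ guessLength k := Nat.pow_le_pow_left h _
      _ = k ^ (8 * guessLength k) := by rw [← pow_mul]
      _ ≤ k ^ (64 * k ^ 2) := Nat.pow_le_pow_right (by omega) (by omega)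
  calc weight 0 4 1 1 1 k = (k + 1) ^ 4 * 2 ^ k * (64 * k + 3) ^ guessLength k := by
        simp [weight]
    _ ≤ k ^ (2 * k ^ 2) * k ^ (k ^ 2) * k ^ (64 * k ^ 2) :=
        Nat.mul_le_mul (Nat.mul_le_mul h1 h2) h3
    _ = k ^ (67 * k ^ 2) := by rw [← pow_add, ← pow_add]; congr 1; ring

theorem exists_time_bound : ∃ c : ℕ, ∀ n k, 0 < n →
    (mainTime n k : ℝ) ≤
      c * (2 : ℝ) ^ ((c : ℝ) * ((k : ℝ) ^ 2 * Real.logb 2 k)) * (n : ℝ) ^ 3 := by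
  obtain ⟨C, hC⟩ := dom_mainTime
  -- For `k = 0` and `k = 1` the exponent of the bound vanishes, so these two weights have to be
  -- absorbed by the constant.
  set M := weight 0 4 1 1 1 0 + weight 0 4 1 1 1 1 + 1 with hM
  refine ⟨C * M + 67, fun n k hn => ?_⟩
  have hw : weight 3 4 1 1 n k = weight 0 4 1 1 1 k * n ^ 3 := by unfold weight; ring
  have h1 : (mainTime n k : ℝ) ≤ C * weight 0 4 1 1 1 k * (n : ℝ) ^ 3 := by
    have := hC n k hn
    rw [hw, ← mul_assoc] at this
    exact_mod_cast this
  refine h1.trans (mul_le_mul_of_nonneg_right ?_ (by positivity))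
  have hMr : (1 : ℝ) ≤ M := by exact_mod_cast (by omega : 1 ≤ M)
  have hlog : (0 : ℝ) ≤ (k : ℝ) ^ 2 * Real.logb 2 k := by
    refine mul_nonneg (by positivity) ?_
    rcases Nat.eq_zero_or_pos k with rfl | hk
    · simp
    · exact Real.logb_nonneg (by norm_num) (by exact_mod_cast hk)
  have hone : (1 : ℝ) ≤ (2 : ℝ) ^ (((C * M + 67 : ℕ) : ℝ) * ((k : ℝ) ^ 2 * Real.logb 2 k)) :=
    Real.one_le_rpow (by norm_num) (mul_nonneg (Nat.cast_nonneg _) hlog)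
  rcases Nat.lt_or_ge k 2 with hk | hk
  · have h2 : weight 0 4 1 1 1 k ≤ M := by
      interval_cases k <;> omega
    have h3 : (C * weight 0 4 1 1 1 k : ℝ) ≤ ((C * M + 67 : ℕ) : ℝ) := by
      have : C * weight 0 4 1 1 1 k ≤ C * M + 67 :=
        (Nat.mul_le_mul_left C h2).trans (Nat.le_add_right _ _)
      exact_mod_cast this
    exact h3.trans (le_mul_of_one_le_right (Nat.cast_nonneg _) hone)
  · have h2 : (weight 0 4 1 1 1 k : ℝ) ≤
        (2 : ℝ) ^ (((C * M + 67 : ℕ) : ℝ) * ((k : ℝ) ^ 2 * Real.logb 2 k)) := by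
      have hk0 : (0 : ℝ) < k := by exact_mod_cast (by omega : 0 < k)
      have h3 : (weight 0 4 1 1 1 k : ℝ) ≤ (k : ℝ) ^ (67 * k ^ 2) := by
        exact_mod_cast weight_le_pow hk
      refine h3.trans ?_
      have h4 : (k : ℝ) ^ (67 * k ^ 2) = (2 : ℝ) ^ ((67 : ℝ) * ((k : ℝ) ^ 2 * Real.logb 2 k)) := by
        rw [show (67 : ℝ) * ((k : ℝ) ^ 2 * Real.logb 2 k) =
          Real.logb 2 k * ((67 * k ^ 2 : ℕ) : ℝ) by push_cast; ring, Real.rpow_mul (by norm_num),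
          Real.rpow_logb (by norm_num) (by norm_num) hk0, Real.rpow_natCast]
      rw [h4]
      refine Real.rpow_le_rpow_of_exponent_le (by norm_num)
        (mul_le_mul_of_nonneg_right ?_ hlog)
      push_cast
      have : (0 : ℝ) ≤ C * M := by positivity
      linarith
    have h3 : (C : ℝ) ≤ ((C * M + 67 : ℕ) : ℝ) := by
      push_cast
      have : (C : ℝ) * 1 ≤ C * M := mul_le_mul_of_nonneg_left hMr (Nat.cast_nonneg _)
      linarith
    exact mul_le_mul h3 h2 (Nat.cast_nonneg _) (Nat.cast_nonneg _)

end CSR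

theorem theorem1 (ε : ℝ) (hε : 0 < ε) :
    ∃ (A : CSR.Program) (c : ℕ),
      ∀ (n k : ℕ) (X : Type*) [MetricSpace X] (P : Fin n ↪ X) (η : Fin n → ℕ), 0 < n →
        ∃ (t : ℕ) (s : CSR.State),
          CSR.Runs A (CSR.input P k η) t s ∧
          (t : ℝ) ≤ c * (2 : ℝ) ^ ((c : ℝ) * ((k : ℝ) ^ 2 * Real.logb 2 k)) * (n : ℝ) ^ 3 ∧
          ((∃ S : CSR.Solution n, CSR.Returns s S ∧ S.Feasible P k η ∧
              ∀ S' : CSR.Solution n, S'.Feasible P k η →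
                (S.cost : ℝ) ≤ (15 + ε) * (S'.cost : ℝ)) ∨
            (CSR.ReportsInfeasible s ∧ ∀ S : CSR.Solution n, ¬ S.Feasible P k η)) := by
  obtain ⟨c, hc⟩ := CSR.exists_time_bound
  refine ⟨.main, c, fun n k X _ P η hn => ?_⟩
  obtain ⟨t, s, hr, ht, h⟩ := CSR.exists_output (k := k) P η hn
  refine ⟨t, s, hr, (Nat.cast_le.2 ht).trans (hc n k hn), h.imp ?_ id⟩
  rintro ⟨S, h1, h2, h3⟩
  refine ⟨S, h1, h2, fun S' hS' => (h3 S' hS').trans ?_⟩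
  exact mul_le_mul_of_nonneg_right (by linarith) (Nat.cast_nonneg _)
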